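/- Let $n\ge 1$, let $\Omega\subseteq\mathbb R^n$ be a nonempty open set, let $s\in\mathbb R$ and $1<p<\infty$, and let $p'=p/(p-1)$. All functions, distributions and vector spaces are real. **Sobolev–Slobodeckij spaces.** For $t\ge 0$ and $1<q<\infty$, write $t=k+\theta$ with $k\in\mathbb N_0$ and $0\le\theta<1$. The space $W^{t,q}(\Omega)$ consists of the distributions $u\in D'(\Omega)$ for which $$\|u\|_{W^{t,q}(\Omega)}=\sum_{|\nu|\le k}\|\partial^\nu u\|_{L^q(\Omega)}+\sum_{|\nu|=k}|\partial^\nu u|_{W^{\theta,q}(\Omega)},\qquad |f|_{W^{\theta,q}(\Omega)}=\Big(\iint_{\Omega\times\Omega}\frac{|f(x)-f(y)|^q}{|x-y|^{n+\theta q}}\,dx\,dy\Big)^{1/q},$$ is finite, where the second sum is omitted if $\theta=0$. $W_0^{t,q}(\Omega)$ is the closure of $C_c^\infty(\Omega)$ in $W^{t,q}(\Omega)$. For $t<0$, $W^{t,q}(\Omega)$ is the dual Banach space $(W_0^{-t,q'}(\Omega))^*$, viewed as a subspace of $D'(\Omega)$ by restricting functionals to $C_c^\infty(\Omega)$. **The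 spaces $W_{comp}$ and $W_{loc}$.** For compact $K\subseteq\Omega$ let $W^{t,q}_K(\Omega)=\{u\in W^{t,q}(\Omega):\operatorname{supp}u\subseteq K\}$, with the norm of $W^{t,q}(\Omega)$. Let $W^{t,q}_{comp}(\Omega)=\bigcup_K W^{t,q}_K(\Omega)$, with the inductive limit topology: the finest topology that makes it a locally convex topological vector space and all inclusions $W^{t,q}_K(\Omega)\subseteq W^{t,q}_{comp}(\Omega)$ continuous. Let $W^{t,q}_{loc}(\Omega)=\{u\in D'(\Omega):\varphi u\in W^{t,q}(\Omega)\text{ for all }\varphi\in C_c^\infty(\Omega)\}$, with the topology defined by the seminorms $u\mapsto\|\varphi u\|_{W^{t,q}(\Omega)}$, $\varphi\in C_c^\infty(\Omega)$. **Further terms.** $(t,q,\Omega)$ is a *smooth multiplication triple* if for every $\varphi\in C_c^\infty(\Omega)$ the map $u\mapsto\varphi u$ is well defined and bounded from $W^{t,q}(\Omega)$ to $W^{t,q}(\Omega)$. The dual $X^*$ of a topological vector space $X$ is the space of continuous linear functionals with the strong topology (uniform convergence on bounded subsets of $X$). $X$ is *semireflexive* if the canonical map $J:X\to X^{**}$,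 $(Jx)(f)=f(x)$, is bijective, and *reflexive* if $J$ is a linear homeomorphism of $X$ onto $X^{**}$. **Statement.** Suppose that $(s,p,\Omega)$ and $(-s,p',\Omega)$ are smooth multiplication triples. Then 1. $W^{s,p}_{comp}(\Omega)$ is semireflexive; 2. $W^{s,p}_{comp}(\Omega)$ is reflexive; 3. the dual of $W^{s,p}_{comp}(\Omega)$ is $W^{-s,p'}_{loc}(\Omega)$: there is a linear homeomorphism $T:W^{-s,p'}_{loc}(\Omega)\to[W^{s,p}_{comp}(\Omega)]^*$ such that $T(u)(\varphi)=\langle u,\varphi\rangle$ for all $u\in W^{-s,p'}_{loc}(\Omega)$ and $\varphi\in C_c^\infty(\Omega)$; 4. $W^{-s,p'}_{loc}(\Omega)$ is reflexive. -/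

import Mathlib

open MeasureTheory TopologicalSpace Topology
open scoped ENNReal NNReal Distributions LineDeriv

noncomputable section

/-- An extended seminorm on a real vector space: a `[0,∞]`-valued absolutely homogeneous
subadditive function. -/
structure ExtSeminorm (V : Type*) [AddCommGroup V] [Module ℝ V] where
  toFun : V → ℝ≥0∞
  map_zero' : toFun 0 = 0
  add_le' : ∀ u v, toFun (u + v) ≤ toFun u + toFun v
  smul_le' : ∀ (c : ℝ) v, toFun (c • v) ≤ ‖c‖ₑ * toFun v

namespace ExtSeminorm

variable {V W : Type*} [AddCommGroup V] [Module ℝ V] [AddCommGroup W] [Module ℝ W]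

instance : CoeFun (ExtSeminorm V) (fun _ => V → ℝ≥0∞) := ⟨ExtSeminorm.toFun⟩

theorem map_smul (N : ExtSeminorm V) (c : ℝ) (v : V) : N (c • v) = ‖c‖ₑ * N v := by
  refine le_antisymm (N.smul_le' c v) ?_
  rcases eq_or_ne c 0 with rfl | hc
  · simp
  · have h := N.smul_le' c⁻¹ (c • v)
    rw [smul_smul, inv_mul_cancel₀ hc, one_smul] at h
    calc ‖c‖ₑ * N v ≤ ‖c‖ₑ * (‖c⁻¹‖ₑ * N (c • v)) := by gcongr
      _ = N (c • v) := by
        rw [← mul_assoc, ← enorm_mul, mul_inv_cancel₀ hc, enorm_one, one_mul]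

theorem toReal_smul_le (N : ExtSeminorm V) (c : ℝ) (v : V) :
    (N (c • v)).toReal ≤ ‖c‖ * (N v).toReal := by
  rw [N.map_smul, ENNReal.toReal_mul, toReal_enorm]

instance : Zero (ExtSeminorm V) := ⟨⟨fun _ => 0, rfl, by simp, by simp⟩⟩

instance : Add (ExtSeminorm V) := ⟨fun M N => ⟨fun v => M v + N v, by
    simp [M.map_zero', N.map_zero'], fun u v => by
    refine (add_le_add (M.add_le' u v) (N.add_le' u v)).trans_eq (by ring), fun c v => by
    refine (add_le_add (M.smul_le' c v) (N.smul_le' c v)).trans_eq (by ring)⟩⟩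

/-- The sum of a finite family of extended seminorms. -/
def sum {ι : Type*} (s : Finset ι) (N : ι → ExtSeminorm V) : ExtSeminorm V where
  toFun v := ∑ i ∈ s, N i v
  map_zero' := by simp [(N _).map_zero']
  add_le' u v := by
    rw [← Finset.sum_add_distrib]
    exact Finset.sum_le_sum fun i _ => (N i).add_le' u v
  smul_le' c v := by
    rw [Finset.mul_sum]
    exact Finset.sum_le_sum fun i _ => (N i).smul_le' c v

/-- The pull-back of an extended seminorm along a linear map. -/
def comp (N : ExtSeminorm W) (L : V →ₗ[ℝ] W) : ExtSeminorm V where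
  toFun v := N (L v)
  map_zero' := by simp [N.map_zero']
  add_le' u v := by simpa using N.add_le' (L u) (L v)
  smul_le' c v := by simpa using N.smul_le' c (L v)

/-- Transport of an extended seminorm along a linear relation `R`: the value at `v` is the infimum
of `N w` over all `w` related to `v`; in particular it is `∞` if there is no such `w`. -/
def transport (N : ExtSeminorm W) (R : Submodule ℝ (W × V)) : ExtSeminorm V where
  toFun v := ⨅ (w : W) (_ : (w, v) ∈ R), N w
  map_zero' := le_antisymm
    ((iInf₂_le (0 : W) (by exact R.zero_mem)).trans_eq N.map_zero') bot_le
  add_le' u v := by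
    simp_rw [ENNReal.iInf_add, ENNReal.add_iInf]
    refine le_iInf₂ fun w hw => le_iInf₂ fun w' hw' => ?_
    exact (iInf₂_le (w + w') (by exact R.add_mem hw hw')).trans (N.add_le' w w')
  smul_le' c v := by
    rcases eq_or_ne c 0 with rfl | hc
    · rw [zero_smul]
      exact ((iInf₂_le (0 : W) (by exact R.zero_mem)).trans_eq N.map_zero').trans bot_le
    · have hc0 : ‖c‖ₑ ≠ 0 := by simpa using hc
      simp_rw [ENNReal.mul_iInf_of_ne hc0 enorm_ne_top]
      refine le_iInf₂ fun w hw => ?_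
      exact (iInf₂_le (c • w) (by exact R.smul_mem c hw)).trans (N.smul_le' c w)

theorem transport_le (N : ExtSeminorm W) (R : Submodule ℝ (W × V)) {w : W} {v : V}
    (h : (w, v) ∈ R) : N.transport R v ≤ N w := iInf₂_le w h

theorem exists_of_transport_lt (N : ExtSeminorm W) (R : Submodule ℝ (W × V)) {v : V} {a : ℝ≥0∞}
    (h : N.transport R v < a) : ∃ w, (w, v) ∈ R ∧ N w < a := by
  simpa only [iInf_lt_iff, exists_prop] using
    (show (⨅ (w : W) (_ : (w, v) ∈ R), N w) < a from h)

theorem le_transport_mul (N : ExtSeminorm W) (R : Submodule ℝ (W × V)) {v : V}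
    (hv : N.transport R v < ∞) {a c : ℝ≥0∞} (hc : c ≠ ∞) (h : ∀ w, (w, v) ∈ R → a ≤ N w * c) :
    a ≤ N.transport R v * c := by
  rcases eq_or_ne c 0 with rfl | hc0
  · obtain ⟨w, hw, -⟩ := N.exists_of_transport_lt R hv
    simpa using h w hw
  · have : N.transport R v = ⨅ (w : W) (_ : (w, v) ∈ R), N w := rfl
    simp_rw [this, ENNReal.iInf_mul_of_ne hc0 hc]
    exact le_iInf₂ h

/-- The norm of a normed space, as an extended seminorm. -/
def ofNorm (W : Type*) [NormedAddCommGroup W] [NormedSpace ℝ W] : ExtSeminorm W where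
  toFun w := ‖w‖ₑ
  map_zero' := by simp
  add_le' u v := enorm_add_le u v
  smul_le' c v := (enorm_smul c v).le

/-- The subspace on which an extended seminorm is finite. -/
def finite (N : ExtSeminorm V) : Submodule ℝ V where
  carrier := {v | N v < ∞}
  zero_mem' := by simp [N.map_zero']
  add_mem' {u v} hu hv := (N.add_le' u v).trans_lt (ENNReal.add_lt_top.2 ⟨hu, hv⟩)
  smul_mem' c v hv := (N.smul_le' c v).trans_lt (ENNReal.mul_lt_top (by simp) hv)

/-- A definite extended seminorm `N` turns the subspace on which it is finite into a normed
space, with norm `N`. -/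
@[reducible]
def normedAddCommGroup (N : ExtSeminorm V) (h0 : ∀ v, N v = 0 → v = 0) :
    NormedAddCommGroup N.finite :=
  AddGroupNorm.toNormedAddCommGroup
    { toFun := fun v => (N v).toReal
      map_zero' := by simp [N.map_zero']
      add_le' := fun u v => by
        rw [← ENNReal.toReal_add u.2.ne v.2.ne]
        exact ENNReal.toReal_mono (ENNReal.add_lt_top.2 ⟨u.2, v.2⟩).ne (N.add_le' u v)
      neg' := fun u => by
        have := N.map_smul (-1) u
        simp only [neg_smul, one_smul, enorm_neg, enorm_one, one_mul] at this
        simp [this]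
      eq_zero_of_map_eq_zero' := fun u hu => by
        rcases (ENNReal.toReal_eq_zero_iff _).1 hu with h | h
        · exact Subtype.ext (h0 _ h)
        · exact absurd h u.2.ne }

end ExtSeminorm

/-! ### Distributions on an open set of `ℝⁿ` -/

namespace Sobolev

variable {n : ℕ}

/-- `ℝⁿ` with the Euclidean norm. -/
abbrev Rn (n : ℕ) : Type := EuclideanSpace ℝ (Fin n)

/-- The distribution `u` is given by the function `f`, i.e. `u φ = ∫_Ω f φ` for all `φ`. -/
def IsGivenBy {Ω : Opens (Rn n)} (u : 𝓓'(Ω, ℝ)) (f : Rn n → ℝ) : Prop :=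
  ∀ φ : 𝓓(Ω, ℝ), u φ = ∫ x in (Ω : Set (Rn n)), f x * φ x

theorem locallyIntegrableOn_test {Ω : Opens (Rn n)} (φ : 𝓓(Ω, ℝ)) :
    LocallyIntegrableOn φ Ω (volume.restrict (Ω : Set (Rn n))) :=
  (φ.continuous.locallyIntegrable (μ := volume.restrict (Ω : Set (Rn n)))).locallyIntegrableOn _

theorem integrable_mul_test {Ω : Opens (Rn n)} {f : Rn n → ℝ}
    (hf : LocallyIntegrableOn f Ω (volume.restrict (Ω : Set (Rn n)))) (φ : 𝓓(Ω, ℝ)) :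
    Integrable (fun x => f x * φ x) (volume.restrict (Ω : Set (Rn n))) := by
  simpa [mul_comm] using TestFunction.integrable_bilin (ContinuousLinearMap.mul ℝ ℝ) hf φ

/-- The distribution `ψ ↦ ∫ φ ψ` given by a test function `φ`. -/
def ofTest (Ω : Opens (Rn n)) : 𝓓(Ω, ℝ) →ₗ[ℝ] 𝓓'(Ω, ℝ) where
  toFun φ := ContinuousLinearMap.toUniformConvergenceCLM (RingHom.id ℝ) ℝ _
    (TestFunction.integralAgainstBilinCLM (ContinuousLinearMap.mul ℝ ℝ)
      (volume.restrict (Ω : Set (Rn n))) φ)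
  map_add' φ ψ := by
    ext χ
    have h1 := integrable_mul_test (locallyIntegrableOn_test φ) χ
    have h2 := integrable_mul_test (locallyIntegrableOn_test ψ) χ
    have h3 := locallyIntegrableOn_test (φ + ψ)
    simp only [ContinuousLinearMap.toUniformConvergenceCLM_apply,
      TestFunction.integralAgainstBilinCLM_apply, add_apply, locallyIntegrableOn_test, if_true,
      ContinuousLinearMap.mul_apply']
    rw [← integral_add (by simpa only [mul_comm] using h1) (by simpa only [mul_comm] using h2)]
    simp [mul_add]
  map_smul' c φ := by
    ext χ
    simp only [ContinuousLinearMap.toUniformConvergenceCLM_apply,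
      TestFunction.integralAgainstBilinCLM_apply, smul_apply, locallyIntegrableOn_test, if_true,
      ContinuousLinearMap.mul_apply', RingHom.id_apply, smul_eq_mul]
    rw [← integral_const_mul]
    simp [mul_left_comm]

theorem ofTest_apply {Ω : Opens (Rn n)} (φ ψ : 𝓓(Ω, ℝ)) :
    ofTest Ω φ ψ = ∫ x in (Ω : Set (Rn n)), φ x * ψ x := by
  simp [ofTest, locallyIntegrableOn_test, mul_comm]

/-- The partial derivative `∂^ν = ∂₁^{ν₁} ⋯ ∂ₙ^{νₙ}` of distributions, for a multi-index `ν`. -/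
def multiDeriv (Ω : Opens (Rn n)) (ν : Fin n → ℕ) : 𝓓'(Ω, ℝ) →ₗ[ℝ] 𝓓'(Ω, ℝ) :=
  (List.ofFn fun i : Fin n =>
    ((LineDeriv.lineDerivOpCLM ℝ 𝓓'(Ω, ℝ) (EuclideanSpace.single i (1 : ℝ)) :
      𝓓'(Ω, ℝ) →L[ℝ] 𝓓'(Ω, ℝ)) : 𝓓'(Ω, ℝ) →ₗ[ℝ] 𝓓'(Ω, ℝ)) ^ ν i).prod

/-- The multiplication of a test function by a test function `φ`. -/
def mulTest {Ω : Opens (Rn n)} (φ : 𝓓(Ω, ℝ)) : 𝓓(Ω, ℝ) →L[ℝ] 𝓓(Ω, ℝ) :=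
  TestFunction.limitCLM ℝ
    (fun ψ => ⟨fun x => φ x * ψ x, φ.contDiff.mul ψ.contDiff, ψ.hasCompactSupport.mul_left,
      (tsupport_mul_subset_right).trans ψ.tsupport_subset⟩)
    (fun _ hK => TestFunction.ofSupportedInCLM ℝ hK ∘L
      ContDiffMapSupportedIn.bilinLeftCLM (ContinuousLinearMap.mul ℝ ℝ) φ.contDiff)
    (fun _ _ ψ => by ext x; simp [mul_comm])

theorem mulTest_apply {Ω : Opens (Rn n)} (φ ψ : 𝓓(Ω, ℝ)) (x : Rn n) :
    mulTest φ ψ x = φ x * ψ x := rfl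

/-- The product `φ u` of a test function and a distribution: `(φ u)(ψ) = u (φ ψ)`. -/
def mulDistribution {Ω : Opens (Rn n)} (φ : 𝓓(Ω, ℝ)) : 𝓓'(Ω, ℝ) →ₗ[ℝ] 𝓓'(Ω, ℝ) where
  toFun u := ContinuousLinearMap.toUniformConvergenceCLM (RingHom.id ℝ) ℝ _
    ((ContinuousLinearMap.toUniformConvergenceCLM (RingHom.id ℝ) ℝ _).symm u ∘L mulTest φ)
  map_add' _ _ := rfl
  map_smul' _ _ := rfl

theorem mulDistribution_apply {Ω : Opens (Rn n)} (φ ψ : 𝓓(Ω, ℝ)) (u : 𝓓'(Ω, ℝ)) :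
    mulDistribution φ u ψ = u (mulTest φ ψ) := rfl


/-! ### Sobolev–Slobodeckij spaces -/

instance factOneLe (p : ℝ) [h : Fact (1 < p)] : Fact (1 ≤ ENNReal.ofReal p) :=
  ⟨by simpa using h.out.le⟩

instance factConjExponent (p : ℝ) [h : Fact (1 < p)] : Fact (1 < p.conjExponent) :=
  ⟨(Real.HolderConjugate.conjExponent h.out).symm.lt⟩

/-- `Lᵖ(Ω)`. -/
abbrev LpOn (Ω : Opens (Rn n)) (p : ℝ) : Type :=
  Lp ℝ (ENNReal.ofReal p) (volume.restrict (Ω : Set (Rn n)))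

theorem locallyIntegrableOn_Lp {Ω : Opens (Rn n)} {p : ℝ} [Fact (1 < p)] (f : LpOn Ω p) :
    LocallyIntegrableOn f Ω (volume.restrict (Ω : Set (Rn n))) :=
  ((Lp.memLp f).locallyIntegrable Fact.out).locallyIntegrableOn _

/-- The relation between functions in `Lᵖ(Ω)` and the distributions that they define. -/
def lpRel (Ω : Opens (Rn n)) (p : ℝ) [Fact (1 < p)] : Submodule ℝ (LpOn Ω p × 𝓓'(Ω, ℝ)) where
  carrier := {fu | IsGivenBy fu.2 fu.1}
  zero_mem' φ := by
    have h : (fun x => ((0 : LpOn Ω p) : Rn n → ℝ) x * φ x)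
        =ᵐ[volume.restrict (Ω : Set (Rn n))] 0 := by
      filter_upwards [Lp.coeFn_zero ℝ (ENNReal.ofReal p) (volume.restrict (Ω : Set (Rn n)))]
        with x hx
      rw [hx]
      simp
    simp only [Prod.fst_zero, Prod.snd_zero]
    rw [integral_congr_ae h]
    simp
  add_mem' {fu gv} hf hg φ := by
    have h : (fun x => ((fu.1 + gv.1 : LpOn Ω p) : Rn n → ℝ) x * φ x)
        =ᵐ[volume.restrict (Ω : Set (Rn n))] fun x => fu.1 x * φ x + gv.1 x * φ x := by
      filter_upwards [Lp.coeFn_add fu.1 gv.1] with x hx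
      rw [hx, Pi.add_apply, add_mul]
    simp only [Prod.fst_add, Prod.snd_add]
    rw [integral_congr_ae h, integral_add (integrable_mul_test (locallyIntegrableOn_Lp _) φ)
      (integrable_mul_test (locallyIntegrableOn_Lp _) φ), ← hf φ, ← hg φ]
    rfl
  smul_mem' c fu hf φ := by
    have h : (fun x => ((c • fu.1 : LpOn Ω p) : Rn n → ℝ) x * φ x)
        =ᵐ[volume.restrict (Ω : Set (Rn n))] fun x => c * (fu.1 x * φ x) := by
      filter_upwards [Lp.coeFn_smul c fu.1] with x hx
      rw [hx, Pi.smul_apply, smul_eq_mul, mul_assoc]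
    simp only [Prod.smul_fst, Prod.smul_snd]
    rw [integral_congr_ae h, integral_const_mul, ← hf φ]
    rfl

/-- The `Lᵖ(Ω)` norm of a distribution; it is `∞` if the distribution is not in `Lᵖ(Ω)`. -/
def lpNorm (Ω : Opens (Rn n)) (p : ℝ) [Fact (1 < p)] : ExtSeminorm 𝓓'(Ω, ℝ) :=
  (ExtSeminorm.ofNorm (LpOn Ω p)).transport (lpRel Ω p)

/-- The Slobodeckij difference quotient `(f x - f y) / |x - y|^{n/p + θ}`. -/
def slobodeckijQuotient (p θ : ℝ) (f : Rn n → ℝ) (z : Rn n × Rn n) : ℝ :=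
  (f z.1 - f z.2) / ‖z.1 - z.2‖ ^ (n / p + θ)

/-- Lebesgue measure on `Ω × Ω`. -/
abbrev volume₂ (Ω : Opens (Rn n)) : Measure (Rn n × Rn n) :=
  (volume.restrict (Ω : Set (Rn n))).prod (volume.restrict (Ω : Set (Rn n)))

theorem slobodeckijQuotient_congr {Ω : Opens (Rn n)} (p θ : ℝ) {f g : Rn n → ℝ}
    (h : f =ᵐ[volume.restrict (Ω : Set (Rn n))] g) :
    slobodeckijQuotient p θ f =ᵐ[volume₂ Ω] slobodeckijQuotient p θ g := by
  filter_upwards [Measure.quasiMeasurePreserving_fst.ae_eq_comp h,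
    Measure.quasiMeasurePreserving_snd.ae_eq_comp h] with z h1 h2
  simp only [Function.comp_apply] at h1 h2
  simp [slobodeckijQuotient, h1, h2]

theorem aestronglyMeasurable_slobodeckijQuotient {Ω : Opens (Rn n)} (p θ : ℝ) {f : Rn n → ℝ}
    (hf : AEStronglyMeasurable f (volume.restrict (Ω : Set (Rn n)))) :
    AEStronglyMeasurable (slobodeckijQuotient p θ f) (volume₂ Ω) := by
  have h1 := (hf.comp_fst (ν := volume.restrict (Ω : Set (Rn n)))).sub
    (hf.comp_snd (μ := volume.restrict (Ω : Set (Rn n))))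
  have h2 : Measurable fun z : Rn n × Rn n => ‖z.1 - z.2‖ ^ (n / p + θ) := by fun_prop
  exact (h1.aemeasurable.div h2.aemeasurable).aestronglyMeasurable

/-- The Slobodeckij seminorm
`(∫_Ω ∫_Ω |f x - f y|ᵖ / |x - y|^{n + θ p} dx dy)^{1/p}` of a function in `Lᵖ(Ω)`, that is, the
`Lᵖ(Ω × Ω)` norm of the difference quotient. -/
def slobodeckijLp (Ω : Opens (Rn n)) (p θ : ℝ) [Fact (1 < p)] : ExtSeminorm (LpOn Ω p) where
  toFun f := eLpNorm (slobodeckijQuotient p θ f) (ENNReal.ofReal p) (volume₂ Ω)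
  map_zero' := by
    rw [eLpNorm_congr_ae (slobodeckijQuotient_congr p θ (Lp.coeFn_zero _ _ _))]
    have : slobodeckijQuotient p θ (0 : Rn n → ℝ) = 0 := by ext; simp [slobodeckijQuotient]
    simp [this]
  add_le' f g := by
    rw [eLpNorm_congr_ae (slobodeckijQuotient_congr p θ (Lp.coeFn_add f g))]
    have : slobodeckijQuotient p θ (⇑f + ⇑g)
        = slobodeckijQuotient p θ f + slobodeckijQuotient p θ g := by
      ext z
      simp only [slobodeckijQuotient, Pi.add_apply]
      ring
    rw [this]
    exact eLpNorm_add_le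
      (aestronglyMeasurable_slobodeckijQuotient p θ (Lp.aestronglyMeasurable f))
      (aestronglyMeasurable_slobodeckijQuotient p θ (Lp.aestronglyMeasurable g)) Fact.out
  smul_le' c f := by
    rw [eLpNorm_congr_ae (slobodeckijQuotient_congr p θ (Lp.coeFn_smul c f))]
    have : slobodeckijQuotient p θ (c • ⇑f) = c • slobodeckijQuotient p θ f := by
      ext z
      simp only [slobodeckijQuotient, Pi.smul_apply, smul_eq_mul]
      ring
    rw [this, eLpNorm_const_smul]

/-- The Slobodeckij seminorm of a distribution; it is `∞` if the distribution is not
in `Lᵖ(Ω)`. -/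
def slobodeckijSeminorm (Ω : Opens (Rn n)) (p θ : ℝ) [Fact (1 < p)] : ExtSeminorm 𝓓'(Ω, ℝ) :=
  (slobodeckijLp Ω p θ).transport (lpRel Ω p)

/-- The norm of `W^{s,p}(Ω)` for `s = k + θ ≥ 0`, where `k` is an integer and `0 ≤ θ < 1`: it is
`∑_{|ν| ≤ k} ‖∂^ν u‖_{Lᵖ}`, plus `∑_{|ν| = k} |∂^ν u|_{W^{θ,p}}` if `θ ≠ 0`. -/
def normNonneg (Ω : Opens (Rn n)) (s p : ℝ) [Fact (1 < p)] : ExtSeminorm 𝓓'(Ω, ℝ) :=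
  ExtSeminorm.sum (Finset.range (⌊s⌋₊ + 1)) (fun m =>
      ExtSeminorm.sum (Finset.piAntidiag Finset.univ m) fun ν =>
        (lpNorm Ω p).comp (multiDeriv Ω ν)) +
    if Int.fract s = 0 then 0 else
      ExtSeminorm.sum (Finset.piAntidiag Finset.univ ⌊s⌋₊) fun ν =>
        (slobodeckijSeminorm Ω p (Int.fract s)).comp (multiDeriv Ω ν)

theorem lpNorm_le_normNonneg (Ω : Opens (Rn n)) (s p : ℝ) [Fact (1 < p)] (u : 𝓓'(Ω, ℝ)) :
    lpNorm Ω p u ≤ normNonneg Ω s p u := by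
  have h0 : multiDeriv Ω 0 = LinearMap.id := by
    simp only [multiDeriv, Pi.zero_apply, pow_zero, List.ofFn_const, List.prod_replicate, one_pow]
    rfl
  refine le_trans ?_ (le_add_of_nonneg_right bot_le)
  refine le_trans ?_ (Finset.single_le_sum (f := fun m => ExtSeminorm.sum
      (Finset.piAntidiag Finset.univ m) (fun ν => (lpNorm Ω p).comp (multiDeriv Ω ν)) u)
      (fun _ _ => bot_le) (Finset.mem_range.2 (Nat.succ_pos ⌊s⌋₊)))
  refine le_trans ?_ (Finset.single_le_sum (f := fun ν => (lpNorm Ω p).comp (multiDeriv Ω ν) u)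
      (fun _ _ => bot_le) (a := (0 : Fin n → ℕ)) (by simp))
  simp [ExtSeminorm.comp, h0]

theorem lintegral_radial_lt_top [NeZero n] {p θ A B : ℝ} (hp : 1 < p) (hθ : 0 < θ) (hθ1 : θ < 1) :
    ∫⁻ w : Rn n, ENNReal.ofReal (if ‖w‖ ≤ 1 then A * ‖w‖ ^ (p - n - θ * p)
      else B * ‖w‖ ^ (-n - θ * p)) < ∞ := by
  have : Nontrivial (Rn n) := by
    have : Nonempty (Fin n) := ⟨⟨0, Nat.pos_of_ne_zero (NeZero.ne n)⟩⟩
    infer_instance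
  have hn : 1 ≤ n := Nat.pos_of_ne_zero (NeZero.ne n)
  have key : Integrable (fun w : Rn n => (fun r : ℝ => if r ≤ 1 then A * r ^ (p - n - θ * p)
      else B * r ^ (-n - θ * p)) ‖w‖) volume := by
    refine (integrable_fun_norm_addHaar (volume : Measure (Rn n)) (f := fun r : ℝ =>
      if r ≤ 1 then A * r ^ (p - n - θ * p) else B * r ^ (-n - θ * p))).2 ?_
    rw [← Set.Ioc_union_Ioi_eq_Ioi (zero_le_one' ℝ),
      integrableOn_union]
    constructor
    · have h1 : IntegrableOn (fun r : ℝ => A * r ^ (p * (1 - θ) - 1)) (Set.Ioc 0 1) := by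
        refine Integrable.const_mul ?_ A
        have := intervalIntegral.intervalIntegrable_rpow' (a := 0) (b := 1)
          (r := p * (1 - θ) - 1) (by nlinarith)
        rwa [intervalIntegrable_iff_integrableOn_Ioc_of_le zero_le_one] at this
      refine h1.congr_fun (fun r hr => ?_) measurableSet_Ioc
      simp only [hr.2, if_true, finrank_euclideanSpace, Fintype.card_fin, smul_eq_mul]
      rw [← Real.rpow_natCast, mul_left_comm, ← Real.rpow_add hr.1, Nat.cast_sub hn]
      congr 2
      push_cast
      ring
    · have h1 : IntegrableOn (fun r : ℝ => B * r ^ (-1 - θ * p)) (Set.Ioi 1) :=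
        Integrable.const_mul (integrableOn_Ioi_rpow_of_lt (by nlinarith) one_pos) B
      refine h1.congr_fun (fun r hr => ?_) measurableSet_Ioi
      have hr' : ¬ r ≤ 1 := not_le.2 hr
      have hr0 : 0 < r := one_pos.trans hr
      simp only [hr', if_false, finrank_euclideanSpace, Fintype.card_fin, smul_eq_mul]
      rw [← Real.rpow_natCast, mul_left_comm, ← Real.rpow_add hr0, Nat.cast_sub hn]
      congr 2
      push_cast
      ring
  exact (lintegral_ofReal_le_lintegral_enorm _).trans_lt key.2

theorem eLpNorm_slobodeckijQuotient_lt_top {p θ : ℝ} (hp : 1 < p) (hθ : 0 < θ) (hθ1 : θ < 1)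
    {f : Rn n → ℝ} (hf : ContDiff ℝ 1 f) (hc : HasCompactSupport f) :
    eLpNorm (slobodeckijQuotient p θ f) (ENNReal.ofReal p)
      ((volume : Measure (Rn n)).prod volume) < ∞ := by
  rcases eq_or_ne n 0 with rfl | hn
  · have : slobodeckijQuotient p θ f = 0 := by
      ext z
      simp [slobodeckijQuotient, Subsingleton.elim z.1 z.2]
    simp [this]
  have : NeZero n := ⟨hn⟩
  have hp0 : 0 < p := one_pos.trans hp
  obtain ⟨L, hL⟩ := hf.lipschitzWith_of_hasCompactSupport hc one_ne_zero
  obtain ⟨M, hM⟩ := hf.continuous.bounded_above_of_compact_support hc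
  set K := tsupport f with hK
  have hKm : MeasurableSet K := (isClosed_tsupport f).measurableSet
  set H : Rn n → ℝ≥0∞ := fun w => ENNReal.ofReal (if ‖w‖ ≤ 1 then
    (L : ℝ) ^ p * ‖w‖ ^ (p - n - θ * p) else (2 * M) ^ p * ‖w‖ ^ (-n - θ * p)) with hH
  have hHm : Measurable H := by
    refine ENNReal.measurable_ofReal.comp (Measurable.ite ?_ (by fun_prop) (by fun_prop))
    exact measurableSet_le measurable_norm measurable_const
  have hHi : ∫⁻ w, H w < ∞ := lintegral_radial_lt_top hp hθ hθ1
  have hM0 : 0 ≤ M := (norm_nonneg _).trans (hM 0)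
  have hbound (x y : Rn n) (hxy : x ≠ y) :
      ‖slobodeckijQuotient p θ f (x, y)‖ₑ ^ p ≤ H (x - y) := by
    have hr : 0 < ‖x - y‖ := norm_pos_iff.2 (sub_ne_zero.2 hxy)
    have e1 : ‖slobodeckijQuotient p θ f (x, y)‖ₑ ^ p
        = ENNReal.ofReal (|f x - f y| ^ p * ‖x - y‖ ^ (-n - θ * p)) := by
      rw [← ofReal_norm, ENNReal.ofReal_rpow_of_nonneg (norm_nonneg _) hp0.le]
      congr 1
      rw [slobodeckijQuotient, norm_div, Real.norm_eq_abs, Real.norm_eq_abs,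
        abs_of_nonneg (Real.rpow_nonneg hr.le _), Real.div_rpow (abs_nonneg _)
        (Real.rpow_nonneg hr.le _), ← Real.rpow_mul hr.le, div_eq_mul_inv,
        ← Real.rpow_neg hr.le]
      congr 2
      field_simp
      ring
    rw [e1]
    refine ENNReal.ofReal_le_ofReal ?_
    split_ifs with h
    · have h1 : |f x - f y| ≤ L * ‖x - y‖ := by
        simpa [dist_eq_norm] using hL.dist_le_mul x y
      calc |f x - f y| ^ p * ‖x - y‖ ^ (-n - θ * p)
          ≤ (L * ‖x - y‖) ^ p * ‖x - y‖ ^ (-n - θ * p) := by gcongr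
        _ = L ^ p * ‖x - y‖ ^ (p - n - θ * p) := by
          rw [Real.mul_rpow (NNReal.coe_nonneg L) hr.le, mul_assoc, ← Real.rpow_add hr]
          congr 2
          ring
    · have h1 : |f x - f y| ≤ 2 * M := by
        have := (abs_sub (f x) (f y)).trans (add_le_add (hM x) (hM y))
        linarith
      gcongr
  have hpt (z : Rn n × Rn n) : ‖slobodeckijQuotient p θ f z‖ₑ ^ p ≤
      K.indicator 1 z.1 * H (z.1 - z.2) + K.indicator 1 z.2 * H (z.1 - z.2) := by
    by_cases h : z.1 = z.2
    · simp [slobodeckijQuotient, h, hp0]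
    · by_cases h1 : z.1 ∈ K
      · simpa [h1] using (hbound z.1 z.2 h).trans le_self_add
      · by_cases h2 : z.2 ∈ K
        · simpa [h1, h2] using hbound z.1 z.2 h
        · simp [slobodeckijQuotient, image_eq_zero_of_notMem_tsupport h1,
            image_eq_zero_of_notMem_tsupport h2, hp0]
  have hKv : volume K < ∞ := hc.measure_lt_top
  have hind : Measurable (K.indicator (1 : Rn n → ℝ≥0∞)) := measurable_one.indicator hKm
  rw [eLpNorm_lt_top_iff_lintegral_rpow_enorm_lt_top (by simpa using hp0) ENNReal.ofReal_ne_top,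
    ENNReal.toReal_ofReal hp0.le]
  refine (lintegral_mono hpt).trans_lt ?_
  rw [lintegral_add_left (by fun_prop)]
  refine ENNReal.add_lt_top.2 ⟨?_, ?_⟩
  · rw [lintegral_prod _ (by fun_prop)]
    have h (x : Rn n) : ∫⁻ y, K.indicator 1 x * H (x - y) = K.indicator 1 x * ∫⁻ w, H w := by
      rw [lintegral_const_mul _ (by fun_prop), lintegral_sub_left_eq_self H x]
    simp_rw [h]
    rw [lintegral_mul_const _ hind, lintegral_indicator_one hKm]
    exact ENNReal.mul_lt_top hKv hHi
  · rw [lintegral_prod_symm _ (by fun_prop)]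
    have h (y : Rn n) : ∫⁻ x, K.indicator 1 y * H (x - y) = K.indicator 1 y * ∫⁻ w, H w := by
      rw [lintegral_const_mul _ (by fun_prop), lintegral_sub_right_eq_self H y]
    simp_rw [h]
    rw [lintegral_mul_const _ hind, lintegral_indicator_one hKm]
    exact ENNReal.mul_lt_top hKv hHi

theorem memLp_test {Ω : Opens (Rn n)} (φ : 𝓓(Ω, ℝ)) (q : ℝ≥0∞) :
    MemLp φ q (volume.restrict (Ω : Set (Rn n))) :=
  φ.continuous.memLp_of_hasCompactSupport φ.hasCompactSupport

theorem enorm_apply_le_lpNorm {Ω : Opens (Rn n)} {p : ℝ} [Fact (1 < p)] (u : 𝓓'(Ω, ℝ))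
    (hu : lpNorm Ω p u < ∞) (φ : 𝓓(Ω, ℝ)) : ‖u φ‖ₑ ≤ lpNorm Ω p u *
      eLpNorm φ (ENNReal.ofReal p.conjExponent) (volume.restrict (Ω : Set (Rn n))) := by
  refine ExtSeminorm.le_transport_mul _ _ hu (memLp_test φ _).2.ne fun f hf => ?_
  have hpq := Real.HolderConjugate.conjExponent (Fact.out : 1 < p)
  have : (ENNReal.ofReal p).HolderConjugate (ENNReal.ofReal p.conjExponent) := hpq.ennrealOfReal
  rw [show u φ = _ from hf φ]
  refine (enorm_integral_le_lintegral_enorm _).trans ?_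
  have h := eLpNorm_smul_le_mul_eLpNorm (r := 1) (p := ENNReal.ofReal p)
    (q := ENNReal.ofReal p.conjExponent) (μ := volume.restrict (Ω : Set (Rn n)))
    (memLp_test φ 1).1 (Lp.aestronglyMeasurable f)
  rw [eLpNorm_one_eq_lintegral_enorm] at h
  refine (h.trans_eq ?_)
  change _ = ‖f‖ₑ * _
  rw [Lp.enorm_def]

theorem eq_zero_of_normNonneg {Ω : Opens (Rn n)} {s p : ℝ} [Fact (1 < p)] (u : 𝓓'(Ω, ℝ))
    (h : normNonneg Ω s p u = 0) : u = 0 := by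
  have h0 : lpNorm Ω p u = 0 := le_antisymm ((lpNorm_le_normNonneg Ω s p u).trans_eq h) bot_le
  ext φ
  have := enorm_apply_le_lpNorm u (by rw [h0]; exact ENNReal.zero_lt_top) φ
  rw [h0, zero_mul] at this
  exact enorm_eq_zero.1 (le_antisymm this bot_le)

theorem lineDeriv_ofTest {Ω : Opens (Rn n)} (v : Rn n) (φ : 𝓓(Ω, ℝ)) :
    (∂_{v} (ofTest Ω φ) : 𝓓'(Ω, ℝ)) = ofTest Ω (∂_{v} φ) := by
  ext ψ
  rw [Distribution.lineDerivOp_apply_apply, map_neg, ofTest_apply, ofTest_apply]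
  have hsub (f g : 𝓓(Ω, ℝ)) :
      ∫ x in (Ω : Set (Rn n)), f x * g x = ∫ x, f x * g x :=
    setIntegral_eq_integral_of_forall_compl_eq_zero fun x hx => by
      rw [image_eq_zero_of_notMem_tsupport fun h => hx (f.tsupport_subset h), zero_mul]
  have hint (f g : 𝓓(Ω, ℝ)) : Integrable (fun x => f x * g x) :=
    (f.continuous.mul g.continuous).integrable_of_hasCompactSupport f.hasCompactSupport.mul_right
  have hd (f : 𝓓(Ω, ℝ)) (x : Rn n) : DifferentiableAt ℝ f x :=
    (f.contDiff.differentiable (by simp)).differentiableAt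
  rw [hsub, hsub]
  have := integral_mul_fderiv_eq_neg_fderiv_mul_of_integrable (v := v) (f := φ) (g := ψ)
    (hint (∂_{v} φ) ψ) (hint φ (∂_{v} ψ)) (hint φ ψ) (fun x _ => hd φ x) (fun x _ => hd ψ x)
  refine Eq.trans (congrArg Neg.neg this) ?_
  rw [neg_neg]
  rfl

theorem multiDeriv_ofTest {Ω : Opens (Rn n)} (ν : Fin n → ℕ) (φ : 𝓓(Ω, ℝ)) :
    ∃ ψ : 𝓓(Ω, ℝ), multiDeriv Ω ν (ofTest Ω φ) = ofTest Ω ψ := by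
  let S : Submonoid (Module.End ℝ 𝓓'(Ω, ℝ)) :=
    { carrier := {L | ∀ φ, ∃ ψ, L (ofTest Ω φ) = ofTest Ω ψ}
      one_mem' := fun φ => ⟨φ, rfl⟩
      mul_mem' := fun {L M} hL hM φ => by
        obtain ⟨ψ, hψ⟩ := hM φ
        obtain ⟨χ, hχ⟩ := hL ψ
        exact ⟨χ, by rw [Module.End.mul_apply, hψ, hχ]⟩ }
  suffices h : multiDeriv Ω ν ∈ S from h φ
  refine S.list_prod_mem fun L hL => ?_
  obtain ⟨i, rfl⟩ := List.mem_ofFn.1 hL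
  exact S.pow_mem (fun φ => ⟨_, lineDeriv_ofTest _ φ⟩) _

theorem lpRel_test {Ω : Opens (Rn n)} (p : ℝ) [Fact (1 < p)] (φ : 𝓓(Ω, ℝ)) :
    ((memLp_test φ (ENNReal.ofReal p)).toLp φ, ofTest Ω φ) ∈ lpRel Ω p := by
  intro ψ
  rw [ofTest_apply]
  refine integral_congr_ae ?_
  filter_upwards [(memLp_test φ (ENNReal.ofReal p)).coeFn_toLp] with x hx
  rw [hx]

theorem normNonneg_ofTest_lt (Ω : Opens (Rn n)) (s p : ℝ) [Fact (1 < p)] (φ : 𝓓(Ω, ℝ)) :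
    normNonneg Ω s p (ofTest Ω φ) < ∞ := by
  refine ENNReal.add_lt_top.2 ⟨?_, ?_⟩
  · simp only [ExtSeminorm.sum]
    refine ENNReal.sum_lt_top.2 fun m _ => ENNReal.sum_lt_top.2 fun ν _ => ?_
    obtain ⟨ψ, hψ⟩ := multiDeriv_ofTest ν φ
    simp only [ExtSeminorm.comp, hψ]
    refine (ExtSeminorm.transport_le _ _ (lpRel_test p ψ)).trans_lt ?_
    exact enorm_lt_top
  · split_ifs with hs
    · exact ENNReal.zero_lt_top
    · simp only [ExtSeminorm.sum]
      refine ENNReal.sum_lt_top.2 fun ν _ => ?_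
      obtain ⟨ψ, hψ⟩ := multiDeriv_ofTest ν φ
      simp only [ExtSeminorm.comp, hψ]
      refine (ExtSeminorm.transport_le _ _ (lpRel_test p ψ)).trans_lt ?_
      simp only [slobodeckijLp]
      rw [eLpNorm_congr_ae (slobodeckijQuotient_congr p _ (MemLp.coeFn_toLp _)),
        volume₂, Measure.prod_restrict]
      exact (eLpNorm_mono_measure _ Measure.restrict_le_self).trans_lt
        (eLpNorm_slobodeckijQuotient_lt_top Fact.out
          (lt_of_le_of_ne (Int.fract_nonneg s) (Ne.symm hs)) (Int.fract_lt_one s)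
          (ψ.contDiff.of_le (by simp)) ψ.hasCompactSupport)

/-- `W^{s,p}(Ω)` for `s ≥ 0`, as a normed space. -/
def SobolevNonneg (Ω : Opens (Rn n)) (s p : ℝ) [Fact (1 < p)] : Type :=
  (normNonneg Ω s p).finite

instance (Ω : Opens (Rn n)) (s p : ℝ) [Fact (1 < p)] :
    NormedAddCommGroup (SobolevNonneg Ω s p) :=
  (normNonneg Ω s p).normedAddCommGroup eq_zero_of_normNonneg

instance (Ω : Opens (Rn n)) (s p : ℝ) [Fact (1 < p)] : Module ℝ (SobolevNonneg Ω s p) :=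
  inferInstanceAs (Module ℝ (normNonneg Ω s p).finite)

instance (Ω : Opens (Rn n)) (s p : ℝ) [Fact (1 < p)] : NormedSpace ℝ (SobolevNonneg Ω s p) where
  norm_smul_le c u := (normNonneg Ω s p).toReal_smul_le c u.1

/-- The test functions in `W^{s,p}(Ω)`, `s ≥ 0`. -/
def testNonneg (Ω : Opens (Rn n)) (s p : ℝ) [Fact (1 < p)] :
    𝓓(Ω, ℝ) →ₗ[ℝ] SobolevNonneg Ω s p :=
  (ofTest Ω).codRestrict (normNonneg Ω s p).finite (normNonneg_ofTest_lt Ω s p)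

/-- `W_0^{s,p}(Ω)` for `s ≥ 0`: the closure of the test functions in `W^{s,p}(Ω)`. -/
abbrev SobolevZero (Ω : Opens (Rn n)) (s p : ℝ) [Fact (1 < p)] :
    Submodule ℝ (SobolevNonneg Ω s p) :=
  (LinearMap.range (testNonneg Ω s p)).topologicalClosure

/-- The test functions in `W_0^{s,p}(Ω)`, `s ≥ 0`. -/
def testZero (Ω : Opens (Rn n)) (s p : ℝ) [Fact (1 < p)] : 𝓓(Ω, ℝ) →ₗ[ℝ] SobolevZero Ω s p :=
  (testNonneg Ω s p).codRestrict _ fun φ =>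
    Submodule.le_topologicalClosure _ (LinearMap.mem_range_self _ φ)

/-- The relation between continuous linear functionals on `W_0^{s,p}(Ω)`, `s ≥ 0`, and the
distributions to which they restrict. -/
def dualRel (Ω : Opens (Rn n)) (s p : ℝ) [Fact (1 < p)] :
    Submodule ℝ (StrongDual ℝ (SobolevZero Ω s p) × 𝓓'(Ω, ℝ)) where
  carrier := {Fu | ∀ φ : 𝓓(Ω, ℝ), Fu.2 φ = Fu.1 (testZero Ω s p φ)}
  zero_mem' _ := rfl
  add_mem' {Fu Gv} hF hG φ := by
    simpa using congrArg₂ (· + ·) (hF φ) (hG φ)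
  smul_mem' c Fu hF φ := by
    simpa using congrArg (c * ·) (hF φ)

/-- The norm of `(W_0^{s,p}(Ω))*`, `s ≥ 0`, on distributions; it is `∞` if the distribution does
not extend to a continuous linear functional on `W_0^{s,p}(Ω)`. -/
def normDual (Ω : Opens (Rn n)) (s p : ℝ) [Fact (1 < p)] : ExtSeminorm 𝓓'(Ω, ℝ) :=
  (ExtSeminorm.ofNorm (StrongDual ℝ (SobolevZero Ω s p))).transport (dualRel Ω s p)

theorem eq_zero_of_normDual {Ω : Opens (Rn n)} {s p : ℝ} [Fact (1 < p)] (u : 𝓓'(Ω, ℝ))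
    (h : normDual Ω s p u = 0) : u = 0 := by
  ext φ
  have : ‖u φ‖ₑ ≤ normDual Ω s p u * ‖testZero Ω s p φ‖ₑ := by
    refine ExtSeminorm.le_transport_mul _ _ ?_ enorm_ne_top fun F hF => ?_
    · exact h.trans_lt ENNReal.zero_lt_top
    · rw [show u φ = _ from hF φ]
      exact F.le_opENorm _
  rw [h, zero_mul] at this
  exact enorm_eq_zero.1 (le_antisymm this bot_le)

theorem normDual_ofTest_lt (Ω : Opens (Rn n)) (s p : ℝ) [Fact (1 < p)] (φ : 𝓓(Ω, ℝ)) :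
    normDual Ω s p (ofTest Ω φ) < ∞ := by
  let f : SobolevZero Ω s p →ₗ[ℝ] ℝ :=
    { toFun := fun w => w.1.1 φ
      map_add' := fun _ _ => rfl
      map_smul' := fun _ _ => rfl }
  set C := eLpNorm φ (ENNReal.ofReal p.conjExponent) (volume.restrict (Ω : Set (Rn n)))
  have hC : C < ∞ := (memLp_test φ _).2
  have hf (w : SobolevZero Ω s p) : ‖f w‖ ≤ C.toReal * ‖w‖ := by
    have h1 : lpNorm Ω p w.1.1 ≤ normNonneg Ω s p w.1.1 := lpNorm_le_normNonneg Ω s p _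
    have h2 : normNonneg Ω s p w.1.1 < ∞ := w.1.2
    have h3 := (enorm_apply_le_lpNorm w.1.1 (h1.trans_lt h2) φ).trans (mul_le_mul_left h1 C)
    have h4 := ENNReal.toReal_mono (ENNReal.mul_lt_top h2 hC).ne h3
    rw [ENNReal.toReal_mul, mul_comm, toReal_enorm] at h4
    exact h4
  refine (ExtSeminorm.transport_le _ _ (w := f.mkContinuous _ hf) fun ψ => ?_).trans_lt ?_
  · change ofTest Ω φ ψ = ofTest Ω ψ φ
    simp only [ofTest_apply, mul_comm]
  · exact enorm_lt_top

/-- The norm of `W^{s,p}(Ω)`, `s ∈ ℝ`, on distributions, where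
`W^{s,p}(Ω) = (W_0^{-s,p'}(Ω))*` for `s < 0`; it is `∞` outside of `W^{s,p}(Ω)`. -/
def sobolevNorm (Ω : Opens (Rn n)) (s p : ℝ) [Fact (1 < p)] : ExtSeminorm 𝓓'(Ω, ℝ) :=
  if 0 ≤ s then normNonneg Ω s p else normDual Ω (-s) p.conjExponent

theorem eq_zero_of_sobolevNorm {Ω : Opens (Rn n)} {s p : ℝ} [Fact (1 < p)] (u : 𝓓'(Ω, ℝ))
    (h : sobolevNorm Ω s p u = 0) : u = 0 := by
  unfold sobolevNorm at h
  split_ifs at h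
  · exact eq_zero_of_normNonneg u h
  · exact eq_zero_of_normDual u h

theorem sobolevNorm_ofTest_lt (Ω : Opens (Rn n)) (s p : ℝ) [Fact (1 < p)] (φ : 𝓓(Ω, ℝ)) :
    sobolevNorm Ω s p (ofTest Ω φ) < ∞ := by
  unfold sobolevNorm
  split_ifs
  · exact normNonneg_ofTest_lt Ω s p φ
  · exact normDual_ofTest_lt Ω _ _ φ

/-- The Sobolev–Slobodeckij space `W^{s,p}(Ω)`, `s ∈ ℝ`, `1 < p < ∞`, as a normed space of
distributions on `Ω`. -/
def SobolevSpace (Ω : Opens (Rn n)) (s p : ℝ) [Fact (1 < p)] : Type :=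
  (sobolevNorm Ω s p).finite

instance (Ω : Opens (Rn n)) (s p : ℝ) [Fact (1 < p)] :
    NormedAddCommGroup (SobolevSpace Ω s p) :=
  (sobolevNorm Ω s p).normedAddCommGroup eq_zero_of_sobolevNorm

instance (Ω : Opens (Rn n)) (s p : ℝ) [Fact (1 < p)] : Module ℝ (SobolevSpace Ω s p) :=
  inferInstanceAs (Module ℝ (sobolevNorm Ω s p).finite)

instance (Ω : Opens (Rn n)) (s p : ℝ) [Fact (1 < p)] : NormedSpace ℝ (SobolevSpace Ω s p) where
  norm_smul_le c u := (sobolevNorm Ω s p).toReal_smul_le c u.1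

/-- The inclusion `W^{s,p}(Ω) ⊆ 𝓓'(Ω)`. -/
def SobolevSpace.toDistribution (Ω : Opens (Rn n)) (s p : ℝ) [Fact (1 < p)] :
    SobolevSpace Ω s p →ₗ[ℝ] 𝓓'(Ω, ℝ) :=
  (sobolevNorm Ω s p).finite.subtype

instance (Ω : Opens (Rn n)) (s p : ℝ) [Fact (1 < p)] :
    CoeOut (SobolevSpace Ω s p) 𝓓'(Ω, ℝ) := ⟨SobolevSpace.toDistribution Ω s p⟩

/-- `(s, p, Ω)` is a smooth multiplication triple: for every test function `φ`, the multiplication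
by `φ` is a well-defined continuous linear map of `W^{s,p}(Ω)` to itself. -/
def IsSmoothMultiplicationTriple (Ω : Opens (Rn n)) (s p : ℝ) [Fact (1 < p)] : Prop :=
  ∀ φ : 𝓓(Ω, ℝ), ∃ m : SobolevSpace Ω s p →L[ℝ] SobolevSpace Ω s p,
    ∀ u : SobolevSpace Ω s p, (m u : 𝓓'(Ω, ℝ)) = mulDistribution φ (u : 𝓓'(Ω, ℝ))

/-! ### The spaces `W_K`, `W_comp` and `W_loc` -/

/-- The distributions with support in `K`. -/
def supportedIn (Ω : Opens (Rn n)) (K : Set (Rn n)) :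
    Submodule ℝ 𝓓'(Ω, ℝ) where
  carrier := {u | Distribution.dsupport u ⊆ K}
  zero_mem' := by
    intro x hx
    by_contra
    exact (Distribution.notMem_dsupport_iff x).2 ⟨Set.univ, fun _ _ => rfl, isOpen_univ, trivial⟩ hx
  add_mem' {u v} hu hv := by
    intro x hx
    by_contra hxK
    obtain ⟨s, hs, hso, hxs⟩ := (Distribution.notMem_dsupport_iff x).1 fun h => hxK (hu h)
    obtain ⟨t, ht, hto, hxt⟩ := (Distribution.notMem_dsupport_iff x).1 fun h => hxK (hv h)
    refine (Distribution.notMem_dsupport_iff x).2 ⟨s ∩ t, fun φ hφ => ?_, hso.inter hto, hxs, hxt⟩ hx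
    have h1 := hs φ (hφ.trans Set.inter_subset_left)
    have h2 := ht φ (hφ.trans Set.inter_subset_right)
    change u φ + v φ = 0
    rw [h1, h2, add_zero]
  smul_mem' c u hu := by
    refine (Distribution.dsupport_subset_dsupport fun s _ hs φ hφ => ?_).trans hu
    change c • u φ = 0
    rw [hs φ hφ, smul_zero]

/-- `W^{s,p}_K(Ω)`: the elements of `W^{s,p}(Ω)` with support in `K`, with the norm of
`W^{s,p}(Ω)`. (For a compact set `K ⊆ Ω`, the smallest relatively closed subset of `Ω` outside of
which `u` vanishes is contained in `K` if and only if `Distribution.dsupport u ⊆ K`.) -/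
abbrev SobolevSupp (Ω : Opens (Rn n)) (s p : ℝ) [Fact (1 < p)] (K : Set (Rn n)) :
    Submodule ℝ (SobolevSpace Ω s p) :=
  (supportedIn Ω K).comap (SobolevSpace.toDistribution Ω s p)

/-- The union of the `W^{s,p}_K(Ω)` over all compact sets `K ⊆ Ω`, as a subspace of `𝓓'(Ω)`. -/
def compSubmodule (Ω : Opens (Rn n)) (s p : ℝ) [Fact (1 < p)] : Submodule ℝ 𝓓'(Ω, ℝ) where
  carrier := {u | sobolevNorm Ω s p u < ∞ ∧
    ∃ K : Compacts (Rn n), (K : Set (Rn n)) ⊆ Ω ∧ u ∈ supportedIn Ω (K : Set (Rn n))}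
  zero_mem' := ⟨(sobolevNorm Ω s p).finite.zero_mem, ⊥, by simp, Submodule.zero_mem _⟩
  add_mem' {u v} := by
    rintro ⟨hu, K, hK, huK⟩ ⟨hv, L, hL, hvL⟩
    refine ⟨(sobolevNorm Ω s p).finite.add_mem hu hv, K ⊔ L, by simp [hK, hL],
      Submodule.add_mem _ ?_ ?_⟩
    · exact Set.Subset.trans huK (by simp)
    · exact Set.Subset.trans hvL (by simp)
  smul_mem' c u := by
    rintro ⟨hu, K, hK, huK⟩
    exact ⟨(sobolevNorm Ω s p).finite.smul_mem c hu, K, hK, Submodule.smul_mem _ c huK⟩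

/-- `W^{s,p}_comp(Ω)`. Its topology is defined below. -/
def SobolevComp (Ω : Opens (Rn n)) (s p : ℝ) [Fact (1 < p)] : Type :=
  compSubmodule Ω s p

instance (Ω : Opens (Rn n)) (s p : ℝ) [Fact (1 < p)] : AddCommGroup (SobolevComp Ω s p) :=
  inferInstanceAs (AddCommGroup (compSubmodule Ω s p))

instance (Ω : Opens (Rn n)) (s p : ℝ) [Fact (1 < p)] : Module ℝ (SobolevComp Ω s p) :=
  inferInstanceAs (Module ℝ (compSubmodule Ω s p))

/-- The inclusion `W^{s,p}_K(Ω) ⊆ W^{s,p}_comp(Ω)`. -/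
def SobolevSupp.toComp (Ω : Opens (Rn n)) (s p : ℝ) [Fact (1 < p)] (K : Compacts (Rn n))
    (hK : (K : Set (Rn n)) ⊆ Ω) : SobolevSupp Ω s p (K : Set (Rn n)) →ₗ[ℝ] SobolevComp Ω s p :=
  (SobolevSpace.toDistribution Ω s p ∘ₗ (SobolevSupp Ω s p (K : Set (Rn n))).subtype).codRestrict
    (compSubmodule Ω s p) fun u => ⟨u.1.2, K, hK, u.2⟩

/-- The inductive limit topology: the finest topology that makes `W^{s,p}_comp(Ω)` a locally convex
topological vector space and the inclusions `W^{s,p}_K(Ω) ⊆ W^{s,p}_comp(Ω)` continuous. -/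
instance (Ω : Opens (Rn n)) (s p : ℝ) [Fact (1 < p)] : TopologicalSpace (SobolevComp Ω s p) :=
  sInf {t : TopologicalSpace (SobolevComp Ω s p) |
    (∀ (K : Compacts (Rn n)) (hK : (K : Set (Rn n)) ⊆ Ω),
      Continuous[_, t] (SobolevSupp.toComp Ω s p K hK)) ∧
    @IsTopologicalAddGroup _ t _ ∧ @ContinuousSMul ℝ _ _ _ t ∧
    @LocallyConvexSpace ℝ _ _ _ _ _ t}

instance (Ω : Opens (Rn n)) (s p : ℝ) [Fact (1 < p)] :
    IsTopologicalAddGroup (SobolevComp Ω s p) :=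
  topologicalAddGroup_sInf fun _ ⟨_, h, _, _⟩ => h

instance (Ω : Opens (Rn n)) (s p : ℝ) [Fact (1 < p)] : ContinuousSMul ℝ (SobolevComp Ω s p) :=
  continuousSMul_sInf fun _ ⟨_, _, h, _⟩ => h

/-- The test functions in `W^{s,p}_comp(Ω)`. -/
def testComp (Ω : Opens (Rn n)) (s p : ℝ) [Fact (1 < p)] : 𝓓(Ω, ℝ) →ₗ[ℝ] SobolevComp Ω s p :=
  (ofTest Ω).codRestrict (compSubmodule Ω s p) fun φ =>
    ⟨sobolevNorm_ofTest_lt Ω s p φ, ⟨tsupport φ, φ.hasCompactSupport⟩, φ.tsupport_subset, by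
      intro x hx
      by_contra hxφ
      refine (Distribution.notMem_dsupport_iff x).2 ⟨(tsupport φ)ᶜ, fun ψ hψ => ?_,
        (isClosed_tsupport φ).isOpen_compl, hxφ⟩ hx
      rw [ofTest_apply]
      refine integral_eq_zero_of_ae (Filter.Eventually.of_forall fun y => ?_)
      by_cases hy : y ∈ tsupport φ
      · simp [image_eq_zero_of_notMem_tsupport fun h => hψ h hy]
      · simp [image_eq_zero_of_notMem_tsupport hy]⟩

/-- The distributions `u` on `Ω` such that `φ u ∈ W^{s,p}(Ω)` for all test functions `φ`. -/
def locSubmodule (Ω : Opens (Rn n)) (s p : ℝ) [Fact (1 < p)] : Submodule ℝ 𝓓'(Ω, ℝ) :=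
  ⨅ φ : 𝓓(Ω, ℝ), (sobolevNorm Ω s p).finite.comap (mulDistribution φ)

/-- `W^{s,p}_loc(Ω)`. Its topology is defined below. -/
def SobolevLoc (Ω : Opens (Rn n)) (s p : ℝ) [Fact (1 < p)] : Type :=
  locSubmodule Ω s p

instance (Ω : Opens (Rn n)) (s p : ℝ) [Fact (1 < p)] : AddCommGroup (SobolevLoc Ω s p) :=
  inferInstanceAs (AddCommGroup (locSubmodule Ω s p))

instance (Ω : Opens (Rn n)) (s p : ℝ) [Fact (1 < p)] : Module ℝ (SobolevLoc Ω s p) :=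
  inferInstanceAs (Module ℝ (locSubmodule Ω s p))

/-- The inclusion `W^{s,p}_loc(Ω) ⊆ 𝓓'(Ω)`. -/
def SobolevLoc.toDistribution (Ω : Opens (Rn n)) (s p : ℝ) [Fact (1 < p)] :
    SobolevLoc Ω s p →ₗ[ℝ] 𝓓'(Ω, ℝ) :=
  (locSubmodule Ω s p).subtype

instance (Ω : Opens (Rn n)) (s p : ℝ) [Fact (1 < p)] :
    CoeOut (SobolevLoc Ω s p) 𝓓'(Ω, ℝ) := ⟨SobolevLoc.toDistribution Ω s p⟩

/-- The map `u ↦ φ u` from `W^{s,p}_loc(Ω)` to `W^{s,p}(Ω)`, for a test function `φ`. -/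
def SobolevLoc.mul (Ω : Opens (Rn n)) (s p : ℝ) [Fact (1 < p)] (φ : 𝓓(Ω, ℝ)) :
    SobolevLoc Ω s p →ₗ[ℝ] SobolevSpace Ω s p :=
  (mulDistribution φ ∘ₗ SobolevLoc.toDistribution Ω s p).codRestrict (sobolevNorm Ω s p).finite
    fun u => (Submodule.mem_iInf _).1 u.2 φ

/-- The topology of `W^{s,p}_loc(Ω)` defined by the seminorms `u ↦ ‖φ u‖_{W^{s,p}(Ω)}`. -/
instance (Ω : Opens (Rn n)) (s p : ℝ) [Fact (1 < p)] : TopologicalSpace (SobolevLoc Ω s p) :=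
  ⨅ φ : 𝓓(Ω, ℝ), TopologicalSpace.induced (SobolevLoc.mul Ω s p φ) inferInstance

instance (Ω : Opens (Rn n)) (s p : ℝ) [Fact (1 < p)] :
    IsTopologicalAddGroup (SobolevLoc Ω s p) :=
  topologicalAddGroup_iInf fun φ => topologicalAddGroup_induced (SobolevLoc.mul Ω s p φ)

instance (Ω : Opens (Rn n)) (s p : ℝ) [Fact (1 < p)] : ContinuousSMul ℝ (SobolevLoc Ω s p) :=
  continuousSMul_iInf fun φ => continuousSMul_induced (SobolevLoc.mul Ω s p φ)

/-! ### Reflexivity -/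

section Reflexive

variable (E : Type*) [AddCommGroup E] [Module ℝ E] [TopologicalSpace E] [IsTopologicalAddGroup E]
  [ContinuousSMul ℝ E]

/-- The canonical map `J : E → E**`, `(J x) f = f x`, where `E*` is the space of continuous linear
functionals on `E` with the strong topology, that is, the topology of uniform convergence on the
bounded subsets of `E`, and `E** = (E*)*`. -/
def evalBidual : E →ₗ[ℝ] StrongDual ℝ (StrongDual ℝ E) where
  toFun x :=
    { toFun := fun f => f x
      map_add' := fun _ _ => rfl
      map_smul' := fun _ _ => rfl
      cont := continuous_eval_const x }
  map_add' x y := by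
    ext f
    exact map_add f x y
  map_smul' c x := by
    ext f
    exact _root_.map_smul f c x

/-- `E` is semireflexive: the canonical map to the bidual is bijective. -/
def IsSemireflexive : Prop := Function.Bijective (evalBidual E)

/-- `E` is reflexive: the canonical map to the bidual is a linear homeomorphism. -/
def IsReflexive : Prop := IsHomeomorph (evalBidual E)

end Reflexive

end Sobolev
end

noncomputable section

/-! ### Reflexive normed spaces -/

/-- The canonical map of a normed space to its bidual is surjective. -/
def SurjectiveBidual (E : Type*) [NormedAddCommGroup E] [NormedSpace ℝ E] : Prop :=
  ∀ Φ : StrongDual ℝ (StrongDual ℝ E), ∃ x : E, ∀ f : StrongDual ℝ E, Φ f = f x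

/-- A complete space that embeds into a space with surjective bidual map has surjective bidual
map. -/
theorem SurjectiveBidual.of_antilipschitz {E F : Type*} [NormedAddCommGroup E] [NormedSpace ℝ E]
    [NormedAddCommGroup F] [NormedSpace ℝ F] [CompleteSpace E] (hF : SurjectiveBidual F)
    (J : E →L[ℝ] F) {C : ℝ≥0} (hJ : AntilipschitzWith C J) : SurjectiveBidual E := by
  intro Φ
  obtain ⟨y, hy⟩ := hF (Φ ∘L J.precomp ℝ)
  have hcl : IsClosed (LinearMap.range (J : E →ₗ[ℝ] F) : Set F) := by
    rw [LinearMap.coe_range]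
    exact hJ.isClosed_range J.uniformContinuous
  have hyr : y ∈ LinearMap.range (J : E →ₗ[ℝ] F) := by
    by_contra h
    obtain ⟨f, a, hf1, hf2⟩ := geometric_hahn_banach_closed_point
      (LinearMap.range (J : E →ₗ[ℝ] F)).convex hcl h
    have h0 : ∀ x, f (J x) = 0 := by
      intro x
      by_contra hx
      have h3 := hf1 (J ((((|a| + 1) / f (J x))) • x)) ⟨_, rfl⟩
      rw [map_smul, map_smul, smul_eq_mul, div_mul_cancel₀ _ hx] at h3
      linarith [le_abs_self a]
    have h4 := hf1 0 (Submodule.zero_mem _)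
    rw [map_zero] at h4
    have h5 : f ∘L J = 0 := by ext x; exact h0 x
    have h6 := hy f
    simp only [ContinuousLinearMap.comp_apply, ContinuousLinearMap.precomp_apply, h5,
      map_zero] at h6
    linarith
  obtain ⟨x, rfl⟩ := hyr
  refine ⟨x, fun f => ?_⟩
  let e := LinearEquiv.ofInjective (J : E →ₗ[ℝ] F) hJ.injective
  let g0 : LinearMap.range (J : E →ₗ[ℝ] F) →ₗ[ℝ] ℝ := (f : E →ₗ[ℝ] ℝ) ∘ₗ e.symm.toLinearMap
  have he (z : E) : e.symm ⟨J z, z, rfl⟩ = z := by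
    rw [LinearEquiv.symm_apply_eq]
    rfl
  let g : StrongDual ℝ (LinearMap.range (J : E →ₗ[ℝ] F)) := g0.mkContinuous (‖f‖ * C) (by
    rintro ⟨_, z, rfl⟩
    have h1 : ‖z‖ ≤ C * ‖J z‖ := by simpa using hJ.le_mul_dist z 0
    change ‖f (e.symm ⟨J z, z, rfl⟩)‖ ≤ _
    rw [he, mul_assoc]
    exact (f.le_opNorm z).trans (mul_le_mul_of_nonneg_left h1 (norm_nonneg _)))
  obtain ⟨G, hG, -⟩ := exists_extension_norm_eq _ g
  have h1 : G ∘L J = f := by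
    ext z
    rw [ContinuousLinearMap.comp_apply]
    refine (hG ⟨J z, z, rfl⟩).trans ?_
    change f (e.symm ⟨J z, z, rfl⟩) = _
    rw [he]
  have h2 := hy G
  simp only [ContinuousLinearMap.comp_apply, ContinuousLinearMap.precomp_apply, h1] at h2
  rw [h2]
  exact congrArg (· x) h1

theorem SurjectiveBidual.prod {E F : Type*} [NormedAddCommGroup E] [NormedSpace ℝ E]
    [NormedAddCommGroup F] [NormedSpace ℝ F] (hE : SurjectiveBidual E) (hF : SurjectiveBidual F) :
    SurjectiveBidual (E × F) := by
  intro Φ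
  obtain ⟨x, hx⟩ := hE (Φ ∘L (ContinuousLinearMap.fst ℝ E F).precomp ℝ)
  obtain ⟨y, hy⟩ := hF (Φ ∘L (ContinuousLinearMap.snd ℝ E F).precomp ℝ)
  refine ⟨(x, y), fun f => ?_⟩
  have hf : f = (f ∘L ContinuousLinearMap.inl ℝ E F) ∘L ContinuousLinearMap.fst ℝ E F +
      (f ∘L ContinuousLinearMap.inr ℝ E F) ∘L ContinuousLinearMap.snd ℝ E F := by
    ext <;> simp [← Prod.zero_eq_mk]
  have h1 := hx (f ∘L ContinuousLinearMap.inl ℝ E F)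
  have h2 := hy (f ∘L ContinuousLinearMap.inr ℝ E F)
  simp only [ContinuousLinearMap.comp_apply, ContinuousLinearMap.precomp_apply] at h1 h2
  conv_lhs => rw [hf]
  rw [map_add, h1, h2, ← map_add]
  simp

/-- In a space with surjective bidual map, a set of functionals that separates the points spans a
dense subspace of the dual. -/
theorem SurjectiveBidual.dense_of_separating {E : Type*} [NormedAddCommGroup E]
    [NormedSpace ℝ E] (hE : SurjectiveBidual E) (S : Submodule ℝ (StrongDual ℝ E))
    (hS : ∀ x : E, (∀ f ∈ S, f x = 0) → x = 0) : S.topologicalClosure = ⊤ := by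
  by_contra h
  obtain ⟨f, hf⟩ : ∃ f, f ∉ S.topologicalClosure := by
    by_contra! h'
    exact h (eq_top_iff.2 fun f _ => h' f)
  obtain ⟨Φ, a, h1, h2⟩ := geometric_hahn_banach_closed_point
    S.topologicalClosure.convex S.isClosed_topologicalClosure hf
  obtain ⟨x, hx⟩ := hE Φ
  have h0 : ∀ g ∈ S, g x = 0 := by
    intro g hg
    by_contra hgx
    have h3 := h1 (((|a| + 1) / g x) • g)
      (S.le_topologicalClosure (S.smul_mem _ hg))
    rw [hx, smul_apply, smul_eq_mul, div_mul_cancel₀ _ hgx] at h3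
    linarith [le_abs_self a]
  have h4 := h1 0 (Submodule.zero_mem _)
  rw [map_zero] at h4
  rw [hx, hS x h0, map_zero] at h2
  linarith

end

noncomputable section

/-! ### The dual of `Lᵖ` -/

theorem abs_midpoint_rpow_lt {p : ℝ} (hp : 1 < p) {a b : ℝ} (hab : a ≠ b) :
    |(a + b) / 2| ^ p < (|a| ^ p + |b| ^ p) / 2 := by
  have hp0 : 0 < p := one_pos.trans hp
  rcases eq_or_ne |a| |b| with h | h
  · obtain rfl : a = -b := (abs_eq_abs.1 h).resolve_left hab
    have hb : b ≠ 0 := fun hb => hab (by simp [hb])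
    have : 0 < |b| ^ p := Real.rpow_pos_of_pos (abs_pos.2 hb) p
    simp only [neg_add_cancel, zero_div, abs_zero, abs_neg, Real.zero_rpow hp0.ne']
    linarith
  · have h1 := (strictConvexOn_rpow hp).2 (abs_nonneg a) (abs_nonneg b) h
      (one_half_pos (α := ℝ)) (one_half_pos (α := ℝ)) (by norm_num)
    simp only [smul_eq_mul] at h1
    have h2 : |(a + b) / 2| ≤ 1 / 2 * |a| + 1 / 2 * |b| := by
      rw [abs_div, abs_two]
      linarith [abs_add_le a b]
    calc |(a + b) / 2| ^ p ≤ (1 / 2 * |a| + 1 / 2 * |b|) ^ p := by gcongr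
      _ < _ := h1
      _ = _ := by ring

theorem abs_midpoint_rpow_le {p : ℝ} (hp : 1 < p) (a b : ℝ) :
    |(a + b) / 2| ^ p ≤ (|a| ^ p + |b| ^ p) / 2 := by
  rcases eq_or_ne a b with rfl | h
  · simp
  · exact (abs_midpoint_rpow_lt hp h).le

/-- A quantitative form of the strict convexity of `|·|ᵖ`. -/
theorem exists_abs_sub_rpow_le {p δ : ℝ} (hp : 1 < p) (hδ : 0 < δ) :
    ∃ C, 0 ≤ C ∧ ∀ a b : ℝ, |a - b| ^ p ≤
      δ * (|a| ^ p + |b| ^ p) + C * ((|a| ^ p + |b| ^ p) / 2 - |(a + b) / 2| ^ p) := by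
  have hp0 : 0 < p := one_pos.trans hp
  set D : ℝ × ℝ → ℝ := fun z => (|z.1| ^ p + |z.2| ^ p) / 2 - |(z.1 + z.2) / 2| ^ p with hD
  have hDc : Continuous D := by
    have h (f : ℝ × ℝ → ℝ) (hf : Continuous f) : Continuous fun z => |f z| ^ p :=
      hf.abs.rpow_const fun _ => Or.inr hp0.le
    exact (((h _ continuous_fst).add (h _ continuous_snd)).div_const 2).sub
      (h _ ((continuous_fst.add continuous_snd).div_const 2))
  have hD0 (z : ℝ × ℝ) : 0 ≤ D z := sub_nonneg.2 (abs_midpoint_rpow_le hp _ _)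
  set S : Set (ℝ × ℝ) := Metric.sphere 0 1 ∩ {z | δ ≤ |z.1 - z.2| ^ p} with hS
  have hSc : IsCompact S := by
    refine (isCompact_sphere _ _).inter_right (isClosed_le continuous_const ?_)
    exact (continuous_fst.sub continuous_snd).abs.rpow_const fun _ => Or.inr hp0.le
  obtain ⟨m, hm, hmS⟩ : ∃ m, 0 < m ∧ ∀ z ∈ S, m ≤ D z := by
    rcases S.eq_empty_or_nonempty with h | h
    · exact ⟨1, one_pos, by simp [h]⟩
    · obtain ⟨z, hz, hmin⟩ := hSc.exists_isMinOn h hDc.continuousOn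
      refine ⟨D z, sub_pos.2 (abs_midpoint_rpow_lt hp fun h => ?_), fun w hw => hmin hw⟩
      have := hz.2
      simp only [Set.mem_ofPred_eq, h, sub_self, abs_zero, Real.zero_rpow hp0.ne'] at this
      linarith
  refine ⟨2 ^ p / m, by positivity, fun a b => ?_⟩
  have key (z : ℝ × ℝ) (hz : ‖z‖ = 1) :
      |z.1 - z.2| ^ p ≤ δ * (|z.1| ^ p + |z.2| ^ p) + 2 ^ p / m * D z := by
    have h1 : |z.1| ≤ 1 := (norm_fst_le z).trans_eq hz
    have h2 : |z.2| ≤ 1 := (norm_snd_le z).trans_eq hz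
    by_cases h : δ ≤ |z.1 - z.2| ^ p
    · have h3 := hmS z ⟨by simpa using hz, h⟩
      calc |z.1 - z.2| ^ p ≤ 2 ^ p := by
            gcongr
            linarith [abs_sub z.1 z.2]
        _ = 2 ^ p / m * m := by field_simp
        _ ≤ 2 ^ p / m * D z := by gcongr
        _ ≤ _ := le_add_of_nonneg_left (by positivity)
    · have h4 : 1 ≤ |z.1| ^ p + |z.2| ^ p := by
        have h5 : max |z.1| |z.2| = 1 := hz
        rcases max_choice |z.1| |z.2| with h6 | h6 <;> rw [h6] at h5 <;> rw [h5, Real.one_rpow]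
        · linarith [Real.rpow_nonneg (abs_nonneg z.2) p]
        · linarith [Real.rpow_nonneg (abs_nonneg z.1) p]
      have h5 : 0 ≤ 2 ^ p / m * D z := mul_nonneg (by positivity) (hD0 z)
      nlinarith
  rcases eq_or_ne ((a, b) : ℝ × ℝ) 0 with h | h
  · obtain ⟨rfl, rfl⟩ := Prod.mk.inj h
    simp [Real.zero_rpow hp0.ne']
  · set r := ‖((a, b) : ℝ × ℝ)‖ with hr
    have hr0 : 0 < r := norm_pos_iff.2 h
    have h1 := key (r⁻¹ • (a, b)) (by rw [norm_smul, norm_inv, norm_norm, inv_mul_cancel₀ hr0.ne'])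
    have h2 (x : ℝ) : |r⁻¹ * x| ^ p = (r ^ p)⁻¹ * |x| ^ p := by
      rw [abs_mul, Real.mul_rpow (abs_nonneg _) (abs_nonneg _), abs_of_pos (inv_pos.2 hr0),
        Real.inv_rpow hr0.le]
    simp only [hD, Prod.smul_fst, Prod.smul_snd, smul_eq_mul, ← mul_sub, ← mul_add,
      mul_div_assoc, h2] at h1
    have h3 : 0 < r ^ p := Real.rpow_pos_of_pos hr0 p
    have h4 := mul_le_mul_of_nonneg_left h1 h3.le
    rw [← mul_assoc, mul_inv_cancel₀ h3.ne', one_mul] at h4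
    refine h4.trans_eq ?_
    field_simp

section

variable {α : Type*} [MeasurableSpace α] {μ : Measure α} {p : ℝ}

theorem integrable_abs_rpow (hp : 1 < p) {f : α → ℝ} (hf : MemLp f (ENNReal.ofReal p) μ) :
    Integrable (fun x => |f x| ^ p) μ := by
  have := hf.integrable_norm_rpow (by simpa using one_pos.trans hp) ENNReal.ofReal_ne_top
  simpa [ENNReal.toReal_ofReal (one_pos.trans hp).le] using this

theorem norm_rpow_eq_integral (hp : 1 < p) (f : Lp ℝ (ENNReal.ofReal p) μ) :
    ‖f‖ ^ p = ∫ x, |f x| ^ p ∂μ := by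
  have hp0 : 0 < p := one_pos.trans hp
  have h0 : 0 ≤ ∫ x, |f x| ^ p ∂μ := integral_nonneg fun _ => by positivity
  rw [Lp.norm_def, (Lp.memLp f).eLpNorm_eq_integral_rpow_norm (by simpa using hp0)
    ENNReal.ofReal_ne_top, ENNReal.toReal_ofReal hp0.le]
  simp only [Real.norm_eq_abs]
  rw [ENNReal.toReal_ofReal (Real.rpow_nonneg h0 _), ← Real.rpow_mul h0,
    inv_mul_cancel₀ hp0.ne', Real.rpow_one]

variable [Fact (1 ≤ ENNReal.ofReal p)]

/-- The functional `f ↦ ‖f‖ᵖ / p - l f` has a minimum on `Lᵖ`. -/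
theorem exists_forall_norm_rpow_div_sub_le (hp : 1 < p)
    (l : StrongDual ℝ (Lp ℝ (ENNReal.ofReal p) μ)) :
    ∃ f, ∀ g, ‖f‖ ^ p / p - l f ≤ ‖g‖ ^ p / p - l g := by
  have hp0 : 0 < p := one_pos.trans hp
  set J : Lp ℝ (ENNReal.ofReal p) μ → ℝ := fun f => ‖f‖ ^ p / p - l f with hJ
  have hJc : Continuous J :=
    ((continuous_norm.rpow_const fun _ => Or.inr hp0.le).div_const p).sub l.continuous
  obtain ⟨B, hB⟩ : ∃ B, ∀ f, ‖f‖ ^ p / (2 * p) - B ≤ J f := by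
    have hpq := Real.HolderConjugate.conjExponent hp
    refine ⟨((2 : ℝ) ^ p⁻¹ * ‖l‖) ^ p.conjExponent / p.conjExponent, fun f => ?_⟩
    have h1 := Real.young_inequality_of_nonneg (a := ‖f‖ / (2 : ℝ) ^ p⁻¹)
      (b := (2 : ℝ) ^ p⁻¹ * ‖l‖) (by positivity) (by positivity) hpq
    have h2 : ‖f‖ / (2 : ℝ) ^ p⁻¹ * ((2 : ℝ) ^ p⁻¹ * ‖l‖) = ‖l‖ * ‖f‖ := by
      field_simp
    rw [h2, Real.div_rpow (norm_nonneg _) (by positivity), ← Real.rpow_mul (by norm_num),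
      inv_mul_cancel₀ hp0.ne', Real.rpow_one] at h1
    have h3 : l f ≤ ‖l‖ * ‖f‖ := (le_abs_self _).trans (l.le_opNorm f)
    have h4 : ‖f‖ ^ p / p = ‖f‖ ^ p / 2 / p + ‖f‖ ^ p / (2 * p) := by field_simp; ring
    simp only [hJ]
    linarith
  have hbdd : BddBelow (Set.range J) := ⟨-B, by
    rintro _ ⟨f, rfl⟩
    have : 0 ≤ ‖f‖ ^ p / (2 * p) := by positivity
    linarith [hB f]⟩
  set m := ⨅ f, J f with hm
  have hseq (k : ℕ) : ∃ f, J f < m + 1 / (k + 1 : ℝ) :=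
    exists_lt_of_ciInf_lt (lt_add_of_pos_right _ (by positivity))
  choose f hf using hseq
  obtain ⟨R, hR⟩ : ∃ R, ∀ k, ‖f k‖ ^ p ≤ R := by
    refine ⟨(m + 1 + B) * (2 * p), fun k => ?_⟩
    have h1 : 1 / (k + 1 : ℝ) ≤ 1 := by
      rw [div_le_one (by positivity)]
      linarith [Nat.cast_nonneg (α := ℝ) k]
    rw [← div_le_iff₀ (by positivity)]
    linarith [hB (f k), hf k]
  have hR0 : 0 ≤ R := (Real.rpow_nonneg (norm_nonneg _) p).trans (hR 0)
  have hconv (δ : ℝ) (hδ : 0 < δ) : ∃ C, 0 ≤ C ∧ ∀ u v : Lp ℝ (ENNReal.ofReal p) μ,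
      ‖u - v‖ ^ p ≤ δ * (‖u‖ ^ p + ‖v‖ ^ p) + C * ((J u + J v) / 2 - m) := by
    obtain ⟨C, hC0, hC⟩ := exists_abs_sub_rpow_le hp hδ
    refine ⟨C * p, by positivity, fun u v => ?_⟩
    set w : Lp ℝ (ENNReal.ofReal p) μ := (2⁻¹ : ℝ) • (u + v) with hw
    have e1 : ‖u - v‖ ^ p = ∫ x, |u x - v x| ^ p ∂μ := by
      rw [norm_rpow_eq_integral hp]
      refine integral_congr_ae ?_
      filter_upwards [Lp.coeFn_sub u v] with x hx
      rw [hx, Pi.sub_apply]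
    have e2 : ‖w‖ ^ p = ∫ x, |(u x + v x) / 2| ^ p ∂μ := by
      rw [norm_rpow_eq_integral hp]
      refine integral_congr_ae ?_
      filter_upwards [Lp.coeFn_smul (2⁻¹ : ℝ) (u + v), Lp.coeFn_add u v] with x hx hx'
      rw [hx, Pi.smul_apply, hx', Pi.add_apply, smul_eq_mul, div_eq_inv_mul]
    have hu := integrable_abs_rpow hp (Lp.memLp u)
    have hv := integrable_abs_rpow hp (Lp.memLp v)
    have huv : Integrable (fun x => |u x - v x| ^ p) μ :=
      integrable_abs_rpow hp ((Lp.memLp u).sub (Lp.memLp v))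
    have huv' : Integrable (fun x => |(u x + v x) / 2| ^ p) μ := by
      have := integrable_abs_rpow hp (((Lp.memLp u).add (Lp.memLp v)).const_smul (2⁻¹ : ℝ))
      simpa [div_eq_inv_mul] using this
    have h1 := integral_mono huv (((hu.add hv).const_mul δ).add
      ((((hu.add hv).div_const 2).sub huv').const_mul C)) fun x => hC (u x) (v x)
    have h2 : ∫ x, δ * (|u x| ^ p + |v x| ^ p) +
        C * ((|u x| ^ p + |v x| ^ p) / 2 - |(u x + v x) / 2| ^ p) ∂μ =
        δ * (‖u‖ ^ p + ‖v‖ ^ p) + C * ((‖u‖ ^ p + ‖v‖ ^ p) / 2 - ‖w‖ ^ p) := by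
      rw [integral_add, integral_const_mul, integral_const_mul, integral_sub, integral_div,
        integral_add hu hv, e2, norm_rpow_eq_integral hp u, norm_rpow_eq_integral hp v]
      · exact (hu.add hv).div_const 2
      · exact huv'
      · exact (hu.add hv).const_mul δ
      · exact (((hu.add hv).div_const 2).sub huv').const_mul C
    have h3 : m ≤ J w := ciInf_le hbdd w
    have h4 : (‖u‖ ^ p + ‖v‖ ^ p) / 2 - ‖w‖ ^ p = p * ((J u + J v) / 2 - J w) := by
      simp only [hJ, hw, map_smul, map_add, smul_eq_mul]
      field_simp
      ring
    rw [e1]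
    refine (h1.trans_eq h2).trans ?_
    rw [h4, ← mul_assoc]
    gcongr
  have hcauchy : CauchySeq f := by
    rw [Metric.cauchySeq_iff']
    intro ε hε
    have hεp : 0 < ε ^ p := Real.rpow_pos_of_pos hε p
    obtain ⟨C, hC0, hC⟩ := hconv (ε ^ p / (4 * (R + 1))) (by positivity)
    obtain ⟨K, hK⟩ := exists_nat_gt (4 * C / ε ^ p)
    refine ⟨K, fun k hk => ?_⟩
    have h1 := hC (f k) (f K)
    have h2 : (J (f k) + J (f K)) / 2 - m ≤ 1 / (K + 1 : ℝ) := by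
      have h3 : 1 / (k + 1 : ℝ) ≤ 1 / (K + 1 : ℝ) := by gcongr
      linarith [hf k, hf K]
    have h3 : C * ((J (f k) + J (f K)) / 2 - m) ≤ ε ^ p / 4 := by
      refine (mul_le_mul_of_nonneg_left h2 hC0).trans ?_
      rw [div_lt_iff₀ hεp] at hK
      rw [mul_one_div, div_le_div_iff₀ (by positivity) (by norm_num)]
      nlinarith
    have h4 : ε ^ p / (4 * (R + 1)) * (‖f k‖ ^ p + ‖f K‖ ^ p) ≤ ε ^ p / 2 := by
      calc _ ≤ ε ^ p / (4 * (R + 1)) * (2 * (R + 1)) := by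
            gcongr
            linarith [hR k, hR K]
        _ = ε ^ p / 2 := by field_simp; ring
    rw [dist_eq_norm]
    by_contra! h
    have := Real.rpow_le_rpow hε.le h hp0.le
    linarith
  obtain ⟨f₀, hf₀⟩ := cauchySeq_tendsto_of_complete hcauchy
  refine ⟨f₀, fun g => ?_⟩
  have h1 : J f₀ ≤ m := by
    refine le_of_tendsto_of_tendsto' ((hJc.tendsto f₀).comp hf₀) ?_ fun k => (hf k).le
    simpa using tendsto_one_div_add_atTop_nhds_zero_nat.const_add m
  exact h1.trans (ciInf_le hbdd g)

/-- The Riesz representation of the dual of `Lᵖ`, `1 < p < ∞`, for an arbitrary measure. -/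
theorem exists_Lp_forall_eq_integral {q : ℝ} (hpq : p.HolderConjugate q)
    (l : StrongDual ℝ (Lp ℝ (ENNReal.ofReal p) μ)) :
    ∃ g : Lp ℝ (ENNReal.ofReal q) μ, ∀ f, l f = ∫ x, g x * f x ∂μ := by
  have hp := hpq.lt
  have hp0 : 0 < p := one_pos.trans hp
  obtain ⟨f, hf⟩ := exists_forall_norm_rpow_div_sub_le hp l
  have hψm : Measurable fun x : ℝ => |x| ^ (p - 2) * x := by fun_prop
  have hψ (x : ℝ) : |(|x| ^ (p - 2) * x)| = |x| ^ (p - 1) := by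
    rcases eq_or_ne x 0 with rfl | hx
    · simp [Real.zero_rpow (sub_ne_zero.2 hp.ne')]
    · have hx' := abs_pos.2 hx
      rw [abs_mul, abs_of_nonneg (Real.rpow_nonneg hx'.le _)]
      conv_lhs => rw [← Real.rpow_one |x|, ← Real.rpow_mul hx'.le]
      rw [one_mul, ← Real.rpow_add hx']
      congr 1
      ring
  have hg : MemLp (fun x => |f x| ^ (p - 2) * f x) (ENNReal.ofReal q) μ := by
    have hm : AEStronglyMeasurable (fun x => |f x| ^ (p - 2) * f x) μ :=
      (hψm.comp_aemeasurable (Lp.aestronglyMeasurable f).aemeasurable).aestronglyMeasurable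
    rw [← integrable_norm_rpow_iff hm (by simpa using hpq.symm.pos) ENNReal.ofReal_ne_top,
      ENNReal.toReal_ofReal hpq.symm.nonneg]
    refine (integrable_abs_rpow hp (Lp.memLp f)).congr (Filter.Eventually.of_forall fun x => ?_)
    simp only [Real.norm_eq_abs, hψ]
    rw [← Real.rpow_mul (abs_nonneg _), hpq.sub_one_mul_conj]
  refine ⟨hg.toLp _, fun h => ?_⟩
  rw [integral_congr_ae (g := fun x => |f x| ^ (p - 2) * f x * h x)
    (by filter_upwards [hg.coeFn_toLp] with x hx; rw [hx])]
  set F : ℝ → α → ℝ := fun t x => |f x + t * h x| ^ p with hF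
  set F' : ℝ → α → ℝ := fun t x => (p * |f x + t * h x| ^ (p - 2) * (f x + t * h x)) * h x with hF'
  have hfh (t : ℝ) : MemLp (fun x => f x + t * h x) (ENNReal.ofReal p) μ :=
    (Lp.memLp f).add ((Lp.memLp h).const_smul t)
  have hder := hasDerivAt_integral_of_dominated_loc_of_deriv_le (μ := μ) (F := F) (F' := F')
    (x₀ := (0 : ℝ)) (s := Metric.ball 0 1) (bound := fun x => p * |(|f x| + |h x|)| ^ p)
    (Metric.ball_mem_nhds 0 one_pos)
    (Filter.Eventually.of_forall fun t => (integrable_abs_rpow hp (hfh t)).1)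
    (integrable_abs_rpow hp (hfh 0)) (by
      have h1 := (hψm.comp_aemeasurable (hfh 0).1.aemeasurable).mul
        (Lp.aestronglyMeasurable h).aemeasurable
      refine (h1.const_mul p).aestronglyMeasurable.congr (Filter.Eventually.of_forall fun x => ?_)
      simp only [hF', Function.comp, Pi.mul_apply]
      ring)
    (Filter.Eventually.of_forall fun x t ht => by
      have ht' : |t| ≤ 1 := by simpa using (mem_ball_zero_iff.1 ht).le
      have h1 : |f x + t * h x| ≤ |f x| + |h x| := by
        refine (abs_add_le _ _).trans (add_le_add_right ?_ _)
        rw [abs_mul]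
        exact mul_le_of_le_one_left (abs_nonneg _) ht'
      have h2 : (0 : ℝ) ≤ |f x| + |h x| := by positivity
      rw [Real.norm_eq_abs, abs_of_nonneg h2]
      simp only [hF']
      rw [abs_mul, mul_assoc, abs_mul, hψ, abs_of_pos hp0, mul_assoc]
      refine mul_le_mul_of_nonneg_left ?_ hp0.le
      calc |f x + t * h x| ^ (p - 1) * |h x| ≤ (|f x| + |h x|) ^ (p - 1) * (|f x| + |h x|) := by
            have h3 : |h x| ≤ |f x| + |h x| := le_add_of_nonneg_left (abs_nonneg _)
            gcongr
        _ = (|f x| + |h x|) ^ p := by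
          rcases eq_or_lt_of_le h2 with h3 | h3
          · rw [← h3, mul_zero, Real.zero_rpow hp0.ne']
          · conv_lhs => rw [← Real.rpow_one (|f x| + |h x|), ← Real.rpow_mul h3.le]
            rw [one_mul, ← Real.rpow_add h3]
            congr 1
            ring)
    ((integrable_abs_rpow hp ((Lp.memLp f).abs.add (Lp.memLp h).abs)).const_mul p)
    (Filter.Eventually.of_forall fun x t _ => by
      have h1 : HasDerivAt (fun t => f x + t * h x) (h x) t := by
        simpa using ((hasDerivAt_id t).mul_const (h x)).const_add (f x)
      exact (hasDerivAt_abs_rpow (f x + t * h x) hp).comp t h1)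
  have hmin : IsLocalMin (fun t : ℝ => (∫ x, F t x ∂μ) / p - (l f + t * l h)) 0 := by
    refine Filter.Eventually.of_forall fun t => ?_
    have h1 (t : ℝ) : ∫ x, F t x ∂μ = ‖f + t • h‖ ^ p := by
      rw [norm_rpow_eq_integral hp]
      refine integral_congr_ae ?_
      filter_upwards [Lp.coeFn_add f (t • h), Lp.coeFn_smul t h] with x hx hx'
      simp only [hF, hx, Pi.add_apply, hx', Pi.smul_apply, smul_eq_mul]
    have h2 := hf (f + t • h)
    simp only [h1]
    simpa using h2
  have hd := hmin.hasDerivAt_eq_zero ((hder.2.div_const p).sub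
    (((hasDerivAt_id (0 : ℝ)).mul_const (l h)).const_add (l f)))
  have e : ∫ x, F' 0 x ∂μ = p * ∫ x, |f x| ^ (p - 2) * f x * h x ∂μ := by
    rw [← integral_const_mul]
    refine integral_congr_ae (Filter.Eventually.of_forall fun x => ?_)
    simp only [hF', zero_mul, add_zero]
    ring
  rw [e, mul_div_cancel_left₀ _ hp0.ne'] at hd
  linarith

end

theorem surjectiveBidual_Lp {α : Type*} [MeasurableSpace α] (μ : Measure α) (p : ℝ)
    [Fact (1 < p)] : SurjectiveBidual (Lp ℝ (ENNReal.ofReal p) μ) := by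
  intro Φ
  have hpq := Real.HolderConjugate.conjExponent (Fact.out : 1 < p)
  have := Sobolev.factOneLe p
  have := Sobolev.factOneLe p.conjExponent
  have : (ENNReal.ofReal p.conjExponent).HolderConjugate (ENNReal.ofReal p) :=
    hpq.symm.ennrealOfReal
  set R := (ContinuousLinearMap.mul ℝ ℝ).lpPairing μ (ENNReal.ofReal p.conjExponent)
    (ENNReal.ofReal p) with hR
  obtain ⟨f, hf⟩ := exists_Lp_forall_eq_integral hpq.symm (Φ ∘L R)
  refine ⟨f, fun l => ?_⟩
  obtain ⟨g, hg⟩ := exists_Lp_forall_eq_integral hpq l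
  have hl : l = R g := by
    ext h
    rw [hg, hR, ContinuousLinearMap.lpPairing_eq_integral]
    simp
  rw [hl]
  refine (hf g).trans ?_
  rw [hR, ContinuousLinearMap.lpPairing_eq_integral]
  simp [mul_comm]

end

noncomputable section

namespace Sobolev

open Filter

variable {n : ℕ} {Ω : Opens (Rn n)}

/-! ### Functions and distributions -/

/-- The distribution given by a function in `Lᵖ(Ω)`. -/
theorem exists_mem_lpRel {p : ℝ} [Fact (1 < p)] (f : LpOn Ω p) :
    ∃ u : 𝓓'(Ω, ℝ), (f, u) ∈ lpRel Ω p := by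
  refine ⟨ContinuousLinearMap.toUniformConvergenceCLM (RingHom.id ℝ) ℝ _
    (TestFunction.integralAgainstBilinCLM (ContinuousLinearMap.mul ℝ ℝ)
      (volume.restrict (Ω : Set (Rn n))) f), fun φ => ?_⟩
  simp [locallyIntegrableOn_Lp, mul_comm]

theorem ae_eq_zero_of_forall_test {f : Rn n → ℝ}
    (hf : LocallyIntegrableOn f Ω (volume.restrict (Ω : Set (Rn n)))) {U : Set (Rn n)}
    (hU : IsOpen U) (hUΩ : U ⊆ Ω)
    (h : ∀ φ : 𝓓(Ω, ℝ), tsupport φ ⊆ U → ∫ x in (Ω : Set (Rn n)), f x * φ x = 0) :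
    ∀ᵐ x ∂volume.restrict (Ω : Set (Rn n)), x ∈ U → f x = 0 := by
  refine hU.ae_eq_zero_of_integral_contDiff_smul_eq_zero (hf.mono_set hUΩ)
    fun g hg hgc hgs => ?_
  have := h ⟨g, hg, hgc, hgs.trans hUΩ⟩ hgs
  simp only [smul_eq_mul, mul_comm (g _)]
  exact this

theorem lpRel_unique {p : ℝ} [Fact (1 < p)] {f g : LpOn Ω p} {u : 𝓓'(Ω, ℝ)}
    (hf : (f, u) ∈ lpRel Ω p) (hg : (g, u) ∈ lpRel Ω p) : f = g := by
  have h0 : (f - g, (0 : 𝓓'(Ω, ℝ))) ∈ lpRel Ω p := by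
    simpa using (lpRel Ω p).sub_mem hf hg
  have h1 := ae_eq_zero_of_forall_test (locallyIntegrableOn_Lp (f - g)) Ω.isOpen subset_rfl
    fun φ _ => (h0 φ).symm
  refine sub_eq_zero.1 ((Lp.eq_zero_iff_ae_eq_zero).2 ?_)
  filter_upwards [h1, ae_restrict_mem Ω.isOpen.measurableSet] with x hx hxΩ
  exact hx hxΩ

theorem lpNorm_eq {p : ℝ} [Fact (1 < p)] {f : LpOn Ω p} {u : 𝓓'(Ω, ℝ)}
    (hf : (f, u) ∈ lpRel Ω p) : lpNorm Ω p u = ‖f‖ₑ :=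
  le_antisymm (ExtSeminorm.transport_le _ _ hf)
    (le_iInf₂ fun g hg => by rw [lpRel_unique hf hg]; exact le_rfl)

theorem exists_mem_lpRel_of_lpNorm_lt {p : ℝ} [Fact (1 < p)] {u : 𝓓'(Ω, ℝ)}
    (hu : lpNorm Ω p u < ∞) : ∃ f : LpOn Ω p, (f, u) ∈ lpRel Ω p := by
  obtain ⟨f, hf, -⟩ := ExtSeminorm.exists_of_transport_lt _ _ hu
  exact ⟨f, hf⟩

theorem slobodeckijSeminorm_eq {p θ : ℝ} [Fact (1 < p)] {f : LpOn Ω p} {u : 𝓓'(Ω, ℝ)}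
    (hf : (f, u) ∈ lpRel Ω p) : slobodeckijSeminorm Ω p θ u =
      eLpNorm (slobodeckijQuotient p θ f) (ENNReal.ofReal p) (volume₂ Ω) :=
  le_antisymm (ExtSeminorm.transport_le _ _ hf)
    (le_iInf₂ fun g hg => by rw [lpRel_unique hf hg]; exact le_rfl)

theorem tendsto_integral_mul_test {p : ℝ} [Fact (1 < p)] {f : ℕ → LpOn Ω p} {g : LpOn Ω p}
    (h : Tendsto f atTop (𝓝 g)) (φ : 𝓓(Ω, ℝ)) :
    Tendsto (fun j => ∫ x in (Ω : Set (Rn n)), f j x * φ x) atTop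
      (𝓝 (∫ x in (Ω : Set (Rn n)), g x * φ x)) := by
  have hpq := Real.HolderConjugate.conjExponent (Fact.out : 1 < p)
  have : (ENNReal.ofReal p).HolderConjugate (ENNReal.ofReal p.conjExponent) := hpq.ennrealOfReal
  set R := (ContinuousLinearMap.mul ℝ ℝ).lpPairing (volume.restrict (Ω : Set (Rn n)))
    (ENNReal.ofReal p) (ENNReal.ofReal p.conjExponent) with hR
  have hm := memLp_test φ (ENNReal.ofReal p.conjExponent)
  have key (f : LpOn Ω p) : R f (hm.toLp φ) = ∫ x in (Ω : Set (Rn n)), f x * φ x := by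
    rw [hR, ContinuousLinearMap.lpPairing_eq_integral]
    refine integral_congr_ae ?_
    filter_upwards [hm.coeFn_toLp] with x hx
    simp [hx]
  have hc : Continuous fun f => R f (hm.toLp φ) := R.continuous.clm_apply continuous_const
  simpa only [Function.comp_def, key] using (hc.tendsto g).comp h

theorem exists_multiDeriv_adjoint (ν : Fin n → ℕ) : ∃ A : 𝓓(Ω, ℝ) → 𝓓(Ω, ℝ),
    ∀ (u : 𝓓'(Ω, ℝ)) φ, multiDeriv Ω ν u φ = u (A φ) := by
  let S : Submonoid (Module.End ℝ 𝓓'(Ω, ℝ)) :=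
    { carrier := {L | ∃ A : 𝓓(Ω, ℝ) → 𝓓(Ω, ℝ), ∀ (u : 𝓓'(Ω, ℝ)) φ, L u φ = u (A φ)}
      one_mem' := ⟨id, fun _ _ => rfl⟩
      mul_mem' := fun {L M} hL hM => by
        obtain ⟨A, hA⟩ := hM
        obtain ⟨B, hB⟩ := hL
        exact ⟨A ∘ B, fun u φ => by rw [Module.End.mul_apply, hB, hA]; rfl⟩ }
  suffices h : multiDeriv Ω ν ∈ S from h
  refine S.list_prod_mem fun L hL => ?_
  obtain ⟨i, rfl⟩ := List.mem_ofFn.1 hL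
  exact S.pow_mem ⟨_, fun u φ => Distribution.lineDerivOp_apply_apply u φ _⟩ _

/-! ### Reflexivity of `W^{s,p}(Ω)`, `s ≥ 0` -/

/-- The space normed by `N` is isomorphic to a subspace of a reflexive space, via a relation that is
closed with respect to weak convergence of distributions. -/
def HasReflexiveModel (N : ExtSeminorm 𝓓'(Ω, ℝ)) : Prop :=
  ∃ (F : Type) (_ : NormedAddCommGroup F) (_ : NormedSpace ℝ F)
    (G : Submodule ℝ (𝓓'(Ω, ℝ) × F)) (C : ℝ≥0), CompleteSpace F ∧ SurjectiveBidual F ∧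
    (∀ u y, (u, y) ∈ G → N u ≤ C * ‖y‖ₑ) ∧
    (∀ u, N u < ∞ → ∃ y, (u, y) ∈ G ∧ ‖y‖ₑ ≤ C * N u) ∧
    (∀ y, ((0 : 𝓓'(Ω, ℝ)), y) ∈ G → y = 0) ∧
    ∀ (u : ℕ → 𝓓'(Ω, ℝ)) (y : ℕ → F) v z, (∀ j, (u j, y j) ∈ G) → Tendsto y atTop (𝓝 z) →
      (∀ φ, Tendsto (fun j => u j φ) atTop (𝓝 (v φ))) → (v, z) ∈ G

theorem enorm_prodMk_le {E F : Type*} [NormedAddCommGroup E] [NormedAddCommGroup F] {x : E} {y : F}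
    {a : ℝ≥0∞} (hx : ‖x‖ₑ ≤ a) (hy : ‖y‖ₑ ≤ a) : ‖(x, y)‖ₑ ≤ a := by
  rcases le_total ‖x‖ ‖y‖ with h | h
  · exact (enorm_le_iff_norm_le.2 (by simpa [Prod.norm_def] using h)).trans hy
  · exact (enorm_le_iff_norm_le.2 (by simpa [Prod.norm_def] using h)).trans hx

namespace HasReflexiveModel

variable {M N : ExtSeminorm 𝓓'(Ω, ℝ)}

theorem of_equiv (hM : HasReflexiveModel M) (K : ℝ≥0) (h1 : ∀ u, N u ≤ M u)
    (h2 : ∀ u, M u ≤ K * N u) : HasReflexiveModel N := by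
  obtain ⟨F, i1, i2, G, C, hc, hr, hG1, hG2, hG3, hG4⟩ := hM
  refine ⟨F, i1, i2, G, C * max K 1, hc, hr, fun u y h => ?_, fun u hu => ?_, hG3, hG4⟩
  · refine (h1 u).trans ((hG1 u y h).trans ?_)
    gcongr
    exact_mod_cast le_mul_of_one_le_right C.2 (le_max_right K 1)
  · obtain ⟨y, hy, hyu⟩ := hG2 u ((h2 u).trans_lt (ENNReal.mul_lt_top ENNReal.coe_lt_top hu))
    refine ⟨y, hy, hyu.trans ?_⟩
    rw [ENNReal.coe_mul, mul_assoc]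
    gcongr
    refine (h2 u).trans ?_
    gcongr
    exact le_max_left K 1

theorem zero : HasReflexiveModel (0 : ExtSeminorm 𝓓'(Ω, ℝ)) := by
  refine ⟨PUnit, inferInstance, inferInstance, ⊤, 0, inferInstance, ?_, fun _ _ _ => ?_,
    fun _ _ => ⟨0, trivial, by simp⟩, fun _ _ => rfl, fun _ _ _ _ _ _ _ => trivial⟩
  · intro Φ
    refine ⟨0, fun f => ?_⟩
    have : f = 0 := by ext x; rw [Subsingleton.elim x 0, map_zero, map_zero]
    rw [this, map_zero, map_zero]
  · exact bot_le

theorem add (hM : HasReflexiveModel M) (hN : HasReflexiveModel N) :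
    HasReflexiveModel (M + N) := by
  obtain ⟨F, i1, i2, G, C, hc, hr, hG1, hG2, hG3, hG4⟩ := hM
  obtain ⟨F', i1', i2', G', C', hc', hr', hG1', hG2', hG3', hG4'⟩ := hN
  refine ⟨F × F', inferInstance, inferInstance,
    G.comap (LinearMap.prodMap LinearMap.id (LinearMap.fst ℝ F F')) ⊓
    G'.comap (LinearMap.prodMap LinearMap.id (LinearMap.snd ℝ F F')), C + C', inferInstance,
    hr.prod hr', fun u y h => ?_, fun u hu => ?_, fun y h => ?_, fun u y v z hu hy hv => ?_⟩
  · have e1 : ‖y.1‖ₑ ≤ ‖y‖ₑ := enorm_le_iff_norm_le.2 (norm_fst_le y)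
    have e2 : ‖y.2‖ₑ ≤ ‖y‖ₑ := enorm_le_iff_norm_le.2 (norm_snd_le y)
    change M u + N u ≤ _
    rw [ENNReal.coe_add, add_mul]
    exact add_le_add ((hG1 u y.1 h.1).trans (by gcongr)) ((hG1' u y.2 h.2).trans (by gcongr))
  · have hu' : M u + N u < ∞ := hu
    obtain ⟨hu1, hu2⟩ := ENNReal.add_lt_top.1 hu'
    obtain ⟨y, hy, hyu⟩ := hG2 u hu1
    obtain ⟨y', hy', hyu'⟩ := hG2' u hu2
    refine ⟨(y, y'), ⟨hy, hy'⟩, ?_⟩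
    change _ ≤ _ * (M u + N u)
    refine enorm_prodMk_le (hyu.trans ?_) (hyu'.trans ?_)
    · exact mul_le_mul' (by exact_mod_cast le_self_add) le_self_add
    · exact mul_le_mul' (by exact_mod_cast le_add_self) le_add_self
  · exact Prod.ext (hG3 _ h.1) (hG3' _ h.2)
  · exact ⟨hG4 u (fun j => (y j).1) v z.1 (fun j => (hu j).1) ((continuous_fst.tendsto z).comp hy) hv,
      hG4' u (fun j => (y j).2) v z.2 (fun j => (hu j).2) ((continuous_snd.tendsto z).comp hy) hv⟩

theorem sum {ι : Type*} (s : Finset ι) (N : ι → ExtSeminorm 𝓓'(Ω, ℝ))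
    (h : ∀ i ∈ s, HasReflexiveModel (N i)) : HasReflexiveModel (ExtSeminorm.sum s N) := by
  classical
  induction s using Finset.induction_on with
  | empty => exact zero.of_equiv 1 (fun _ => by simp [ExtSeminorm.sum]) (fun _ => bot_le)
  | insert a s ha ih =>
    refine ((h a (by simp)).add (ih fun i hi => h i (by simp [hi]))).of_equiv 1 (fun u => ?_)
      (fun u => ?_)
    · simp only [ExtSeminorm.sum, Finset.sum_insert ha]
      exact le_rfl
    · rw [ENNReal.coe_one, one_mul]
      simp only [ExtSeminorm.sum, Finset.sum_insert ha]
      exact le_rfl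

theorem comp (hN : HasReflexiveModel N) (ν : Fin n → ℕ) :
    HasReflexiveModel (N.comp (multiDeriv Ω ν)) := by
  obtain ⟨F, i1, i2, G, C, hc, hr, hG1, hG2, hG3, hG4⟩ := hN
  obtain ⟨A, hA⟩ := exists_multiDeriv_adjoint (Ω := Ω) ν
  refine ⟨F, i1, i2, G.comap (LinearMap.prodMap (multiDeriv Ω ν) LinearMap.id), C, hc, hr,
    fun u y h => hG1 _ y h, fun u hu => hG2 _ hu, fun y h => hG3 y (by simpa using h),
    fun u y v z hu hy hv => hG4 (fun j => multiDeriv Ω ν (u j)) y _ z hu hy fun φ => ?_⟩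
  change Tendsto _ _ (𝓝 (multiDeriv Ω ν v φ))
  simpa only [hA] using hv (A φ)

theorem lpNorm (p : ℝ) [Fact (1 < p)] : HasReflexiveModel (lpNorm Ω p) := by
  refine ⟨LpOn Ω p, inferInstance, inferInstance,
    (lpRel Ω p).comap (LinearEquiv.prodComm ℝ _ _).toLinearMap, 1, inferInstance,
    surjectiveBidual_Lp _ p, fun u y h => ?_, fun u hu => ?_, fun y h => ?_,
    fun u y v z hu hy hv φ => ?_⟩
  · rw [lpNorm_eq (show (y, u) ∈ lpRel Ω p from h), ENNReal.coe_one, one_mul]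
  · obtain ⟨f, hf⟩ := exists_mem_lpRel_of_lpNorm_lt hu
    exact ⟨f, hf, by rw [lpNorm_eq hf, ENNReal.coe_one, one_mul]⟩
  · exact lpRel_unique h (lpRel Ω p).zero_mem
  · refine tendsto_nhds_unique (hv φ) ((tendsto_integral_mul_test hy φ).congr fun j => ?_)
    exact (hu j φ).symm

/-- The relation between distributions in `Lᵖ(Ω)` and their Slobodeckij difference quotients. -/
def slobodeckijGraph (Ω : Opens (Rn n)) (p θ : ℝ) [Fact (1 < p)] :
    Submodule ℝ (𝓓'(Ω, ℝ) × (LpOn Ω p × Lp ℝ (ENNReal.ofReal p) (volume₂ Ω))) where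
  carrier := {z | (z.2.1, z.1) ∈ lpRel Ω p ∧ z.2.2 =ᵐ[volume₂ Ω] slobodeckijQuotient p θ z.2.1}
  zero_mem' := by
    refine ⟨(lpRel Ω p).zero_mem, ?_⟩
    refine (Lp.coeFn_zero _ _ _).trans (EventuallyEq.trans ?_
      (slobodeckijQuotient_congr p θ (Lp.coeFn_zero _ _ _)).symm)
    exact Eventually.of_forall fun z => by simp [slobodeckijQuotient]
  add_mem' := by
    rintro ⟨u, f, g⟩ ⟨u', f', g'⟩ ⟨h1, h2⟩ ⟨h1', h2'⟩
    refine ⟨(lpRel Ω p).add_mem h1 h1', ?_⟩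
    filter_upwards [Lp.coeFn_add g g', h2, h2',
      slobodeckijQuotient_congr p θ (Lp.coeFn_add f f')] with z e1 e2 e3 e4
    change (g + g') z = slobodeckijQuotient p θ (f + f' : LpOn Ω p) z
    rw [e1, e4, Pi.add_apply, e2, e3]
    simp only [slobodeckijQuotient, Pi.add_apply]
    ring
  smul_mem' := by
    rintro c ⟨u, f, g⟩ ⟨h1, h2⟩
    refine ⟨(lpRel Ω p).smul_mem c h1, ?_⟩
    filter_upwards [Lp.coeFn_smul c g, h2,
      slobodeckijQuotient_congr p θ (Lp.coeFn_smul c f)] with z e1 e2 e3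
    change (c • g) z = slobodeckijQuotient p θ (c • f : LpOn Ω p) z
    rw [e1, e3, Pi.smul_apply, e2]
    simp only [slobodeckijQuotient, Pi.smul_apply, smul_eq_mul]
    ring

theorem lpNorm_add_slobodeckij (p θ : ℝ) [Fact (1 < p)] :
    HasReflexiveModel (Sobolev.lpNorm Ω p + slobodeckijSeminorm Ω p θ) := by
  have hval (u : 𝓓'(Ω, ℝ)) : (Sobolev.lpNorm Ω p + slobodeckijSeminorm Ω p θ) u =
    Sobolev.lpNorm Ω p u + slobodeckijSeminorm Ω p θ u := rfl
  refine ⟨LpOn Ω p × Lp ℝ (ENNReal.ofReal p) (volume₂ Ω), inferInstance, inferInstance,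
    slobodeckijGraph Ω p θ, 2, inferInstance, (surjectiveBidual_Lp _ p).prod
    (surjectiveBidual_Lp _ p), fun u y h => ?_, fun u hu => ?_, fun y h => ?_,
    fun u y v z hu hy hv => ?_⟩
  · rw [hval, lpNorm_eq h.1, slobodeckijSeminorm_eq h.1, ← eLpNorm_congr_ae h.2, ← Lp.enorm_def]
    have e1 : ‖y.1‖ₑ ≤ ‖y‖ₑ := enorm_le_iff_norm_le.2 (norm_fst_le y)
    have e2 : ‖y.2‖ₑ ≤ ‖y‖ₑ := enorm_le_iff_norm_le.2 (norm_snd_le y)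
    refine (add_le_add e1 e2).trans_eq ?_
    rw [ENNReal.coe_ofNat, two_mul]
  · rw [hval] at hu ⊢
    obtain ⟨hu1, hu2⟩ := ENNReal.add_lt_top.1 hu
    obtain ⟨f, hf⟩ := exists_mem_lpRel_of_lpNorm_lt hu1
    rw [slobodeckijSeminorm_eq hf] at hu2
    have hm : MemLp (slobodeckijQuotient p θ f) (ENNReal.ofReal p) (volume₂ Ω) :=
      ⟨aestronglyMeasurable_slobodeckijQuotient p θ (Lp.aestronglyMeasurable f), hu2⟩
    refine ⟨(f, hm.toLp _), ⟨hf, hm.coeFn_toLp⟩, ?_⟩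
    rw [lpNorm_eq hf, slobodeckijSeminorm_eq hf, ENNReal.coe_ofNat, two_mul]
    refine (enorm_prodMk_le ?_ ?_).trans le_self_add
    · exact le_self_add
    · rw [Lp.enorm_def, eLpNorm_congr_ae hm.coeFn_toLp]
      exact le_add_self
  · have h1 : y.1 = 0 := lpRel_unique h.1 (lpRel Ω p).zero_mem
    refine Prod.ext h1 ((Lp.eq_zero_iff_ae_eq_zero).2 (h.2.trans ?_))
    rw [show ((0 : 𝓓'(Ω, ℝ)), y).2.1 = 0 from h1]
    refine (slobodeckijQuotient_congr p θ (Lp.coeFn_zero _ _ _)).trans ?_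
    exact Eventually.of_forall fun z => by simp [slobodeckijQuotient]
  · have hy1 : Tendsto (fun j => (y j).1) atTop (𝓝 z.1) := (continuous_fst.tendsto z).comp hy
    have hy2 : Tendsto (fun j => (y j).2) atTop (𝓝 z.2) := (continuous_snd.tendsto z).comp hy
    refine ⟨fun φ => tendsto_nhds_unique (hv φ)
      ((tendsto_integral_mul_test hy1 φ).congr fun j => ((hu j).1 φ).symm), ?_⟩
    obtain ⟨k, hk, hk'⟩ := (tendstoInMeasure_of_tendsto_Lp hy1).exists_seq_tendsto_ae
    obtain ⟨l, hl, hl'⟩ := (tendstoInMeasure_of_tendsto_Lp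
      (hy2.comp hk.tendsto_atTop)).exists_seq_tendsto_ae
    have hall : ∀ᵐ w ∂volume₂ Ω, ∀ j, (y j).2 w = slobodeckijQuotient p θ (y j).1 w :=
      ae_all_iff.2 fun j => (hu j).2
    filter_upwards [hl', hall, Measure.quasiMeasurePreserving_fst.ae hk',
      Measure.quasiMeasurePreserving_snd.ae hk'] with w h1 h2 h3 h4
    refine tendsto_nhds_unique h1 ?_
    simp only [Function.comp_apply, h2, slobodeckijQuotient]
    exact ((h3.comp hl.tendsto_atTop).sub (h4.comp hl.tendsto_atTop)).div_const _

theorem normNonneg (s p : ℝ) [Fact (1 < p)] : HasReflexiveModel (normNonneg Ω s p) := by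
  have h1 := sum (Finset.range (⌊s⌋₊ + 1)) (fun m =>
      ExtSeminorm.sum (Finset.piAntidiag Finset.univ m) fun ν =>
        (Sobolev.lpNorm Ω p).comp (multiDeriv Ω ν)) fun m _ => sum _ _ fun ν _ => (lpNorm p).comp ν
  by_cases hs : Int.fract s = 0
  · rw [Sobolev.normNonneg, if_pos hs]
    exact h1.add zero
  · rw [Sobolev.normNonneg, if_neg hs]
    refine (h1.add (sum (Finset.piAntidiag Finset.univ ⌊s⌋₊) _ fun ν _ =>
      (lpNorm_add_slobodeckij p (Int.fract s)).comp ν)).of_equiv 2 (fun u => ?_) fun u => ?_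
    · refine add_le_add le_rfl (Finset.sum_le_sum fun ν _ => ?_)
      exact le_add_self
    · have e : (ExtSeminorm.sum (Finset.piAntidiag Finset.univ ⌊s⌋₊) fun ν =>
          (Sobolev.lpNorm Ω p).comp (multiDeriv Ω ν)) u ≤
          (ExtSeminorm.sum (Finset.range (⌊s⌋₊ + 1)) (fun m =>
            ExtSeminorm.sum (Finset.piAntidiag Finset.univ m) fun ν =>
              (Sobolev.lpNorm Ω p).comp (multiDeriv Ω ν))) u :=
        Finset.single_le_sum (f := fun m => ExtSeminorm.sum
          (Finset.piAntidiag Finset.univ m)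
          (fun ν => (Sobolev.lpNorm Ω p).comp (multiDeriv Ω ν)) u)
          (fun _ _ => bot_le) (Finset.mem_range.2 (Nat.lt_succ_self ⌊s⌋₊))
      have e2 : (ExtSeminorm.sum (Finset.piAntidiag Finset.univ ⌊s⌋₊) fun ν =>
          (Sobolev.lpNorm Ω p + slobodeckijSeminorm Ω p (Int.fract s)).comp (multiDeriv Ω ν)) u =
          (ExtSeminorm.sum (Finset.piAntidiag Finset.univ ⌊s⌋₊) fun ν =>
          (Sobolev.lpNorm Ω p).comp (multiDeriv Ω ν)) u +
          (ExtSeminorm.sum (Finset.piAntidiag Finset.univ ⌊s⌋₊) fun ν =>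
          (slobodeckijSeminorm Ω p (Int.fract s)).comp (multiDeriv Ω ν)) u :=
        Finset.sum_add_distrib
      change _ + (ExtSeminorm.sum _ _) u ≤ _ * (_ + _)
      rw [e2, ENNReal.coe_ofNat, two_mul]
      exact add_le_add le_self_add (add_le_add e le_rfl)

end HasReflexiveModel

theorem enorm_sobolevNonneg {s p : ℝ} [Fact (1 < p)] (u : SobolevNonneg Ω s p) :
    ‖u‖ₑ = normNonneg Ω s p u.1 := by
  rw [← ofReal_norm]
  exact ENNReal.ofReal_toReal u.2.ne

theorem enorm_apply_le_normNonneg {s p : ℝ} [Fact (1 < p)] {u : 𝓓'(Ω, ℝ)}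
    (hu : normNonneg Ω s p u < ∞) (φ : 𝓓(Ω, ℝ)) : ‖u φ‖ₑ ≤ normNonneg Ω s p u *
      eLpNorm φ (ENNReal.ofReal p.conjExponent) (volume.restrict (Ω : Set (Rn n))) := by
  have h := lpNorm_le_normNonneg Ω s p u
  exact (enorm_apply_le_lpNorm u (h.trans_lt hu) φ).trans (mul_le_mul_left h _)

instance (s p : ℝ) [Fact (1 < p)] : CompleteSpace (SobolevNonneg Ω s p) := by
  obtain ⟨F, i1, i2, G, C, hc, hr, hG1, hG2, hG3, hG4⟩ :=
    HasReflexiveModel.normNonneg (Ω := Ω) s p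
  refine Metric.complete_of_cauchySeq_tendsto fun u hu => ?_
  choose y hy hyu using fun j => hG2 (u j).1 (u j).2
  have hlp (j : ℕ) : lpNorm Ω p (u j).1 < ∞ := (lpNorm_le_normNonneg Ω s p _).trans_lt (u j).2
  choose f hf using fun j => exists_mem_lpRel_of_lpNorm_lt (hlp j)
  have hyd (j k : ℕ) : ‖y j - y k‖ ≤ C * ‖u j - u k‖ := by
    obtain ⟨w, hw, hwu⟩ := hG2 (u j - u k).1 (u j - u k).2
    have h1 : (((u j).1 - (u k).1, y j - y k) : 𝓓'(Ω, ℝ) × F) ∈ G := G.sub_mem (hy j) (hy k)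
    have h2 : y j - y k - w = 0 := hG3 _ (by
      have h3 := G.sub_mem h1 hw
      rwa [Prod.mk_sub_mk, show (u j).1 - (u k).1 - (u j - u k).1 = 0 from sub_self _] at h3)
    rw [sub_eq_zero.1 h2]
    rw [← enorm_sobolevNonneg] at hwu
    have h4 := ENNReal.toReal_mono (ENNReal.mul_lt_top ENNReal.coe_lt_top enorm_lt_top).ne hwu
    simpa using h4
  have hfd (j k : ℕ) : ‖f j - f k‖ ≤ ‖u j - u k‖ := by
    have h1 : ((f j - f k, (u j).1 - (u k).1) : LpOn Ω p × 𝓓'(Ω, ℝ)) ∈ lpRel Ω p :=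
      (lpRel Ω p).sub_mem (hf j) (hf k)
    have h2 := lpNorm_le_normNonneg Ω s p (u j - u k).1
    rw [← enorm_sobolevNonneg] at h2
    rw [← enorm_le_iff_norm_le]
    exact (lpNorm_eq h1).symm.trans_le h2
  have hyc : CauchySeq y := by
    rw [Metric.cauchySeq_iff'] at hu ⊢
    intro ε hε
    obtain ⟨K, hK⟩ := hu (ε / (C + 1)) (by positivity)
    refine ⟨K, fun k hk => ?_⟩
    have h1 := hK k hk
    rw [dist_eq_norm, lt_div_iff₀ (by positivity)] at h1
    rw [dist_eq_norm]
    have := hyd k K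
    nlinarith [norm_nonneg (u k - u K)]
  have hfc : CauchySeq f := by
    rw [Metric.cauchySeq_iff'] at hu ⊢
    intro ε hε
    obtain ⟨K, hK⟩ := hu ε hε
    refine ⟨K, fun k hk => ?_⟩
    have h1 := hK k hk
    rw [dist_eq_norm] at h1 ⊢
    exact (hfd k K).trans_lt h1
  obtain ⟨z, hz⟩ := cauchySeq_tendsto_of_complete hyc
  obtain ⟨g, hg⟩ := cauchySeq_tendsto_of_complete hfc
  obtain ⟨v, hv⟩ := exists_mem_lpRel g
  have hvz : (v, z) ∈ G := hG4 (fun j => (u j).1) y v z hy hz fun φ => by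
    rw [show v φ = _ from hv φ]
    exact (tendsto_integral_mul_test hg φ).congr fun j => (hf j φ).symm
  have hvN : normNonneg Ω s p v < ∞ :=
    (hG1 v z hvz).trans_lt (ENNReal.mul_lt_top ENNReal.coe_lt_top enorm_lt_top)
  let w : SobolevNonneg Ω s p := ⟨v, hvN⟩
  refine ⟨w, ?_⟩
  rw [tendsto_iff_norm_sub_tendsto_zero] at hz
  refine tendsto_iff_norm_sub_tendsto_zero.2 ?_
  refine squeeze_zero (fun _ => norm_nonneg _) (fun j => ?_)
    (by simpa using hz.const_mul (C : ℝ))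
  have h1 : ‖u j - w‖ₑ ≤ _ := (enorm_sobolevNonneg _).trans_le (hG1 _ _ (G.sub_mem (hy j) hvz))
  have h2 := ENNReal.toReal_mono (ENNReal.mul_lt_top ENNReal.coe_lt_top enorm_lt_top).ne h1
  simpa using h2

theorem surjectiveBidual_sobolevNonneg (s p : ℝ) [Fact (1 < p)] :
    SurjectiveBidual (SobolevNonneg Ω s p) := by
  obtain ⟨F, i1, i2, G, C, hc, hr, hG1, hG2, hG3, hG4⟩ :=
    HasReflexiveModel.normNonneg (Ω := Ω) s p
  choose J hJ hJu using fun u : SobolevNonneg Ω s p => hG2 u.1 u.2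
  have huniq {u : 𝓓'(Ω, ℝ)} {y z : F} (hy : (u, y) ∈ G) (hz : (u, z) ∈ G) : y = z := by
    have := G.sub_mem hy hz
    rw [Prod.mk_sub_mk, sub_self] at this
    exact sub_eq_zero.1 (hG3 _ this)
  let L : SobolevNonneg Ω s p →ₗ[ℝ] F :=
    { toFun := J
      map_add' := fun u v => huniq (hJ (u + v)) (G.add_mem (hJ u) (hJ v))
      map_smul' := fun c u => huniq (hJ (c • u)) (G.smul_mem c (hJ u)) }
  have hb (u : SobolevNonneg Ω s p) : ‖L u‖ ≤ C * ‖u‖ := by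
    have h1 : ‖L u‖ₑ ≤ _ := hJu u
    rw [← enorm_sobolevNonneg] at h1
    simpa using ENNReal.toReal_mono (ENNReal.mul_lt_top ENNReal.coe_lt_top enorm_lt_top).ne h1
  refine hr.of_antilipschitz (L.mkContinuous C hb) (C := C) ?_
  refine AddMonoidHomClass.antilipschitz_of_bound _ fun u => ?_
  have h1 : _ ≤ C * ‖L u‖ₑ := hG1 _ _ (hJ u)
  rw [← enorm_sobolevNonneg] at h1
  simpa using ENNReal.toReal_mono (ENNReal.mul_lt_top ENNReal.coe_lt_top enorm_lt_top).ne h1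

theorem surjectiveBidual_sobolevZero (s p : ℝ) [Fact (1 < p)] :
    SurjectiveBidual (SobolevZero Ω s p) := by
  have : CompleteSpace (SobolevZero Ω s p) :=
    (Submodule.isClosed_topologicalClosure _).completeSpace_coe
  exact (surjectiveBidual_sobolevNonneg s p).of_antilipschitz (SobolevZero Ω s p).subtypeL
    (C := 1) (AddMonoidHomClass.antilipschitz_of_bound _ fun u => by simp)

end Sobolev

end

noncomputable section

namespace Sobolev

open Filter
open scoped ContDiff

variable {n : ℕ} {Ω : Opens (Rn n)}

/-! ### Cutoff functions and supports -/

/-- The product of a smooth function and a test function. -/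
def smoothMul (θ : Rn n → ℝ) (hθ : ContDiff ℝ ∞ θ) (φ : 𝓓(Ω, ℝ)) : 𝓓(Ω, ℝ) :=
  ⟨fun x => θ x * φ x, hθ.mul φ.contDiff, φ.hasCompactSupport.mul_left,
    tsupport_mul_subset_right.trans φ.tsupport_subset⟩

@[simp]
theorem smoothMul_apply (θ : Rn n → ℝ) (hθ : ContDiff ℝ ∞ θ) (φ : 𝓓(Ω, ℝ)) (x : Rn n) :
    smoothMul θ hθ φ x = θ x * φ x := rfl

theorem apply_eq_zero_of_disjoint {u : 𝓓'(Ω, ℝ)} {K : Set (Rn n)} (hu : u ∈ supportedIn Ω K)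
    {φ : 𝓓(Ω, ℝ)} (hφ : Disjoint K (tsupport φ)) : u φ = 0 := by
  have hc : IsCompact (tsupport φ) := φ.hasCompactSupport
  obtain ⟨θ, hθ, hθ1, h⟩ : ∃ (θ : Rn n → ℝ) (hθ : ContDiff ℝ ∞ θ),
      (∀ x ∈ tsupport φ, θ x = 1) ∧ ∀ ψ : 𝓓(Ω, ℝ), u (smoothMul θ hθ ψ) = 0 := by
    refine hc.induction_on (p := fun S => ∃ (θ : Rn n → ℝ) (hθ : ContDiff ℝ ∞ θ),
      (∀ x ∈ S, θ x = 1) ∧ ∀ ψ : 𝓓(Ω, ℝ), u (smoothMul θ hθ ψ) = 0) ?_ ?_ ?_ ?_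
    · refine ⟨0, contDiff_const, by simp, fun ψ => ?_⟩
      rw [show smoothMul 0 contDiff_const ψ = 0 by ext x; simp, map_zero]
    · rintro S T hST ⟨θ, hθ, h1, h2⟩
      exact ⟨θ, hθ, fun x hx => h1 x (hST hx), h2⟩
    · rintro S T ⟨θ, hθ, h1, h2⟩ ⟨θ', hθ', h1', h2'⟩
      refine ⟨fun x => θ x + θ' x - θ' x * θ x, (hθ.add hθ').sub (hθ'.mul hθ), ?_, fun ψ => ?_⟩
      · rintro x (hx | hx)
        · simp [h1 x hx]
        · simp [h1' x hx]
      · have e : smoothMul (fun x => θ x + θ' x - θ' x * θ x) ((hθ.add hθ').sub (hθ'.mul hθ)) ψ =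
            smoothMul θ hθ ψ + smoothMul θ' hθ' ψ - smoothMul θ' hθ' (smoothMul θ hθ ψ) := by
          ext x
          simp only [smoothMul_apply, sub_apply, add_apply]
          ring
        rw [e, map_sub, map_add, h2, h2', h2', add_zero, sub_zero]
    · intro x hx
      have hxK : x ∉ Distribution.dsupport u := fun h => Set.disjoint_left.1 hφ (hu h) hx
      obtain ⟨U, hU, hUo, hxU⟩ := (Distribution.notMem_dsupport_iff x).1 hxK
      obtain ⟨r, hr, hrU⟩ := Metric.isOpen_iff.1 hUo x hxU
      let b : ContDiffBump x := ⟨r / 4, r / 2, by positivity, by linarith⟩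
      refine ⟨Metric.closedBall x (r / 4), mem_nhdsWithin_of_mem_nhds
        (Metric.closedBall_mem_nhds x (by positivity)), b, b.contDiff,
        fun y hy => b.one_of_mem_closedBall hy, fun ψ => hU _ ?_⟩
      refine tsupport_mul_subset_left.trans ?_
      rw [b.tsupport_eq]
      exact (Metric.closedBall_subset_ball (by change r / 2 < r; linarith)).trans hrU
  have e : smoothMul θ hθ φ = φ := by
    ext x
    by_cases hx : x ∈ tsupport φ
    · simp [hθ1 x hx]
    · simp [image_eq_zero_of_notMem_tsupport hx]
  rw [← e, h]

theorem disjoint_tsupport_of_eq_zero {f : Rn n → ℝ} {K V : Set (Rn n)} (hV : IsOpen V)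
    (hKV : K ⊆ V) (hf : ∀ x ∈ V, f x = 0) : Disjoint K (tsupport f) := by
  refine Set.disjoint_of_subset_left hKV (Set.disjoint_left.2 fun x hx hxf => ?_)
  have : tsupport f ⊆ Vᶜ := closure_minimal (fun y hy hyV => hy (hf y hyV)) hV.isClosed_compl
  exact this hxf hx

theorem exists_cutoff {K : Set (Rn n)} (hK : IsCompact K) (hKΩ : K ⊆ Ω) :
    ∃ (χ : 𝓓(Ω, ℝ)) (V : Set (Rn n)), IsOpen V ∧ K ⊆ V ∧ ∀ x ∈ V, χ x = 1 := by
  obtain ⟨L, hL, hKL, hLΩ⟩ := exists_compact_between hK Ω.isOpen hKΩ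
  obtain ⟨f, h1, h2, -⟩ := exists_contMDiffMap_one_nhds_of_subset_interior
    (n := ⊤) (modelWithCornersSelf ℝ (Rn n)) hK.isClosed hKL
  obtain ⟨V, hV, hKV, hV1⟩ := mem_nhdsSet_iff_exists.1 h1
  have hfL : tsupport f ⊆ L := closure_minimal (fun x hx => by
    by_contra h
    exact hx (h2 x h)) hL.isClosed
  exact ⟨⟨f, f.contMDiff.contDiff, hL.of_isClosed_subset (isClosed_tsupport _) hfL,
    hfL.trans hLΩ⟩, V, hV, hKV, hV1⟩

theorem apply_smoothMul_cutoff {u : 𝓓'(Ω, ℝ)} {K V : Set (Rn n)} (hu : u ∈ supportedIn Ω K)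
    (hV : IsOpen V) (hKV : K ⊆ V) {φ ψ : 𝓓(Ω, ℝ)} (h : ∀ x ∈ V, φ x = ψ x) : u φ = u ψ := by
  rw [← sub_eq_zero, ← map_sub]
  exact apply_eq_zero_of_disjoint hu (disjoint_tsupport_of_eq_zero hV hKV fun x hx => by
    simp [h x hx])

theorem ae_eq_zero_of_supportedIn {p : ℝ} [Fact (1 < p)] {u : 𝓓'(Ω, ℝ)} {f : LpOn Ω p}
    (hf : (f, u) ∈ lpRel Ω p) {K : Set (Rn n)} (hK : IsClosed K) (hu : u ∈ supportedIn Ω K) :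
    ∀ᵐ x ∂volume.restrict (Ω : Set (Rn n)), x ∉ K → f x = 0 := by
  have h := ae_eq_zero_of_forall_test (locallyIntegrableOn_Lp f) (Ω.isOpen.inter hK.isOpen_compl)
    Set.inter_subset_left fun φ hφ => by
      rw [← hf φ]
      exact apply_eq_zero_of_disjoint hu
        (Set.disjoint_left.2 fun x hx hxφ => (hφ hxφ).2 hx)
  filter_upwards [h, ae_restrict_mem Ω.isOpen.measurableSet] with x hx hxΩ hxK
  exact hx ⟨hxΩ, hxK⟩

/-! ### Mollification -/

open scoped Convolution

variable (η : ContDiffBump (0 : Rn n))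

/-- The convolution with a bump function of integral one. -/
def mollify (f : Rn n → ℝ) : Rn n → ℝ := η.normed volume ⋆[ContinuousLinearMap.lsmul ℝ ℝ, volume] f

theorem mollify_apply (f : Rn n → ℝ) (x : Rn n) :
    mollify η f x = ∫ t, η.normed volume t * f (x - t) := rfl

theorem mollify_apply_swap (f : Rn n → ℝ) (x : Rn n) :
    mollify η f x = ∫ y, η.normed volume (x - y) * f y := convolution_lsmul_swap

theorem contDiff_mollify {f : Rn n → ℝ} (hf : LocallyIntegrable f) : ContDiff ℝ ∞ (mollify η f) :=
  (η.hasCompactSupport_normed (μ := volume)).contDiff_convolution_left _ (η.contDiff_normed (μ := volume) (n := ⊤)) hf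

theorem integrable_mollify_integrand {f : Rn n → ℝ} (hf : LocallyIntegrable f) (x : Rn n) :
    Integrable fun t => η.normed volume t * f (x - t) :=
  (η.hasCompactSupport_normed (μ := volume)).convolutionExists_left (ContinuousLinearMap.lsmul ℝ ℝ)
    (η.continuous_normed (μ := volume)) hf x

theorem mollify_fderiv (φ : 𝓓(Ω, ℝ)) (v x : Rn n) :
    HasFDerivAt (mollify η φ) (fderiv ℝ (mollify η φ) x) x ∧
      fderiv ℝ (mollify η φ) x v = mollify η (∂_{v} φ : 𝓓(Ω, ℝ)) x := by
  have h := φ.hasCompactSupport.hasFDerivAt_convolution_right (ContinuousLinearMap.lsmul ℝ ℝ)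
    ((η.continuous_normed (μ := volume)).locallyIntegrable (μ := volume))
    (φ.contDiff.of_le (by simp)) x
  have h' : HasFDerivAt (mollify η φ) _ x := h
  refine ⟨h'.differentiableAt.hasFDerivAt, ?_⟩
  rw [h'.fderiv, convolution_precompR_apply]
  · rfl
  · exact (η.continuous_normed (μ := volume)).locallyIntegrable
  · exact φ.hasCompactSupport.fderiv ℝ
  · exact φ.contDiff.continuous_fderiv (by simp)

/-- The test function `χ (η * φ)`. -/
def mollifyTest (χ φ : 𝓓(Ω, ℝ)) : 𝓓(Ω, ℝ) :=
  smoothMul (mollify η φ) (contDiff_mollify η φ.continuous.locallyIntegrable) χ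

/-- If `u` is supported in a set near which `χ = 1`, then `w` is the convolution of `u` and
`η`. -/
def IsMollification (χ : 𝓓(Ω, ℝ)) (u w : 𝓓'(Ω, ℝ)) : Prop := ∀ φ, w φ = u (mollifyTest η χ φ)

variable {η}

theorem IsMollification.lineDeriv {K V : Set (Rn n)} {χ : 𝓓(Ω, ℝ)} (hV : IsOpen V) (hKV : K ⊆ V)
    (hχ : ∀ x ∈ V, χ x = 1) {u w : 𝓓'(Ω, ℝ)} (hu : u ∈ supportedIn Ω K)
    (h : IsMollification η χ u w) (v : Rn n) :
    IsMollification η χ (∂_{v} u : 𝓓'(Ω, ℝ)) (∂_{v} w : 𝓓'(Ω, ℝ)) := by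
  intro φ
  rw [Distribution.lineDerivOp_apply_apply, Distribution.lineDerivOp_apply_apply, map_neg, map_neg,
    h]
  congr 1
  refine apply_smoothMul_cutoff hu hV hKV fun x hx => ?_
  change mollify η (∂_{v} φ : 𝓓(Ω, ℝ)) x * χ x = fderiv ℝ (mollify η φ * ⇑χ) x v
  obtain ⟨h1, h2⟩ := mollify_fderiv η φ v x
  have h3 : HasFDerivAt (χ : Rn n → ℝ) (0 : Rn n →L[ℝ] ℝ) x := by
    refine (hasFDerivAt_const (1 : ℝ) x).congr_of_eventuallyEq ?_
    filter_upwards [hV.mem_nhds hx] with y hy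
    exact hχ y hy
  rw [(h1.mul h3).fderiv, ← h2]
  simp [mul_comm]

theorem IsMollification.multiDeriv {K V : Set (Rn n)} {χ : 𝓓(Ω, ℝ)} (hV : IsOpen V) (hKV : K ⊆ V)
    (hχ : ∀ x ∈ V, χ x = 1) {u w : 𝓓'(Ω, ℝ)} (hu : u ∈ supportedIn Ω K)
    (h : IsMollification η χ u w) (ν : Fin n → ℕ) : Sobolev.multiDeriv Ω ν u ∈ supportedIn Ω K ∧
      IsMollification η χ (Sobolev.multiDeriv Ω ν u) (Sobolev.multiDeriv Ω ν w) := by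
  let S : Submonoid (Module.End ℝ 𝓓'(Ω, ℝ)) :=
    { carrier := {L | ∀ u w, u ∈ supportedIn Ω K → IsMollification η χ u w →
        L u ∈ supportedIn Ω K ∧ IsMollification η χ (L u) (L w)}
      one_mem' := fun u w hu h => ⟨hu, h⟩
      mul_mem' := fun {L M} hL hM u w hu h => hL _ _ (hM u w hu h).1 (hM u w hu h).2 }
  suffices hν : Sobolev.multiDeriv Ω ν ∈ S from hν u w hu h
  refine S.list_prod_mem fun L hL => ?_
  obtain ⟨i, rfl⟩ := List.mem_ofFn.1 hL
  exact S.pow_mem (fun u w hu h => ⟨(Distribution.dsupport_lineDerivOp_subset _).trans hu,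
    h.lineDeriv hV hKV hχ hu _⟩) _

theorem integral_mul_mollify {f g : Rn n → ℝ} (hf : Integrable f) (hg : Integrable g) :
    ∫ x, f x * mollify η g x = ∫ x, mollify η f x * g x := by
  have hint : Integrable (fun z : Rn n × Rn n => f z.1 * g z.2 * η.normed volume (z.1 - z.2))
      (volume.prod volume) := by
    obtain ⟨C, hC⟩ := (η.continuous_normed (μ := volume)).bounded_above_of_compact_support
      (η.hasCompactSupport_normed (μ := volume))
    refine (hf.mul_prod hg).mul_bdd (c := C)
      ((η.continuous_normed (μ := volume)).comp (continuous_fst.sub continuous_snd)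
        ).aestronglyMeasurable (Eventually.of_forall fun z => hC _)
  calc ∫ x, f x * mollify η g x
      = ∫ x, ∫ y, f x * g y * η.normed volume (x - y) := by
        refine integral_congr_ae (Eventually.of_forall fun x => ?_)
        simp only [mollify_apply_swap, ← integral_const_mul]
        refine integral_congr_ae (Eventually.of_forall fun y => ?_)
        simp only
        ring
    _ = ∫ y, ∫ x, f x * g y * η.normed volume (x - y) := integral_integral_swap hint
    _ = ∫ x, mollify η f x * g x := by
        refine integral_congr_ae (Eventually.of_forall fun y => ?_)
        simp only [mollify_apply_swap, ← integral_mul_const]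
        refine integral_congr_ae (Eventually.of_forall fun x => ?_)
        simp only
        rw [← η.normed_neg (y - x), neg_sub]
        ring

end Sobolev

end

noncomputable section

namespace Sobolev

open Filter

variable {n : ℕ} {Ω : Opens (Rn n)}

/-! ### Estimates for mollifications -/

theorem eLpNorm_integral_le {α β : Type*} [MeasurableSpace α] [MeasurableSpace β] {μ : Measure α}
    [SFinite μ] {ν : Measure β} [IsProbabilityMeasure ν] {p : ℝ} (hp : 1 < p) {F : α × β → ℝ}
    (hF : Measurable F) {C : ℝ≥0∞}
    (hC : ∀ b, eLpNorm (fun a => F (a, b)) (ENNReal.ofReal p) μ ≤ C) :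
    eLpNorm (fun a => ∫ b, F (a, b) ∂ν) (ENNReal.ofReal p) μ ≤ C := by
  have hp0 : 0 < p := one_pos.trans hp
  have e (g : α → ℝ) : eLpNorm g (ENNReal.ofReal p) μ = (∫⁻ a, ‖g a‖ₑ ^ p ∂μ) ^ (1 / p) := by
    rw [eLpNorm_eq_lintegral_rpow_enorm_toReal (by simpa using hp0) ENNReal.ofReal_ne_top,
      ENNReal.toReal_ofReal hp0.le]
  have hjensen (a : α) : ‖∫ b, F (a, b) ∂ν‖ₑ ^ p ≤ ∫⁻ b, ‖F (a, b)‖ₑ ^ p ∂ν := by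
    have hm : AEStronglyMeasurable (fun b => F (a, b)) ν :=
      (hF.comp measurable_prodMk_left).aestronglyMeasurable
    have h1 := eLpNorm_le_eLpNorm_of_exponent_le (p := 1) (q := ENNReal.ofReal p)
      (by simpa using hp.le) hm
    rw [eLpNorm_one_eq_lintegral_enorm, eLpNorm_eq_lintegral_rpow_enorm_toReal
      (by simpa using hp0) ENNReal.ofReal_ne_top, ENNReal.toReal_ofReal hp0.le] at h1
    calc ‖∫ b, F (a, b) ∂ν‖ₑ ^ p ≤ ((∫⁻ b, ‖F (a, b)‖ₑ ^ p ∂ν) ^ (1 / p)) ^ p := by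
          gcongr
          exact (enorm_integral_le_lintegral_enorm _).trans h1
      _ = _ := by rw [← ENNReal.rpow_mul, one_div, inv_mul_cancel₀ hp0.ne', ENNReal.rpow_one]
  rw [e, one_div, ENNReal.rpow_inv_le_iff hp0]
  calc ∫⁻ a, ‖∫ b, F (a, b) ∂ν‖ₑ ^ p ∂μ ≤ ∫⁻ a, ∫⁻ b, ‖F (a, b)‖ₑ ^ p ∂ν ∂μ :=
        lintegral_mono hjensen
    _ = ∫⁻ b, ∫⁻ a, ‖F (a, b)‖ₑ ^ p ∂μ ∂ν :=
        lintegral_lintegral_swap ((hF.enorm.pow_const p).aemeasurable)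
    _ ≤ ∫⁻ _, C ^ p ∂ν := by
        refine lintegral_mono fun b => ?_
        have := hC b
        rwa [e, one_div, ENNReal.rpow_inv_le_iff hp0] at this
    _ = C ^ p := by simp

variable (η : ContDiffBump (0 : Rn n))

/-- The probability measure with density `η`. -/
def bumpMeasure : Measure (Rn n) :=
  volume.withDensity fun t => ENNReal.ofReal (η.normed volume t)

instance : IsProbabilityMeasure (bumpMeasure η) := ⟨by
  rw [bumpMeasure, withDensity_apply _ MeasurableSet.univ, Measure.restrict_univ,
    ← ofReal_integral_eq_lintegral_ofReal η.integrable_normed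
      (Eventually.of_forall η.nonneg_normed), η.integral_normed, ENNReal.ofReal_one]⟩

theorem mollify_eq_integral (f : Rn n → ℝ) (x : Rn n) :
    mollify η f x = ∫ t, f (x - t) ∂bumpMeasure η := by
  rw [bumpMeasure, integral_withDensity_eq_integral_toReal_smul
    (η.continuous_normed.measurable.ennreal_ofReal) (by simp)]
  refine integral_congr_ae (Eventually.of_forall fun t => ?_)
  simp only [ENNReal.toReal_ofReal (η.nonneg_normed t)]
  rfl

theorem integrable_bumpMeasure {f : Rn n → ℝ} (hf : LocallyIntegrable f) (x : Rn n) :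
    Integrable (fun t => f (x - t)) (bumpMeasure η) := by
  rw [bumpMeasure, integrable_withDensity_iff_integrable_smul'
    (η.continuous_normed.measurable.ennreal_ofReal) (by simp)]
  refine (integrable_mollify_integrand η hf x).congr (Eventually.of_forall fun t => ?_)
  simp only [ENNReal.toReal_ofReal (η.nonneg_normed t)]
  rfl

variable {p : ℝ}

theorem eLpNorm_mollify_le (hp : 1 < p) {f : Rn n → ℝ} (hf : Measurable f) :
    eLpNorm (mollify η f) (ENNReal.ofReal p) volume ≤ eLpNorm f (ENNReal.ofReal p) volume := by
  simp_rw [funext (mollify_eq_integral η f)]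
  refine eLpNorm_integral_le hp (F := fun z => f (z.1 - z.2)) (by fun_prop) fun t => ?_
  exact (eLpNorm_comp_measurePreserving hf.aestronglyMeasurable
    (measurePreserving_sub_right volume t)).le

theorem measurable_slobodeckijQuotient (p θ : ℝ) {f : Rn n → ℝ} (hf : Measurable f) :
    Measurable (slobodeckijQuotient p θ f) := by
  unfold slobodeckijQuotient
  fun_prop

theorem eLpNorm_slobodeckijQuotient_mollify_le (hp : 1 < p) (θ : ℝ) {f : Rn n → ℝ}
    (hf : Measurable f) (hfi : LocallyIntegrable f) :
    eLpNorm (slobodeckijQuotient p θ (mollify η f)) (ENNReal.ofReal p)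
      ((volume : Measure (Rn n)).prod volume) ≤
    eLpNorm (slobodeckijQuotient p θ f) (ENNReal.ofReal p)
      ((volume : Measure (Rn n)).prod volume) := by
  have hq := measurable_slobodeckijQuotient p θ hf
  have h (z : Rn n × Rn n) : slobodeckijQuotient p θ (mollify η f) z =
      ∫ t, slobodeckijQuotient p θ f (z.1 - t, z.2 - t) ∂bumpMeasure η := by
    simp only [slobodeckijQuotient, mollify_eq_integral, sub_sub_sub_cancel_right]
    rw [integral_div, integral_sub (integrable_bumpMeasure η hfi _) (integrable_bumpMeasure η hfi _)]
  have hF : Measurable fun w : (Rn n × Rn n) × Rn n =>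
      slobodeckijQuotient p θ f (w.1.1 - w.2, w.1.2 - w.2) := hq.comp (by fun_prop)
  rw [funext h]
  refine eLpNorm_integral_le hp hF fun t => ?_
  have hm : MeasurePreserving (fun z : Rn n × Rn n => (z.1 - t, z.2 - t))
      ((volume : Measure (Rn n)).prod volume) ((volume : Measure (Rn n)).prod volume) :=
    (measurePreserving_sub_right volume t).prod (measurePreserving_sub_right volume t)
  exact (eLpNorm_comp_measurePreserving hq.aestronglyMeasurable hm).le

/-- The Slobodeckij seminorm of the extension by zero of a function with compact support. -/
theorem eLpNorm_slobodeckijQuotient_indicator_lt_top (hp : 1 < p) {θ : ℝ} (hθ : 0 < θ)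
    (hθ1 : θ < 1) {f : Rn n → ℝ} (hf : Measurable f) {K : Set (Rn n)} (hK : IsCompact K)
    (hKΩ : K ⊆ Ω) (hfK : ∀ x ∉ K, f x = 0) (hfp : eLpNorm f (ENNReal.ofReal p) volume < ∞)
    (hq : eLpNorm (slobodeckijQuotient p θ f) (ENNReal.ofReal p) (volume₂ Ω) < ∞) :
    eLpNorm (slobodeckijQuotient p θ f) (ENNReal.ofReal p)
      ((volume : Measure (Rn n)).prod volume) < ∞ := by
  rcases eq_or_ne n 0 with rfl | hn
  · have : slobodeckijQuotient p θ f = 0 := by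
      ext z
      simp [slobodeckijQuotient, Subsingleton.elim z.1 z.2]
    simp [this]
  have : NeZero n := ⟨hn⟩
  have hp0 : 0 < p := one_pos.trans hp
  have hpE : ENNReal.ofReal p ≠ 0 := by simpa using hp0
  obtain ⟨d, hd, hdΩ⟩ := hK.exists_cthickening_subset_open Ω.isOpen hKΩ
  have hdist (x y : Rn n) (hx : x ∈ K) (hy : y ∉ Ω) : d < ‖x - y‖ := by
    by_contra! h
    refine hy (hdΩ (Metric.mem_cthickening_of_dist_le y x d K hx ?_))
    rwa [dist_comm, dist_eq_norm]
  set H : Rn n → ℝ≥0∞ := fun w => ENNReal.ofReal (if ‖w‖ ≤ 1 then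
    d ^ (-p) * ‖w‖ ^ (p - n - θ * p) else 1 * ‖w‖ ^ (-n - θ * p)) with hH
  have hHm : Measurable H := by
    refine ENNReal.measurable_ofReal.comp (Measurable.ite ?_ (by fun_prop) (by fun_prop))
    exact measurableSet_le measurable_norm measurable_const
  have hHi : ∫⁻ w, H w < ∞ := lintegral_radial_lt_top hp hθ hθ1
  have hHneg (w : Rn n) : H (-w) = H w := by simp [hH]
  set q := slobodeckijQuotient p θ f with hqdef
  have hqsymm (x y : Rn n) : ‖q (x, y)‖ₑ = ‖q (y, x)‖ₑ := by
    have : q (x, y) = - q (y, x) := by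
      simp only [hqdef, slobodeckijQuotient, norm_sub_rev y x]
      ring
    rw [this, enorm_neg]
  have hbound (x y : Rn n) (hx : x ∈ K) (hy : y ∉ Ω) :
      ‖q (x, y)‖ₑ ^ p ≤ ‖f x‖ₑ ^ p * H (x - y) := by
    have hd' := hdist x y hx hy
    have hr : 0 < ‖x - y‖ := hd.trans hd'
    have hfy : f y = 0 := hfK y fun h => hy (hKΩ h)
    have e1 : ‖q (x, y)‖ₑ ^ p = ENNReal.ofReal (|f x| ^ p * ‖x - y‖ ^ (-n - θ * p)) := by
      rw [← ofReal_norm, ENNReal.ofReal_rpow_of_nonneg (norm_nonneg _) hp0.le]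
      congr 1
      rw [hqdef, slobodeckijQuotient, norm_div, Real.norm_eq_abs, Real.norm_eq_abs,
        abs_of_nonneg (Real.rpow_nonneg hr.le _), Real.div_rpow (abs_nonneg _)
        (Real.rpow_nonneg hr.le _), ← Real.rpow_mul hr.le, div_eq_mul_inv,
        ← Real.rpow_neg hr.le]
      simp only [hfy, sub_zero]
      congr 2
      field_simp
      ring
    have e2 : ‖f x‖ₑ ^ p = ENNReal.ofReal (|f x| ^ p) := by
      rw [← ofReal_norm, ENNReal.ofReal_rpow_of_nonneg (norm_nonneg _) hp0.le, Real.norm_eq_abs]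
    rw [e1, e2, hH, ← ENNReal.ofReal_mul (by positivity)]
    refine ENNReal.ofReal_le_ofReal (mul_le_mul_of_nonneg_left ?_ (by positivity))
    split_ifs with h
    · rw [show p - n - θ * p = p + (-n - θ * p) by ring, Real.rpow_add hr, ← mul_assoc]
      refine le_mul_of_one_le_left (by positivity) ?_
      rw [Real.rpow_neg hd.le, inv_mul_eq_div, one_le_div (by positivity)]
      gcongr
    · rw [one_mul]
  have hΩm : MeasurableSet (Ω : Set (Rn n)) := Ω.isOpen.measurableSet
  have hpt (z : Rn n × Rn n) : ‖q z‖ₑ ^ p ≤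
      ((Ω : Set (Rn n)) ×ˢ (Ω : Set (Rn n))).indicator (fun z => ‖q z‖ₑ ^ p) z +
      (‖f z.1‖ₑ ^ p * H (z.1 - z.2) + ‖f z.2‖ₑ ^ p * H (z.1 - z.2)) := by
    obtain ⟨x, y⟩ := z
    by_cases hz : (x, y) ∈ (Ω : Set (Rn n)) ×ˢ (Ω : Set (Rn n))
    · rw [Set.indicator_of_mem hz]
      exact le_self_add
    · by_cases hx : x ∈ K
      · have hy : y ∉ Ω := fun h => hz ⟨hKΩ hx, h⟩
        exact (hbound x y hx hy).trans (le_self_add.trans le_add_self)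
      · by_cases hy : y ∈ K
        · have hx' : x ∉ Ω := fun h => hz ⟨h, hKΩ hy⟩
          rw [hqsymm]
          refine (hbound y x hy hx').trans ?_
          rw [← hHneg (y - x), neg_sub]
          exact le_add_self.trans le_add_self
        · simp [hqdef, slobodeckijQuotient, hfK x hx, hfK y hy, hp0]
  have hqm : Measurable q := measurable_slobodeckijQuotient p θ hf
  have hfm : Measurable fun x => ‖f x‖ₑ ^ p := hf.enorm.pow_const p
  rw [eLpNorm_lt_top_iff_lintegral_rpow_enorm_lt_top hpE ENNReal.ofReal_ne_top,
    ENNReal.toReal_ofReal hp0.le] at hfp hq ⊢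
  refine (lintegral_mono hpt).trans_lt ?_
  rw [lintegral_add_left ((hqm.enorm.pow_const p).indicator (hΩm.prod hΩm)),
    lintegral_add_left (by fun_prop)]
  refine ENNReal.add_lt_top.2 ⟨?_, ENNReal.add_lt_top.2 ⟨?_, ?_⟩⟩
  · rw [lintegral_indicator (hΩm.prod hΩm), ← Measure.prod_restrict]
    exact hq
  · rw [lintegral_prod _ (by fun_prop)]
    have h (x : Rn n) : ∫⁻ y, ‖f x‖ₑ ^ p * H (x - y) = ‖f x‖ₑ ^ p * ∫⁻ w, H w := by
      rw [lintegral_const_mul _ (by fun_prop), lintegral_sub_left_eq_self H x]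
    simp_rw [h]
    rw [lintegral_mul_const _ hfm]
    exact ENNReal.mul_lt_top hfp hHi
  · rw [lintegral_prod_symm _ (by fun_prop)]
    have h (y : Rn n) : ∫⁻ x, ‖f y‖ₑ ^ p * H (x - y) = ‖f y‖ₑ ^ p * ∫⁻ w, H w := by
      rw [lintegral_const_mul _ (by fun_prop), lintegral_sub_right_eq_self H y]
    simp_rw [h]
    rw [lintegral_mul_const _ hfm]
    exact ENNReal.mul_lt_top hfp hHi

end Sobolev

end

noncomputable section

namespace Sobolev

open Filter

variable {n : ℕ} {Ω : Opens (Rn n)} {p : ℝ} [Fact (1 < p)]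

/-! ### Approximation of compactly supported elements of `W^{s,p}(Ω)`, `s ≥ 0` -/

theorem toLp_mem_lpRel {w : 𝓓'(Ω, ℝ)} {g : Rn n → ℝ} (hw : IsGivenBy w g)
    (hg : MemLp g (ENNReal.ofReal p) (volume.restrict (Ω : Set (Rn n)))) :
    (hg.toLp g, w) ∈ lpRel Ω p := by
  intro φ
  rw [hw φ]
  refine integral_congr_ae ?_
  filter_upwards [hg.coeFn_toLp] with x hx
  rw [hx]

theorem lpNorm_eq_of_isGivenBy {w : 𝓓'(Ω, ℝ)} {g : Rn n → ℝ} (hw : IsGivenBy w g)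
    (hg : MemLp g (ENNReal.ofReal p) (volume.restrict (Ω : Set (Rn n)))) :
    lpNorm Ω p w = eLpNorm g (ENNReal.ofReal p) (volume.restrict (Ω : Set (Rn n))) := by
  rw [lpNorm_eq (toLp_mem_lpRel hw hg), Lp.enorm_toLp]

theorem slobodeckijSeminorm_eq_of_isGivenBy {θ : ℝ} {w : 𝓓'(Ω, ℝ)} {g : Rn n → ℝ}
    (hw : IsGivenBy w g)
    (hg : MemLp g (ENNReal.ofReal p) (volume.restrict (Ω : Set (Rn n)))) :
    slobodeckijSeminorm Ω p θ w =
      eLpNorm (slobodeckijQuotient p θ g) (ENNReal.ofReal p) (volume₂ Ω) := by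
  rw [slobodeckijSeminorm_eq (toLp_mem_lpRel hw hg)]
  exact eLpNorm_congr_ae (slobodeckijQuotient_congr p θ hg.coeFn_toLp)

/-- An element of `Lᵖ(Ω)` with support in a compact set `K ⊆ Ω` is given by an integrable function
on `ℝⁿ` that vanishes outside of `K`. -/
theorem exists_isGivenBy_of_supportedIn {K : Set (Rn n)} (hK : IsCompact K) (hKΩ : K ⊆ Ω)
    {v : 𝓓'(Ω, ℝ)} (hv : lpNorm Ω p v < ∞) (hvK : v ∈ supportedIn Ω K) :
    ∃ h : Rn n → ℝ, Measurable h ∧ (∀ x ∉ K, h x = 0) ∧ Integrable h ∧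
      MemLp h (ENNReal.ofReal p) volume ∧ IsGivenBy v h ∧
      eLpNorm h (ENNReal.ofReal p) volume = lpNorm Ω p v := by
  obtain ⟨f, hf⟩ := exists_mem_lpRel_of_lpNorm_lt hv
  have hKm := hK.isClosed.measurableSet
  have hae : K.indicator f =ᵐ[volume.restrict (Ω : Set (Rn n))] f := by
    filter_upwards [ae_eq_zero_of_supportedIn hf hK.isClosed hvK] with x hx
    by_cases hxK : x ∈ K
    · simp [hxK]
    · simp [hxK, hx hxK]
  have hind : (Ω : Set (Rn n)).indicator (K.indicator f) = K.indicator f := by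
    rw [Set.indicator_indicator, Set.inter_eq_self_of_subset_right hKΩ]
  have hnorm : eLpNorm (K.indicator f) (ENNReal.ofReal p) volume = lpNorm Ω p v := by
    rw [← hind, eLpNorm_indicator_eq_eLpNorm_restrict Ω.isOpen.measurableSet,
      eLpNorm_congr_ae hae, lpNorm_eq hf, Lp.enorm_def]
  have hm : Measurable (K.indicator f) :=
    (Lp.stronglyMeasurable f).measurable.indicator hKm
  refine ⟨K.indicator f, hm, fun x hx => Set.indicator_of_notMem hx _, ?_,
    ⟨hm.aestronglyMeasurable, hnorm ▸ hv⟩, fun φ => ?_, hnorm⟩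
  · rw [integrable_indicator_iff hKm]
    have h := ((Lp.memLp f).locallyIntegrable Fact.out).integrableOn_isCompact hK
    rwa [IntegrableOn, Measure.restrict_restrict_of_subset hKΩ] at h
  · rw [show v φ = _ from hf φ]
    refine integral_congr_ae ?_
    filter_upwards [hae] with x hx
    rw [hx]

variable {η : ContDiffBump (0 : Rn n)} {χ : 𝓓(Ω, ℝ)} {K : Set (Rn n)}

theorem setIntegral_mul_test (f : Rn n → ℝ) (φ : 𝓓(Ω, ℝ)) :
    ∫ x in (Ω : Set (Rn n)), f x * φ x = ∫ x, f x * φ x :=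
  setIntegral_eq_integral_of_forall_compl_eq_zero fun x hx => by
    rw [image_eq_zero_of_notMem_tsupport fun h => hx (φ.tsupport_subset h), mul_zero]

theorem apply_mollifyTest (hχ : ∀ x ∈ K, χ x = 1) {v : 𝓓'(Ω, ℝ)}
    {h : Rn n → ℝ} (hh : Integrable h) (hhK : ∀ x ∉ K, h x = 0) (hv : IsGivenBy v h)
    (φ : 𝓓(Ω, ℝ)) :
    v (mollifyTest η χ φ) = ∫ x in (Ω : Set (Rn n)), mollify η h x * φ x := by
  rw [hv, setIntegral_mul_test, setIntegral_mul_test, ← integral_mul_mollify hh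
    (φ.continuous.integrable_of_hasCompactSupport φ.hasCompactSupport)]
  refine integral_congr_ae (Eventually.of_forall fun x => ?_)
  simp only [mollifyTest, smoothMul_apply]
  by_cases hx : x ∈ K
  · rw [hχ x hx, mul_one]
  · rw [hhK x hx, zero_mul, zero_mul]

/-- If `u` is supported in `K`, the mollifications of `u` are bounded with respect to `N`. -/
def MollificationBounded (χ : 𝓓(Ω, ℝ)) (K : Set (Rn n)) (N : ExtSeminorm 𝓓'(Ω, ℝ)) : Prop :=
  ∀ u ∈ supportedIn Ω K, N u < ∞ → ∃ C < ∞, ∀ (η : ContDiffBump (0 : Rn n)) (w : 𝓓'(Ω, ℝ)),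
    IsMollification η χ u w → N w ≤ C

namespace MollificationBounded

variable {M N : ExtSeminorm 𝓓'(Ω, ℝ)}

theorem zero : MollificationBounded χ K (0 : ExtSeminorm 𝓓'(Ω, ℝ)) :=
  fun _ _ _ => ⟨0, ENNReal.zero_lt_top, fun _ _ _ => le_rfl⟩

theorem add (hM : MollificationBounded χ K M) (hN : MollificationBounded χ K N) :
    MollificationBounded χ K (M + N) := by
  intro u huK hu
  obtain ⟨hu1, hu2⟩ := ENNReal.add_lt_top.1 (show M u + N u < ∞ from hu)
  obtain ⟨C, hC, h⟩ := hM u huK hu1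
  obtain ⟨C', hC', h'⟩ := hN u huK hu2
  exact ⟨C + C', ENNReal.add_lt_top.2 ⟨hC, hC'⟩, fun η w hw => add_le_add (h η w hw) (h' η w hw)⟩

theorem sum {ι : Type*} (s : Finset ι) {N : ι → ExtSeminorm 𝓓'(Ω, ℝ)}
    (h : ∀ i ∈ s, MollificationBounded χ K (N i)) :
    MollificationBounded χ K (ExtSeminorm.sum s N) := by
  intro u huK hu
  have hu' := ENNReal.sum_lt_top.1 (show ∑ i ∈ s, N i u < ∞ from hu)
  choose! C hC hCw using fun i hi => h i hi u huK (hu' i hi)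
  exact ⟨∑ i ∈ s, C i, ENNReal.sum_lt_top.2 hC, fun η w hw =>
    Finset.sum_le_sum fun i hi => hCw i hi η w hw⟩

theorem comp (hN : MollificationBounded χ K N) {V : Set (Rn n)} (hV : IsOpen V) (hKV : K ⊆ V)
    (hχ : ∀ x ∈ V, χ x = 1) (ν : Fin n → ℕ) :
    MollificationBounded χ K (N.comp (multiDeriv Ω ν)) := by
  intro u huK hu
  have hν (η : ContDiffBump (0 : Rn n)) (w : 𝓓'(Ω, ℝ)) (hw : IsMollification η χ u w) :=
    hw.multiDeriv hV hKV hχ huK ν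
  by_cases h : ∃ (η : ContDiffBump (0 : Rn n)) (w : 𝓓'(Ω, ℝ)), IsMollification η χ u w
  · obtain ⟨η, w, hw⟩ := h
    obtain ⟨C, hC, hCw⟩ := hN _ (hν η w hw).1 hu
    exact ⟨C, hC, fun η w hw => hCw η _ (hν η w hw).2⟩
  · push Not at h
    exact ⟨0, ENNReal.zero_lt_top, fun η w hw => absurd hw (h η w)⟩

theorem lpNorm (hK : IsCompact K) (hKΩ : K ⊆ Ω) (hχ : ∀ x ∈ K, χ x = 1) :
    MollificationBounded χ K (lpNorm Ω p) := by
  intro u huK hu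
  obtain ⟨h, hm, hhK, hi, hp, hv, heq⟩ := exists_isGivenBy_of_supportedIn hK hKΩ hu huK
  refine ⟨_, hu, fun η w hw => ?_⟩
  have hle := eLpNorm_mollify_le η (Fact.out : 1 < p) hm
  have hc := (contDiff_mollify η hi.locallyIntegrable).continuous
  have hmem : MemLp (mollify η h) (ENNReal.ofReal p) volume :=
    ⟨hc.aestronglyMeasurable, hle.trans_lt hp.2⟩
  rw [lpNorm_eq_of_isGivenBy (fun φ => (hw φ).trans (apply_mollifyTest hχ hi hhK hv φ))
    (hmem.restrict _), ← heq]
  exact (eLpNorm_mono_measure _ Measure.restrict_le_self).trans hle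

theorem slobodeckijSeminorm (hK : IsCompact K) (hKΩ : K ⊆ Ω) (hχ : ∀ x ∈ K, χ x = 1) {θ : ℝ}
    (hθ : 0 < θ) (hθ1 : θ < 1) :
    MollificationBounded χ K (slobodeckijSeminorm Ω p θ) := by
  intro u huK hu
  have hulp : Sobolev.lpNorm Ω p u < ∞ := by
    obtain ⟨f, hf, -⟩ := ExtSeminorm.exists_of_transport_lt _ _ hu
    rw [lpNorm_eq hf]
    exact enorm_lt_top
  obtain ⟨h, hm, hhK, hi, hp, hv, heq⟩ := exists_isGivenBy_of_supportedIn hK hKΩ hulp huK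
  rw [slobodeckijSeminorm_eq_of_isGivenBy hv (hp.restrict _)] at hu
  refine ⟨_, eLpNorm_slobodeckijQuotient_indicator_lt_top (Fact.out : 1 < p) hθ hθ1 hm hK hKΩ hhK
    hp.2 hu, fun η w hw => ?_⟩
  have hle := eLpNorm_mollify_le η (Fact.out : 1 < p) hm
  have hc := (contDiff_mollify η hi.locallyIntegrable).continuous
  have hmem : MemLp (mollify η h) (ENNReal.ofReal p) volume :=
    ⟨hc.aestronglyMeasurable, hle.trans_lt hp.2⟩
  rw [slobodeckijSeminorm_eq_of_isGivenBy
    (fun φ => (hw φ).trans (apply_mollifyTest hχ hi hhK hv φ)) (hmem.restrict _), volume₂,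
    Measure.prod_restrict]
  exact (eLpNorm_mono_measure _ Measure.restrict_le_self).trans
    (eLpNorm_slobodeckijQuotient_mollify_le η Fact.out θ hm hi.locallyIntegrable)

theorem normNonneg (hK : IsCompact K) (hKΩ : K ⊆ Ω) {V : Set (Rn n)} (hV : IsOpen V) (hKV : K ⊆ V)
    (hχ : ∀ x ∈ V, χ x = 1) (s : ℝ) : MollificationBounded χ K (normNonneg Ω s p) := by
  have hχK : ∀ x ∈ K, χ x = 1 := fun x hx => hχ x (hKV hx)
  refine add (sum _ fun m _ => sum _ fun ν _ => (lpNorm hK hKΩ hχK).comp hV hKV hχ ν) ?_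
  split_ifs with hs
  · exact zero
  · exact sum _ fun ν _ => (slobodeckijSeminorm hK hKΩ hχK
      (lt_of_le_of_ne (Int.fract_nonneg s) (Ne.symm hs)) (Int.fract_lt_one s)).comp hV hKV hχ ν

end MollificationBounded

theorem support_mollify_subset {h : Rn n → ℝ} (hhK : ∀ x ∉ K, h x = 0) :
    Function.support (mollify η h) ⊆ Metric.cthickening η.rOut K := by
  intro x hx
  by_contra hxK
  refine hx ?_
  rw [mollify_apply]
  refine integral_eq_zero_of_ae (Eventually.of_forall fun t => ?_)
  simp only [Pi.zero_apply, mul_eq_zero]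
  by_cases ht : t ∈ Metric.ball (0 : Rn n) η.rOut
  · right
    refine hhK _ fun hK => hxK (Metric.mem_cthickening_of_dist_le x (x - t) _ K hK ?_)
    simpa [dist_eq_norm] using (mem_ball_zero_iff.1 ht).le
  · left
    rw [← Function.notMem_support, η.support_normed_eq]
    exact ht

/-- An element of `W^{s,p}(Ω)`, `s ≥ 0`, with compact support is the weak limit of a bounded family
of test functions. -/
theorem exists_bounded_test_approximation (hK : IsCompact K) (hKΩ : K ⊆ Ω) (s : ℝ)
    {u : 𝓓'(Ω, ℝ)} (hu : normNonneg Ω s p u < ∞) (huK : u ∈ supportedIn Ω K) :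
    ∃ C < ∞, ∀ (φ : 𝓓(Ω, ℝ)) (ε : ℝ), 0 < ε → ∃ g : 𝓓(Ω, ℝ),
      normNonneg Ω s p (ofTest Ω g) ≤ C ∧ |u φ - ofTest Ω g φ| ≤ ε := by
  obtain ⟨χ, V, hV, hKV, hχ⟩ := exists_cutoff hK hKΩ
  have hχK : ∀ x ∈ K, χ x = 1 := fun x hx => hχ x (hKV hx)
  obtain ⟨C, hC, hCw⟩ := MollificationBounded.normNonneg hK hKΩ hV hKV hχ s u huK hu
  refine ⟨C, hC, fun φ ε hε => ?_⟩
  obtain ⟨d, hd, hdΩ⟩ := hK.exists_cthickening_subset_open Ω.isOpen hKΩ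
  obtain ⟨h, hm, hhK, hi, hp, hv, heq⟩ := exists_isGivenBy_of_supportedIn (p := p) hK hKΩ
    ((lpNorm_le_normNonneg Ω s p u).trans_lt hu) huK
  have hφi := φ.continuous.integrable_of_hasCompactSupport (μ := volume) φ.hasCompactSupport
  set I := ∫ x, ‖h x‖
  have hI : 0 ≤ I := integral_nonneg fun x => norm_nonneg _
  obtain ⟨δ, hδ, hφδ⟩ := Metric.uniformContinuous_iff.1
    (φ.hasCompactSupport.uniformContinuous_of_continuous φ.continuous)
    (ε / (I + 1)) (by positivity)
  have hr : 0 < min d δ := lt_min hd hδ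
  let η : ContDiffBump (0 : Rn n) := ⟨min d δ / 2, min d δ, by linarith, by linarith⟩
  have hsub : tsupport (mollify η h) ⊆ Metric.cthickening d K :=
    closure_minimal ((support_mollify_subset hhK).trans
      (Metric.cthickening_mono (min_le_left _ _) K)) Metric.isClosed_cthickening
  let g : 𝓓(Ω, ℝ) := ⟨mollify η h, contDiff_mollify η hi.locallyIntegrable,
    hK.cthickening.of_isClosed_subset (isClosed_tsupport _) hsub, hsub.trans hdΩ⟩
  have hg : IsMollification η χ u (ofTest Ω g) := fun ψ => by
    rw [apply_mollifyTest hχK hi hhK hv, ofTest_apply]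
    rfl
  refine ⟨g, hCw η _ hg, ?_⟩
  have hgφ : ofTest Ω g φ = ∫ x, h x * mollify η φ x := by
    rw [ofTest_apply, setIntegral_mul_test, integral_mul_mollify hi hφi]
    rfl
  have hdist (x : Rn n) : |φ x - mollify η φ x| ≤ ε / (I + 1) := by
    rw [abs_sub_comm]
    exact η.dist_normed_convolution_le φ.continuous.aestronglyMeasurable fun y hy =>
      (hφδ (lt_of_lt_of_le hy (min_le_right _ _))).le
  obtain ⟨B, hB⟩ := φ.continuous.bounded_above_of_compact_support φ.hasCompactSupport
  have hcm := (contDiff_mollify η (φ.continuous.locallyIntegrable (μ := volume))).continuous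
  have i1 : Integrable fun x => h x * φ x :=
    hi.mul_bdd (c := B) φ.continuous.aestronglyMeasurable (Eventually.of_forall hB)
  have i2 : Integrable fun x => h x * mollify η φ x := by
    refine hi.mul_bdd (c := B + ε / (I + 1)) hcm.aestronglyMeasurable
      (Eventually.of_forall fun x => ?_)
    have := abs_sub_abs_le_abs_sub (mollify η φ x) (φ x)
    rw [abs_sub_comm] at this
    have := hdist x
    have := hB x
    rw [Real.norm_eq_abs] at *
    linarith
  rw [hv, setIntegral_mul_test, hgφ, ← integral_sub i1 i2, ← Real.norm_eq_abs]
  calc ‖∫ x, h x * φ x - h x * mollify η φ x‖ ≤ ∫ x, ‖h x‖ * (ε / (I + 1)) := by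
        refine norm_integral_le_of_norm_le (hi.norm.mul_const _) (Eventually.of_forall fun x => ?_)
        rw [← mul_sub, norm_mul]
        exact mul_le_mul_of_nonneg_left (hdist x) (norm_nonneg _)
    _ = I * (ε / (I + 1)) := integral_mul_const _ _
    _ ≤ ε := by
        rw [mul_div_assoc', div_le_iff₀ (by positivity)]
        nlinarith

end Sobolev

end

noncomputable section

namespace Sobolev

open Filter

variable {n : ℕ} {Ω : Opens (Rn n)} {p : ℝ} [Fact (1 < p)]

/-! ### The duality between `W_0^{s,p}(Ω)` and its dual -/

theorem exists_dual_of_bound {V E : Type*} [AddCommGroup V] [Module ℝ V] [NormedAddCommGroup E]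
    [NormedSpace ℝ E] (e : V →ₗ[ℝ] E) (f : V →ₗ[ℝ] ℝ) (C : ℝ≥0)
    (h : ∀ v, ‖f v‖ₑ ≤ C * ‖e v‖ₑ) : ∃ g : StrongDual ℝ E, ‖g‖ₑ ≤ C ∧ ∀ v, g (e v) = f v := by
  have h' (v : V) : ‖f v‖ ≤ C * ‖e.rangeRestrict v‖ := by
    have := ENNReal.toReal_mono (by finiteness) (h v)
    simpa using this
  have hd : DenseRange e.rangeRestrict := e.surjective_rangeRestrict.denseRange
  obtain ⟨g, hg, hgn⟩ := exists_extension_norm_eq (LinearMap.range e)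
    (f.extendOfNorm e.rangeRestrict)
  refine ⟨g, ?_, fun v => ?_⟩
  · rw [← ofReal_norm, hgn]
    refine ENNReal.ofReal_le_of_le_toReal ?_
    exact ContinuousLinearMap.opNorm_le_bound _ C.2
      (LinearMap.norm_extendOfNorm_apply_le hd C h')
  · rw [← LinearMap.extendOfNorm_eq (e := e.rangeRestrict) hd ⟨C, h'⟩ v]
    exact hg (e.rangeRestrict v)

theorem exists_of_surjectiveBidual {V E : Type*} [AddCommGroup V] [Module ℝ V]
    [NormedAddCommGroup E] [NormedSpace ℝ E] (hE : SurjectiveBidual E) (e : V →ₗ[ℝ] StrongDual ℝ E)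
    (f : V →ₗ[ℝ] ℝ) (C : ℝ≥0) (h : ∀ v, ‖f v‖ₑ ≤ C * ‖e v‖ₑ) :
    ∃ x : E, ‖x‖ₑ ≤ C ∧ ∀ v, e v x = f v := by
  obtain ⟨Λ, hΛC, hΛ⟩ := exists_dual_of_bound e f C h
  obtain ⟨x, hx⟩ := hE Λ
  refine ⟨x, ?_, fun v => by rw [← hx, hΛ]⟩
  have hΛC' : ‖Λ‖ ≤ C := by simpa using ENNReal.toReal_mono ENNReal.coe_ne_top hΛC
  have : ‖x‖ ≤ C := NormedSpace.norm_le_dual_bound ℝ x C.2 fun f => by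
    rw [← hx]
    exact (Λ.le_opNorm f).trans (mul_le_mul_of_nonneg_right hΛC' (norm_nonneg _))
  rw [← ofReal_norm]
  exact ENNReal.ofReal_le_of_le_toReal this

theorem enorm_testZero (s : ℝ) (φ : 𝓓(Ω, ℝ)) :
    ‖testZero Ω s p φ‖ₑ = normNonneg Ω s p (ofTest Ω φ) :=
  enorm_sobolevNonneg (testNonneg Ω s p φ)

theorem enorm_apply_le_normDual {s : ℝ} {u : 𝓓'(Ω, ℝ)} (hu : normDual Ω s p u < ∞) (φ : 𝓓(Ω, ℝ)) :
    ‖u φ‖ₑ ≤ normDual Ω s p u * normNonneg Ω s p (ofTest Ω φ) := by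
  rw [← enorm_testZero]
  refine ExtSeminorm.le_transport_mul _ _ hu enorm_ne_top fun F hF => ?_
  rw [show u φ = _ from hF φ]
  exact F.le_opENorm _

theorem norm_apply_le_sobolevZero {s : ℝ} (ψ : 𝓓(Ω, ℝ)) (w : SobolevZero Ω s p) :
    ‖w.1.1 ψ‖ ≤ (eLpNorm ψ (ENNReal.ofReal p.conjExponent)
      (volume.restrict (Ω : Set (Rn n)))).toReal * ‖w‖ := by
  have h := enorm_apply_le_normNonneg w.1.2 ψ
  rw [← enorm_sobolevNonneg] at h
  have := ENNReal.toReal_mono (ENNReal.mul_ne_top enorm_ne_top (memLp_test ψ _).2.ne) h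
  rw [ENNReal.toReal_mul, mul_comm, toReal_enorm, toReal_enorm] at this
  exact this

/-- The functional on `W_0^{s,p}(Ω)` given by a test function. -/
def testDual (Ω : Opens (Rn n)) (s p : ℝ) [Fact (1 < p)] :
    𝓓(Ω, ℝ) →ₗ[ℝ] StrongDual ℝ (SobolevZero Ω s p) where
  toFun ψ := LinearMap.mkContinuous
    { toFun := fun w : SobolevZero Ω s p => w.1.1 ψ
      map_add' := fun _ _ => rfl
      map_smul' := fun _ _ => rfl }
    (eLpNorm ψ (ENNReal.ofReal p.conjExponent) (volume.restrict (Ω : Set (Rn n)))).toReal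
    (norm_apply_le_sobolevZero ψ)
  map_add' φ ψ := by
    ext w
    exact map_add w.1.1 φ ψ
  map_smul' c ψ := by
    ext w
    exact _root_.map_smul w.1.1 c ψ

theorem testDual_mem_dualRel (s : ℝ) (ψ : 𝓓(Ω, ℝ)) :
    (testDual Ω s p ψ, ofTest Ω ψ) ∈ dualRel Ω s p := fun φ => by
  change ofTest Ω ψ φ = ofTest Ω φ ψ
  simp only [ofTest_apply, mul_comm]

theorem dense_range_testDual (s : ℝ) :
    (LinearMap.range (testDual Ω s p)).topologicalClosure = ⊤ := by
  refine (surjectiveBidual_sobolevZero s p).dense_of_separating _ fun x hx => ?_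
  refine Subtype.ext (Subtype.ext ?_)
  ext ψ
  exact hx _ ⟨ψ, rfl⟩

/-- `N` and `M` are the norms of two spaces of distributions on `Ω` in duality with each other. -/
structure DualNorms (Ω : Opens (Rn n)) (N M : ExtSeminorm 𝓓'(Ω, ℝ)) : Prop where
  finite_left : ∀ φ, N (ofTest Ω φ) < ∞
  finite_right : ∀ φ, M (ofTest Ω φ) < ∞
  pairing : ∀ φ ψ, ‖ofTest Ω φ ψ‖ₑ ≤ N (ofTest Ω φ) * M (ofTest Ω ψ)
  le_left : ∀ (u : 𝓓'(Ω, ℝ)) (C : ℝ≥0), (∀ ψ, ‖u ψ‖ₑ ≤ C * M (ofTest Ω ψ)) →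
    N u ≤ C ∧ ∀ ε > 0, ∃ φ, N (u - ofTest Ω φ) < ε
  le_right : ∀ (u : 𝓓'(Ω, ℝ)) (C : ℝ≥0), (∀ ψ, ‖u ψ‖ₑ ≤ C * N (ofTest Ω ψ)) →
    M u ≤ C ∧ ∀ ε > 0, ∃ φ, M (u - ofTest Ω φ) < ε
  eval_left : ∀ φ, ∃ C : ℝ≥0, ∀ u, N u < ∞ → ‖u φ‖ₑ ≤ C * N u
  eval_right : ∀ φ, ∃ C : ℝ≥0, ∀ u, M u < ∞ → ‖u φ‖ₑ ≤ C * M u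
  dense_left : ∀ (K : Set (Rn n)), IsCompact K → K ⊆ Ω → ∀ u ∈ supportedIn Ω K, N u < ∞ →
    ∀ ε > 0, ∃ φ, N (u - ofTest Ω φ) < ε
  dense_right : ∀ (K : Set (Rn n)), IsCompact K → K ⊆ Ω → ∀ u ∈ supportedIn Ω K, M u < ∞ →
    ∀ ε > 0, ∃ φ, M (u - ofTest Ω φ) < ε

theorem DualNorms.symm {N M : ExtSeminorm 𝓓'(Ω, ℝ)} (h : DualNorms Ω N M) : DualNorms Ω M N where
  finite_left := h.finite_right
  finite_right := h.finite_left
  pairing φ ψ := by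
    rw [mul_comm]
    refine le_of_eq_of_le ?_ (h.pairing ψ φ)
    simp only [ofTest_apply, mul_comm]
  le_left := h.le_right
  le_right := h.le_left
  eval_left := h.eval_right
  eval_right := h.eval_left
  dense_left := h.dense_right
  dense_right := h.dense_left

theorem normDual_le (s : ℝ) (u : 𝓓'(Ω, ℝ)) (C : ℝ≥0)
    (h : ∀ ψ, ‖u ψ‖ₑ ≤ C * normNonneg Ω s p (ofTest Ω ψ)) :
    normDual Ω s p u ≤ C ∧ ∀ ε > 0, ∃ φ, normDual Ω s p (u - ofTest Ω φ) < ε := by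
  obtain ⟨F, hFC, hF⟩ := exists_dual_of_bound (testZero Ω s p)
    (u : 𝓓(Ω, ℝ) →ₗ[ℝ] ℝ) C fun φ => by
      rw [enorm_testZero]
      exact h φ
  have hFu : (F, u) ∈ dualRel Ω s p := fun φ => (hF φ).symm
  refine ⟨(ExtSeminorm.transport_le _ _ hFu).trans hFC, fun ε hε => ?_⟩
  have hmem : F ∈ (LinearMap.range (testDual Ω s p)).topologicalClosure := by
    rw [dense_range_testDual]
    trivial
  obtain ⟨G, ⟨ψ, rfl⟩, hG⟩ := (EMetric.mem_closure_iff
    (s := (LinearMap.range (testDual Ω s p) : Set (StrongDual ℝ (SobolevZero Ω s p))))).1 hmem ε hε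
  refine ⟨ψ, lt_of_le_of_lt (ExtSeminorm.transport_le _ _
    ((dualRel Ω s p).sub_mem hFu (testDual_mem_dualRel s ψ))) ?_⟩
  rwa [edist_eq_enorm_sub] at hG

theorem normNonneg_le (s : ℝ) (u : 𝓓'(Ω, ℝ)) (C : ℝ≥0)
    (h : ∀ ψ, ‖u ψ‖ₑ ≤ C * normDual Ω s p (ofTest Ω ψ)) :
    normNonneg Ω s p u ≤ C ∧ ∀ ε > 0, ∃ φ, normNonneg Ω s p (u - ofTest Ω φ) < ε := by
  have hle (ψ : 𝓓(Ω, ℝ)) : normDual Ω s p (ofTest Ω ψ) ≤ ‖testDual Ω s p ψ‖ₑ :=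
    ExtSeminorm.transport_le _ _ (testDual_mem_dualRel s ψ)
  obtain ⟨x, hxC, hx⟩ := exists_of_surjectiveBidual (surjectiveBidual_sobolevZero s p) (testDual Ω s p)
    (u : 𝓓(Ω, ℝ) →ₗ[ℝ] ℝ) C fun ψ => (h ψ).trans (mul_le_mul_right (hle ψ) _)
  have hxu : x.1.1 = u := by
    ext ψ
    exact hx ψ
  subst hxu
  constructor
  · rw [← enorm_sobolevNonneg]
    exact hxC
  · intro ε hε
    obtain ⟨y, ⟨φ, rfl⟩, hy⟩ := EMetric.mem_closure_iff.1 x.2 ε hε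
    refine ⟨φ, ?_⟩
    rw [edist_eq_enorm_sub, enorm_sobolevNonneg] at hy
    exact hy

theorem dualNorms_normNonneg_normDual (s : ℝ) :
    DualNorms Ω (normNonneg Ω s p) (normDual Ω s p) where
  finite_left := normNonneg_ofTest_lt Ω s p
  finite_right := normDual_ofTest_lt Ω s p
  pairing φ ψ := by
    rw [mul_comm]
    refine le_of_eq_of_le ?_ (enorm_apply_le_normDual (normDual_ofTest_lt Ω s p ψ) φ)
    simp only [ofTest_apply, mul_comm]
  le_left := normNonneg_le s
  le_right := normDual_le s
  eval_left φ := ⟨(eLpNorm φ (ENNReal.ofReal p.conjExponent)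
    (volume.restrict (Ω : Set (Rn n)))).toNNReal, fun u hu => by
      rw [ENNReal.coe_toNNReal (memLp_test φ _).2.ne, mul_comm]
      exact enorm_apply_le_normNonneg hu φ⟩
  eval_right φ := ⟨(normNonneg Ω s p (ofTest Ω φ)).toNNReal, fun u hu => by
      rw [ENNReal.coe_toNNReal (normNonneg_ofTest_lt Ω s p φ).ne, mul_comm]
      exact enorm_apply_le_normDual hu φ⟩
  dense_left K hK hKΩ u huK hu := by
    obtain ⟨C, hC, h⟩ := exists_bounded_test_approximation hK hKΩ s hu huK
    refine (normNonneg_le s u C.toNNReal fun ψ => ?_).2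
    rw [ENNReal.coe_toNNReal hC.ne]
    refine ENNReal.le_of_forall_pos_le_add fun ε hε _ => ?_
    obtain ⟨g, hg, hgu⟩ := h ψ ε hε
    calc ‖u ψ‖ₑ = ‖ofTest Ω g ψ + (u ψ - ofTest Ω g ψ)‖ₑ := by rw [add_sub_cancel]
      _ ≤ ‖ofTest Ω g ψ‖ₑ + ‖u ψ - ofTest Ω g ψ‖ₑ := enorm_add_le _ _
      _ ≤ C * normDual Ω s p (ofTest Ω ψ) + ε := by
        gcongr
        · refine le_trans (le_of_eq_of_le ?_
            (enorm_apply_le_normDual (normDual_ofTest_lt Ω s p ψ) g)) ?_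
          · simp only [ofTest_apply, mul_comm]
          · rw [mul_comm]
            gcongr
        · rw [← ofReal_norm]
          exact ENNReal.ofReal_le_of_le_toReal hgu
  dense_right K _ _ u _ hu := by
    refine (normDual_le s u (normDual Ω s p u).toNNReal fun ψ => ?_).2
    rw [ENNReal.coe_toNNReal hu.ne]
    exact enorm_apply_le_normDual hu ψ

/-! ### The case `s = 0` -/

theorem Lp_enorm_le_of_forall_integral {α : Type*} [MeasurableSpace α] {μ : Measure α} {q : ℝ}
    [Fact (1 < q)] (hpq : p.HolderConjugate q) (g : Lp ℝ (ENNReal.ofReal q) μ) (C : ℝ≥0)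
    (h : ∀ f : Lp ℝ (ENNReal.ofReal p) μ, ‖∫ x, g x * f x ∂μ‖ₑ ≤ C * ‖f‖ₑ) : ‖g‖ₑ ≤ C := by
  have hp : 1 < p := Fact.out
  have hq : 1 < q := Fact.out
  have hp0 : 0 < p := one_pos.trans hp
  have hq0 : 0 < q := one_pos.trans hq
  set f₀ : α → ℝ := fun x => |g x| ^ (q - 2) * g x with hf₀
  have hψ : Measurable fun x : ℝ => |x| ^ (q - 2) * x := by fun_prop
  have hm : AEStronglyMeasurable f₀ μ :=
    (hψ.comp_aemeasurable (Lp.aestronglyMeasurable g).aemeasurable).aestronglyMeasurable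
  have habs (x : α) : |f₀ x| = |g x| ^ (q - 1) := by
    rcases eq_or_ne (g x) 0 with hx | hx
    · simp [hf₀, hx, Real.zero_rpow (by linarith : q - 1 ≠ 0)]
    · have hx' := abs_pos.2 hx
      rw [hf₀, abs_mul, abs_of_nonneg (by positivity), show q - 1 = q - 2 + 1 by ring,
        Real.rpow_add_one hx'.ne']
  have hpow (x : α) : |f₀ x| ^ p = |g x| ^ q := by
    rw [habs, ← Real.rpow_mul (abs_nonneg _), hpq.symm.sub_one_mul_conj]
  have hgi := integrable_abs_rpow hq (Lp.memLp g)
  have hf : MemLp f₀ (ENNReal.ofReal p) μ := by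
    rw [← integrable_norm_rpow_iff hm (by simpa using hp0) ENNReal.ofReal_ne_top,
      ENNReal.toReal_ofReal hp0.le]
    simpa only [Real.norm_eq_abs, hpow] using hgi
  have hcoe := hf.coeFn_toLp
  have h1 : ∫ x, g x * hf.toLp f₀ x ∂μ = ‖g‖ ^ q := by
    rw [norm_rpow_eq_integral hq]
    refine integral_congr_ae ?_
    filter_upwards [hcoe] with x hx
    rw [hx]
    rcases eq_or_ne (g x) 0 with hx | hx
    · simp [hx, Real.zero_rpow hq0.ne']
    · have hx' := abs_pos.2 hx
      simp only [hf₀]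
      rw [mul_left_comm, ← abs_mul_abs_self (g x), ← mul_assoc, ← Real.rpow_add_one hx'.ne',
        ← Real.rpow_add_one hx'.ne']
      congr 1
      ring
  have h2 : ‖hf.toLp f₀‖ ^ p = ‖g‖ ^ q := by
    rw [norm_rpow_eq_integral hp, norm_rpow_eq_integral hq]
    refine integral_congr_ae ?_
    filter_upwards [hcoe] with x hx
    rw [hx, hpow]
  have h3 : ‖hf.toLp f₀‖ = ‖g‖ ^ (q - 1) := by
    rw [← Real.rpow_left_inj (norm_nonneg _) (Real.rpow_nonneg (norm_nonneg _) _) hp0.ne', h2,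
      ← Real.rpow_mul (norm_nonneg _), hpq.symm.sub_one_mul_conj]
  have h4 := ENNReal.toReal_mono (by finiteness) (h (hf.toLp f₀))
  rw [h1, ENNReal.toReal_mul, toReal_enorm, toReal_enorm, h3, Real.norm_eq_abs,
    abs_of_nonneg (by positivity), ENNReal.coe_toReal] at h4
  rw [← ofReal_norm]
  refine ENNReal.ofReal_le_of_le_toReal ?_
  rw [ENNReal.coe_toReal]
  rcases (norm_nonneg g).eq_or_lt with h0 | h0
  · rw [← h0]
    exact C.2
  · have e : ‖g‖ ^ q = ‖g‖ * ‖g‖ ^ (q - 1) := by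
      rw [mul_comm, ← Real.rpow_add_one h0.ne', sub_add_cancel]
    rw [e] at h4
    exact le_of_mul_le_mul_right h4 (Real.rpow_pos_of_pos h0 _)

theorem normNonneg_zero (u : 𝓓'(Ω, ℝ)) : normNonneg Ω 0 p u = lpNorm Ω p u := by
  have h0 : multiDeriv Ω 0 = LinearMap.id := by
    simp only [multiDeriv, Pi.zero_apply, pow_zero, List.ofFn_const, List.prod_replicate, one_pow]
    rfl
  have h : normNonneg Ω 0 p u = (∑ m ∈ Finset.range 1, ∑ ν ∈ Finset.piAntidiag Finset.univ m,
      lpNorm Ω p (multiDeriv Ω ν u)) + 0 := by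
    simp only [normNonneg, Int.fract_zero, if_true, Nat.floor_zero, zero_add]
    rfl
  rw [h, add_zero, Finset.sum_range_one, Finset.piAntidiag_zero, Finset.sum_singleton, h0]
  rfl

theorem lpNorm_ofTest (φ : 𝓓(Ω, ℝ)) : lpNorm Ω p (ofTest Ω φ) =
    eLpNorm φ (ENNReal.ofReal p) (volume.restrict (Ω : Set (Rn n))) := by
  rw [lpNorm_eq (lpRel_test p φ), Lp.enorm_toLp]

theorem normDual_zero {q : ℝ} [Fact (1 < q)] (hpq : p.HolderConjugate q) (u : 𝓓'(Ω, ℝ)) :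
    normDual Ω 0 p u = normNonneg Ω 0 q u := by
  rw [normNonneg_zero]
  refine le_antisymm ?_ ?_
  · rcases eq_or_ne (lpNorm Ω q u) ∞ with h | h
    · rw [h]
      exact le_top
    · rw [← ENNReal.coe_toNNReal h]
      refine (normDual_le 0 u _ fun ψ => ?_).1
      rw [ENNReal.coe_toNNReal h, normNonneg_zero, lpNorm_ofTest]
      have := enorm_apply_le_lpNorm u h.lt_top ψ
      rwa [hpq.symm.conjExponent_eq] at this
  · rcases eq_or_ne (normDual Ω 0 p u) ∞ with h | h
    · rw [h]
      exact le_top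
    · obtain ⟨C, hC⟩ := WithTop.ne_top_iff_exists.1 h
      let e : 𝓓(Ω, ℝ) →ₗ[ℝ] LpOn Ω p :=
        { toFun := fun φ => (memLp_test φ (ENNReal.ofReal p)).toLp φ
          map_add' := fun _ _ => rfl
          map_smul' := fun _ _ => rfl }
      obtain ⟨l, hlC, hl⟩ := exists_dual_of_bound e (u : 𝓓(Ω, ℝ) →ₗ[ℝ] ℝ) C fun φ => by
        have := enorm_apply_le_normDual h.lt_top φ
        rw [normNonneg_zero, lpNorm_ofTest, ← hC] at this
        refine this.trans_eq ?_
        congr 1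
        exact (Lp.enorm_toLp (memLp_test φ (ENNReal.ofReal p))).symm
      obtain ⟨g, hg⟩ := exists_Lp_forall_eq_integral hpq l
      have hgu : (g, u) ∈ lpRel Ω q := fun φ => by
        refine (hl φ).symm.trans ((hg _).trans (integral_congr_ae ?_))
        filter_upwards [(memLp_test φ (ENNReal.ofReal p)).coeFn_toLp] with x hx
        change g x * (memLp_test φ (ENNReal.ofReal p)).toLp φ x = _
        rw [hx]
      rw [lpNorm_eq hgu, ← hC]
      refine Lp_enorm_le_of_forall_integral hpq g C fun f => ?_
      rw [← hg]
      refine (l.le_opENorm f).trans ?_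
      gcongr

theorem extSeminorm_ext {V : Type*} [AddCommGroup V] [Module ℝ V] {M N : ExtSeminorm V}
    (h : ∀ v, M v = N v) : M = N := by
  cases M
  cases N
  congr 1
  exact funext h

theorem normDual_congr {s t r : ℝ} [Fact (1 < r)] (hr : r = p) (ht : t = s) :
    normDual Ω t r = normDual Ω s p := by
  subst hr ht
  rfl

theorem dualNorms_sobolevNorm (Ω : Opens (Rn n)) (s p : ℝ) [Fact (1 < p)] :
    DualNorms Ω (sobolevNorm Ω s p) (sobolevNorm Ω (-s) p.conjExponent) := by
  have hpq := Real.HolderConjugate.conjExponent (Fact.out : 1 < p)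
  rcases lt_trichotomy s 0 with hs | rfl | hs
  · rw [sobolevNorm, if_neg hs.not_ge, sobolevNorm, if_pos (by linarith)]
    exact (dualNorms_normNonneg_normDual _).symm
  · have h := dualNorms_normNonneg_normDual (Ω := Ω) (p := p) 0
    rw [sobolevNorm, if_pos le_rfl, neg_zero, sobolevNorm, if_pos le_rfl]
    rwa [extSeminorm_ext fun u => (normDual_zero hpq u).symm]
  · rw [sobolevNorm, if_pos hs.le, sobolevNorm, if_neg (by linarith),
      normDual_congr hpq.symm.conjExponent_eq (neg_neg s)]
    exact dualNorms_normNonneg_normDual s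

end Sobolev

end

noncomputable section

namespace Sobolev

open Filter

variable {n : ℕ} {Ω : Opens (Rn n)} {p : ℝ}

/-! ### Continuity of the inclusion of the test functions -/

theorem exists_eLpNorm_slobodeckijQuotient_le {θ : ℝ} (hp : 1 < p) (hθ : 0 < θ) (hθ1 : θ < 1)
    {K : Set (Rn n)} (hK : IsCompact K) : ∃ C : ℝ≥0, ∀ (f : Rn n → ℝ) (A : ℝ≥0),
      (∀ x ∉ K, f x = 0) → (∀ x y, |f x - f y| ≤ A) → (∀ x y, |f x - f y| ≤ A * ‖x - y‖) →
      eLpNorm (slobodeckijQuotient p θ f) (ENNReal.ofReal p)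
        ((volume : Measure (Rn n)).prod volume) ≤ A * C := by
  rcases eq_or_ne n 0 with rfl | hn
  · refine ⟨0, fun f A _ _ _ => ?_⟩
    have : slobodeckijQuotient p θ f = 0 := by
      ext z
      simp [slobodeckijQuotient, Subsingleton.elim z.1 z.2]
    simp [this]
  have : NeZero n := ⟨hn⟩
  have hp0 : 0 < p := one_pos.trans hp
  have hKm : MeasurableSet K := hK.isClosed.measurableSet
  set H : Rn n → ℝ≥0∞ := fun w => ENNReal.ofReal (if ‖w‖ ≤ 1 then
    1 * ‖w‖ ^ (p - n - θ * p) else 1 * ‖w‖ ^ (-n - θ * p)) with hH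
  have hHm : Measurable H := by
    refine ENNReal.measurable_ofReal.comp (Measurable.ite ?_ (by fun_prop) (by fun_prop))
    exact measurableSet_le measurable_norm measurable_const
  have hHi : ∫⁻ w, H w < ∞ := lintegral_radial_lt_top hp hθ hθ1
  have hind : Measurable (K.indicator (1 : Rn n → ℝ≥0∞)) := measurable_one.indicator hKm
  set D := ∫⁻ z : Rn n × Rn n, (K.indicator 1 z.1 * H (z.1 - z.2) +
    K.indicator 1 z.2 * H (z.1 - z.2)) ∂((volume : Measure (Rn n)).prod volume) with hD
  have hDfin : D < ∞ := by
    rw [hD, lintegral_add_left (by fun_prop)]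
    refine ENNReal.add_lt_top.2 ⟨?_, ?_⟩
    · rw [lintegral_prod _ (by fun_prop)]
      have h (x : Rn n) : ∫⁻ y, K.indicator 1 x * H (x - y) = K.indicator 1 x * ∫⁻ w, H w := by
        rw [lintegral_const_mul _ (by fun_prop), lintegral_sub_left_eq_self H x]
      simp_rw [h]
      rw [lintegral_mul_const _ hind, lintegral_indicator_one hKm]
      exact ENNReal.mul_lt_top hK.measure_lt_top hHi
    · rw [lintegral_prod_symm _ (by fun_prop)]
      have h (y : Rn n) : ∫⁻ x, K.indicator 1 y * H (x - y) = K.indicator 1 y * ∫⁻ w, H w := by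
        rw [lintegral_const_mul _ (by fun_prop), lintegral_sub_right_eq_self H y]
      simp_rw [h]
      rw [lintegral_mul_const _ hind, lintegral_indicator_one hKm]
      exact ENNReal.mul_lt_top hK.measure_lt_top hHi
  refine ⟨(D ^ (1 / p)).toNNReal, fun f A hfK hA hAL => ?_⟩
  have hbound (x y : Rn n) (hxy : x ≠ y) :
      ‖slobodeckijQuotient p θ f (x, y)‖ₑ ^ p ≤ (A : ℝ≥0∞) ^ p * H (x - y) := by
    have hr : 0 < ‖x - y‖ := norm_pos_iff.2 (sub_ne_zero.2 hxy)
    have e1 : ‖slobodeckijQuotient p θ f (x, y)‖ₑ ^ p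
        = ENNReal.ofReal (|f x - f y| ^ p * ‖x - y‖ ^ (-n - θ * p)) := by
      rw [← ofReal_norm, ENNReal.ofReal_rpow_of_nonneg (norm_nonneg _) hp0.le]
      congr 1
      rw [slobodeckijQuotient, norm_div, Real.norm_eq_abs, Real.norm_eq_abs,
        abs_of_nonneg (Real.rpow_nonneg hr.le _), Real.div_rpow (abs_nonneg _)
        (Real.rpow_nonneg hr.le _), ← Real.rpow_mul hr.le, div_eq_mul_inv,
        ← Real.rpow_neg hr.le]
      congr 2
      field_simp
      ring
    have e2 : (A : ℝ≥0∞) ^ p = ENNReal.ofReal ((A : ℝ) ^ p) := by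
      rw [← ENNReal.ofReal_coe_nnreal, ENNReal.ofReal_rpow_of_nonneg A.coe_nonneg hp0.le]
    rw [e1, e2, hH, ← ENNReal.ofReal_mul (by positivity)]
    refine ENNReal.ofReal_le_ofReal ?_
    split_ifs with h
    · calc |f x - f y| ^ p * ‖x - y‖ ^ (-n - θ * p)
          ≤ (A * ‖x - y‖) ^ p * ‖x - y‖ ^ (-n - θ * p) := by
            gcongr
            exact hAL x y
        _ = A ^ p * (1 * ‖x - y‖ ^ (p - n - θ * p)) := by
          rw [Real.mul_rpow A.coe_nonneg hr.le, mul_assoc, ← Real.rpow_add hr, one_mul]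
          congr 2
          ring
    · rw [one_mul]
      gcongr
      exact hA x y
  have hpt (z : Rn n × Rn n) : ‖slobodeckijQuotient p θ f z‖ₑ ^ p ≤
      (A : ℝ≥0∞) ^ p * (K.indicator 1 z.1 * H (z.1 - z.2) + K.indicator 1 z.2 * H (z.1 - z.2)) := by
    by_cases h : z.1 = z.2
    · simp [slobodeckijQuotient, h, hp0]
    · have hb := hbound z.1 z.2 h
      by_cases h1 : z.1 ∈ K
      · refine hb.trans ?_
        gcongr
        simp [h1]
      · by_cases h2 : z.2 ∈ K
        · simpa [h1, h2] using hb
        · simp [slobodeckijQuotient, hfK _ h1, hfK _ h2, hp0]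
  rw [eLpNorm_eq_lintegral_rpow_enorm_toReal (by simpa using hp0) ENNReal.ofReal_ne_top,
    ENNReal.toReal_ofReal hp0.le]
  calc (∫⁻ z, ‖slobodeckijQuotient p θ f z‖ₑ ^ p ∂((volume : Measure (Rn n)).prod volume)) ^ (1 / p)
      ≤ ((A : ℝ≥0∞) ^ p * D) ^ (1 / p) := by
        gcongr
        refine (lintegral_mono hpt).trans_eq ?_
        rw [lintegral_const_mul _ (by fun_prop)]
    _ = A * (D ^ (1 / p)).toNNReal := by
        rw [ENNReal.mul_rpow_of_nonneg _ _ (by positivity), ← ENNReal.rpow_mul,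
          mul_one_div_cancel hp0.ne', ENNReal.rpow_one, ENNReal.coe_toNNReal]
        exact (ENNReal.rpow_lt_top_of_nonneg (by positivity) hDfin.ne).ne

/-- On the test functions with support in a fixed compact set, `N` is bounded by a continuous
seminorm. -/
def TestContinuous (N : ExtSeminorm 𝓓'(Ω, ℝ)) : Prop :=
  ∀ (K : Compacts (Rn n)) (hK : (K : Set (Rn n)) ⊆ Ω), ∃ q : Seminorm ℝ 𝓓_{K}(Rn n, ℝ),
    Continuous q ∧ ∀ φ : 𝓓_{K}(Rn n, ℝ),
      N (ofTest Ω (TestFunction.ofSupportedIn hK φ)) ≤ ENNReal.ofReal (q φ)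

namespace TestContinuous

variable {M N : ExtSeminorm 𝓓'(Ω, ℝ)}

theorem zero : TestContinuous (0 : ExtSeminorm 𝓓'(Ω, ℝ)) :=
  fun _ _ => ⟨0, continuous_const, fun _ => bot_le⟩

theorem add (hM : TestContinuous M) (hN : TestContinuous N) : TestContinuous (M + N) := by
  intro K hK
  obtain ⟨q, hq, h⟩ := hM K hK
  obtain ⟨q', hq', h'⟩ := hN K hK
  refine ⟨q + q', hq.add hq', fun φ => ?_⟩
  rw [_root_.add_apply, ENNReal.ofReal_add (apply_nonneg q φ) (apply_nonneg q' φ)]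
  exact add_le_add (h φ) (h' φ)

theorem sum {ι : Type*} (s : Finset ι) {N : ι → ExtSeminorm 𝓓'(Ω, ℝ)}
    (h : ∀ i ∈ s, TestContinuous (N i)) : TestContinuous (ExtSeminorm.sum s N) := by
  classical
  induction s using Finset.induction_on with
  | empty => exact fun _ _ => ⟨0, continuous_const, fun _ => by simp [ExtSeminorm.sum]⟩
  | insert a s ha ih =>
    have e : ExtSeminorm.sum (insert a s) N = N a + ExtSeminorm.sum s N :=
      extSeminorm_ext fun v => Finset.sum_insert ha
    rw [e]
    exact (h a (by simp)).add (ih fun i hi => h i (by simp [hi]))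

theorem exists_multiDeriv {K : Compacts (Rn n)} (hK : (K : Set (Rn n)) ⊆ Ω) (ν : Fin n → ℕ) :
    ∃ B : 𝓓_{K}(Rn n, ℝ) →L[ℝ] 𝓓_{K}(Rn n, ℝ), ∀ φ,
      multiDeriv Ω ν (ofTest Ω (TestFunction.ofSupportedIn hK φ)) =
        ofTest Ω (TestFunction.ofSupportedIn hK (B φ)) := by
  let S : Submonoid (Module.End ℝ 𝓓'(Ω, ℝ)) :=
    { carrier := {L | ∃ B : 𝓓_{K}(Rn n, ℝ) →L[ℝ] 𝓓_{K}(Rn n, ℝ), ∀ φ,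
        L (ofTest Ω (TestFunction.ofSupportedIn hK φ)) =
          ofTest Ω (TestFunction.ofSupportedIn hK (B φ))}
      one_mem' := ⟨ContinuousLinearMap.id ℝ _, fun _ => rfl⟩
      mul_mem' := by
        rintro L M ⟨B, hB⟩ ⟨B', hB'⟩
        exact ⟨B.comp B', fun φ => by rw [Module.End.mul_apply, hB', hB]; rfl⟩ }
  refine S.list_prod_mem fun L hL => ?_
  obtain ⟨i, rfl⟩ := List.mem_ofFn.1 hL
  refine S.pow_mem ⟨(ContDiffMapSupportedIn.postcompCLM
    (ContinuousLinearMap.apply ℝ ℝ (EuclideanSpace.single i (1 : ℝ)))).comp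
    (ContDiffMapSupportedIn.fderivCLM ℝ ⊤ ⊤), fun φ => ?_⟩ _
  refine (lineDeriv_ofTest _ _).trans (congrArg _ ?_)
  ext x
  change TestFunction.fderivCLM ℝ ⊤ ⊤ (TestFunction.ofSupportedIn hK φ) x _ = _
  rw [TestFunction.fderivCLM_ofSupportedIn]
  rfl

theorem comp (hN : TestContinuous N) (ν : Fin n → ℕ) : TestContinuous (N.comp (multiDeriv Ω ν)) := by
  intro K hK
  obtain ⟨q, hq, h⟩ := hN K hK
  obtain ⟨B, hB⟩ := exists_multiDeriv hK ν
  refine ⟨q.comp B.toLinearMap, hq.comp B.continuous, fun φ => ?_⟩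
  change N (multiDeriv Ω ν _) ≤ _
  rw [hB]
  exact h (B φ)

theorem lpNorm (p : ℝ) [Fact (1 < p)] : TestContinuous (lpNorm Ω p) := by
  intro K hK
  set V := (volume (K : Set (Rn n)) ^ (1 / (ENNReal.ofReal p).toReal)).toNNReal with hV
  have hVfin : volume (K : Set (Rn n)) ^ (1 / (ENNReal.ofReal p).toReal) ≠ ∞ :=
    (ENNReal.rpow_lt_top_of_nonneg (by positivity) K.isCompact.measure_lt_top.ne).ne
  have hp : ENNReal.ofReal p ≠ 0 := by simpa using one_pos.trans (Fact.out : 1 < p)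
  refine ⟨V • ContDiffMapSupportedIn.seminorm ℝ (Rn n) ℝ ⊤ K 0,
    ((ContDiffMapSupportedIn.withSeminorms ℝ (Rn n) ℝ ⊤ K).continuous_seminorm 0).const_smul V,
    fun φ => ?_⟩
  rw [lpNorm_ofTest]
  set A := ContDiffMapSupportedIn.seminorm ℝ (Rn n) ℝ ⊤ K 0 φ
  have hA : 0 ≤ A := apply_nonneg _ φ
  calc eLpNorm φ (ENNReal.ofReal p) (volume.restrict (Ω : Set (Rn n)))
      ≤ eLpNorm ((K : Set (Rn n)).indicator fun _ => A) (ENNReal.ofReal p) volume := by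
        refine (eLpNorm_mono_measure _ Measure.restrict_le_self).trans (eLpNorm_mono fun x => ?_)
        by_cases hx : x ∈ (K : Set (Rn n))
        · rw [Set.indicator_of_mem hx, Real.norm_of_nonneg hA]
          exact ContDiffMapSupportedIn.norm_apply_le_seminorm ℝ
        · rw [show φ x = 0 from φ.zero_on_compl hx, norm_zero]
          exact norm_nonneg _
    _ = ENNReal.ofReal (V • A) := by
        rw [eLpNorm_indicator_const K.isCompact.measurableSet hp ENNReal.ofReal_ne_top,
          Real.enorm_of_nonneg hA, NNReal.smul_def, smul_eq_mul, ENNReal.ofReal_mul V.coe_nonneg,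
          ENNReal.ofReal_coe_nnreal, hV, ENNReal.coe_toNNReal hVfin, mul_comm]

theorem slobodeckijSeminorm (p : ℝ) [Fact (1 < p)] {θ : ℝ} (hθ : 0 < θ) (hθ1 : θ < 1) :
    TestContinuous (slobodeckijSeminorm Ω p θ) := by
  intro K hK
  obtain ⟨C, hC⟩ := exists_eLpNorm_slobodeckijQuotient_le (Fact.out : 1 < p) hθ hθ1 K.isCompact
  set S := ContDiffMapSupportedIn.seminorm ℝ (Rn n) ℝ ⊤ K
  have hS (i : ℕ) : Continuous (S i) :=
    (ContDiffMapSupportedIn.withSeminorms ℝ (Rn n) ℝ ⊤ K).continuous_seminorm i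
  refine ⟨C • (S 0 + S 0 + S 1), (((hS 0).add (hS 0)).add (hS 1)).const_smul C, fun φ => ?_⟩
  have hS0 (i : ℕ) : 0 ≤ S i φ := apply_nonneg _ φ
  have hb (x : Rn n) : ‖φ x‖ ≤ S 0 φ := ContDiffMapSupportedIn.norm_apply_le_seminorm ℝ
  have hd (x : Rn n) : ‖fderiv ℝ φ x‖ ≤ S 1 φ := by
    rw [← norm_iteratedFDeriv_one]
    exact ContDiffMapSupportedIn.norm_iteratedFDeriv_apply_le_seminorm_top ℝ
  set A : ℝ≥0 := ⟨S 0 φ + S 0 φ + S 1 φ, by have := hS0 0; have := hS0 1; positivity⟩ with hA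
  have h := hC φ A (fun x hx => φ.zero_on_compl hx) (fun x y => ?_) fun x y => ?_
  · rw [slobodeckijSeminorm_eq_of_isGivenBy (ofTest_apply (TestFunction.ofSupportedIn hK φ))
      (memLp_test _ _), volume₂, Measure.prod_restrict]
    refine ((eLpNorm_mono_measure _ Measure.restrict_le_self).trans h).trans_eq ?_
    change _ = ENNReal.ofReal (C • (A : ℝ))
    rw [NNReal.smul_def, smul_eq_mul, ENNReal.ofReal_mul C.coe_nonneg, ENNReal.ofReal_coe_nnreal,
      ENNReal.ofReal_coe_nnreal, mul_comm]
  · have := abs_sub (φ x) (φ y)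
    have h1 := hb x
    have h2 := hb y
    have := hS0 1
    rw [Real.norm_eq_abs] at h1 h2
    change _ ≤ S 0 φ + S 0 φ + S 1 φ
    linarith
  · have h1 : ‖φ x - φ y‖ ≤ S 1 φ * ‖x - y‖ :=
      convex_univ.norm_image_sub_le_of_norm_fderiv_le
        (fun z _ => (φ.contDiff.differentiable (by simp)).differentiableAt) (fun z _ => hd z)
        (Set.mem_univ y) (Set.mem_univ x)
    refine h1.trans (mul_le_mul_of_nonneg_right ?_ (norm_nonneg _))
    have := hS0 0
    change _ ≤ S 0 φ + S 0 φ + S 1 φ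
    linarith

theorem normNonneg (s p : ℝ) [Fact (1 < p)] : TestContinuous (normNonneg Ω s p) := by
  refine add (sum _ fun m _ => sum _ fun ν _ => (lpNorm p).comp ν) ?_
  split_ifs with hs
  · exact zero
  · exact sum _ fun ν _ => (slobodeckijSeminorm p
      (lt_of_le_of_ne (Int.fract_nonneg s) (Ne.symm hs)) (Int.fract_lt_one s)).comp ν

theorem normDual (s p : ℝ) [Fact (1 < p)] : TestContinuous (normDual Ω s p) := by
  intro K hK
  obtain ⟨q, hq, h⟩ := lpNorm (Ω := Ω) p.conjExponent K hK
  refine ⟨q, hq, fun φ => le_trans ?_ (h φ)⟩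
  set ψ := TestFunction.ofSupportedIn hK φ
  have hfin : eLpNorm ψ (ENNReal.ofReal p.conjExponent)
    (volume.restrict (Ω : Set (Rn n))) ≠ ∞ := (memLp_test ψ _).2.ne
  rw [lpNorm_ofTest]
  refine (ExtSeminorm.transport_le _ _ (testDual_mem_dualRel s ψ)).trans ?_
  change ‖testDual Ω s p ψ‖ₑ ≤ _
  rw [← ofReal_norm, ← ENNReal.ofReal_toReal hfin]
  exact ENNReal.ofReal_le_ofReal 
    (ContinuousLinearMap.opNorm_le_bound _ ENNReal.toReal_nonneg (norm_apply_le_sobolevZero ψ))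

theorem sobolevNorm (s p : ℝ) [Fact (1 < p)] : TestContinuous (sobolevNorm Ω s p) := by
  unfold Sobolev.sobolevNorm
  split_ifs
  · exact normNonneg s p
  · exact normDual _ _

/-- A linear functional on the test functions that is bounded by `N` on the test functions with
support in any fixed compact set is a distribution. -/
theorem exists_distribution (hN : TestContinuous N) (l : 𝓓(Ω, ℝ) →ₗ[ℝ] ℝ)
    (hl : ∀ K : Compacts (Rn n), (K : Set (Rn n)) ⊆ Ω → ∃ C : ℝ, ∀ φ : 𝓓(Ω, ℝ),
      tsupport φ ⊆ K → |l φ| ≤ C * (N (ofTest Ω φ)).toReal) :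
    ∃ u : 𝓓'(Ω, ℝ), ∀ φ, u φ = l φ := by
  refine ⟨ContinuousLinearMap.toUniformConvergenceCLM (RingHom.id ℝ) ℝ _ ⟨l, ?_⟩, fun φ => rfl⟩
  refine (TestFunction.continuous_iff_continuous_comp (𝕜 := ℝ) l).2 fun K hK => ?_
  obtain ⟨q, hq, h⟩ := hN K hK
  obtain ⟨C, hC⟩ := hl K hK
  let lK : 𝓓_{K}(Rn n, ℝ) →ₗ[ℝ] ℝ := l ∘ₗ
    (TestFunction.ofSupportedInCLM ℝ hK : 𝓓_{K}(Rn n, ℝ) →L[ℝ] 𝓓(Ω, ℝ)).toLinearMap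
  have hlK (φ : 𝓓_{K}(Rn n, ℝ)) : ‖lK φ‖ ≤ |C| * q φ := by
    refine (hC (TestFunction.ofSupportedIn hK φ) φ.tsupport_subset).trans ?_
    have := ENNReal.toReal_mono ENNReal.ofReal_ne_top (h φ)
    rw [ENNReal.toReal_ofReal (apply_nonneg q φ)] at this
    exact mul_le_mul (le_abs_self C) this ENNReal.toReal_nonneg (abs_nonneg C)
  change Continuous lK
  refine continuous_of_continuousAt_zero lK ?_
  rw [ContinuousAt, map_zero]
  refine squeeze_zero_norm hlK ?_
  have := (hq.tendsto 0).const_mul |C|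
  rwa [map_zero, mul_zero] at this

end TestContinuous

end Sobolev

end

noncomputable section

namespace Sobolev

open Filter Bornology

/-! ### Strong duals of topological vector spaces -/

section Dual

set_option linter.unusedSectionVars false

variable {E F : Type*} [AddCommGroup E] [Module ℝ E] [TopologicalSpace E]
  [IsTopologicalAddGroup E] [ContinuousSMul ℝ E] [AddCommGroup F] [Module ℝ F] [TopologicalSpace F]
  [IsTopologicalAddGroup F] [ContinuousSMul ℝ F]

theorem evalBidual_apply (x : E) (f : StrongDual ℝ E) : evalBidual E x f = f x := rfl

theorem continuous_to_dual (g : F →ₗ[ℝ] StrongDual ℝ E) (h : ∀ B : Set E, IsVonNBounded ℝ B →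
    ∀ ε > 0, ∀ᶠ x in 𝓝 0, ∀ b ∈ B, |g x b| ≤ ε) : Continuous g := by
  refine continuous_of_continuousAt_zero g ?_
  rw [ContinuousAt, map_zero, ContinuousLinearMap.nhds_zero_eq]
  simp only [tendsto_iInf, tendsto_principal]
  intro B hB U hU
  obtain ⟨ε, hε, hεU⟩ := Metric.nhds_basis_closedBall.mem_iff.1 hU
  filter_upwards [h B hB ε hε] with x hx b hb
  exact hεU (by simpa using hx b hb)

theorem eventually_forall_abs_le {B : Set E} (hB : IsVonNBounded ℝ B) {ε : ℝ} (hε : 0 < ε) :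
    ∀ᶠ f : StrongDual ℝ E in 𝓝 0, ∀ b ∈ B, |f b| ≤ ε := by
  filter_upwards [ContinuousLinearMap.eventually_nhds_zero_mapsTo (F := ℝ) hB
    (Metric.closedBall_mem_nhds (0 : ℝ) hε)] with f hf b hb
  simpa using hf hb

/-- A bounded subset of the strong dual is uniformly bounded on bounded sets. -/
theorem exists_forall_forall_abs_le {S : Set (StrongDual ℝ E)} (hS : IsVonNBounded ℝ S) {B : Set E}
    (hB : IsVonNBounded ℝ B) : ∃ C, ∀ f ∈ S, ∀ b ∈ B, |f b| ≤ C := by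
  obtain ⟨C, hC⟩ := (NormedSpace.isVonNBounded_iff ℝ).1
    (ContinuousLinearMap.isVonNBounded_image2_apply hS hB) |>.exists_norm_le
  exact ⟨C, fun f hf b hb => hC _ ⟨f, hf, b, hb, rfl⟩⟩

/-- The transpose of a linear homeomorphism. -/
def dualCongr (e : E ≃L[ℝ] F) : StrongDual ℝ E ≃L[ℝ] StrongDual ℝ F :=
  e.arrowCongr (ContinuousLinearEquiv.refl ℝ ℝ)

/-- In a reflexive space, the canonical map to the bidual, as a linear homeomorphism. -/
def bidualEquiv (h : IsReflexive E) : E ≃L[ℝ] StrongDual ℝ (StrongDual ℝ E) where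
  toLinearEquiv := LinearEquiv.ofBijective (evalBidual E) h.bijective
  continuous_toFun := h.continuous
  continuous_invFun := (h.homeomorph _).symm.continuous.congr fun Φ => by
    refine h.injective ?_
    exact ((h.homeomorph _).apply_symm_apply Φ).trans
      ((LinearEquiv.ofBijective (evalBidual E) h.bijective).apply_symm_apply Φ).symm

theorem bidualEquiv_symm_apply (h : IsReflexive E) (Φ : StrongDual ℝ (StrongDual ℝ E))
    (f : StrongDual ℝ E) : f ((bidualEquiv h).symm Φ) = Φ f :=
  congrArg (fun Ψ : StrongDual ℝ (StrongDual ℝ E) => Ψ f) ((bidualEquiv h).apply_symm_apply Φ)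

theorem isReflexive_of_equiv (e : E ≃L[ℝ] StrongDual ℝ (StrongDual ℝ E))
    (h : ∀ x f, e x f = f x) : IsReflexive E := by
  have : ⇑(evalBidual E) = e := funext fun x => by
    ext f
    exact (h x f).symm
  rw [IsReflexive, this]
  exact e.toHomeomorph.isHomeomorph

/-- The strong dual of a reflexive space is reflexive. -/
theorem IsReflexive.dual (h : IsReflexive E) : IsReflexive (StrongDual ℝ E) :=
  isReflexive_of_equiv (dualCongr (F := StrongDual ℝ (StrongDual ℝ E)) (bidualEquiv h))
    fun f Φ => bidualEquiv_symm_apply h Φ f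

theorem IsReflexive.congr (e : E ≃L[ℝ] F) (h : IsReflexive E) : IsReflexive F :=
  isReflexive_of_equiv ((e.symm.trans (bidualEquiv h)).trans (dualCongr (dualCongr e)))
    fun y f => by
      change f (e (e.symm y)) = f y
      rw [e.apply_symm_apply]

/-- In a locally convex space, the canonical map to the bidual is open onto its range. -/
theorem comap_evalBidual_le [LocallyConvexSpace ℝ E] :
    comap (evalBidual E) (𝓝 0) ≤ 𝓝 0 := by
  refine (nhds_hasBasis_absConvex_open ℝ E).ge_iff.2 fun U hU => ?_
  obtain ⟨h0, hUo, hUb, hUc⟩ := hU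
  let S : Set (StrongDual ℝ E) := {f | ∀ a ∈ U, |f a| ≤ 1}
  have hS : IsVonNBounded ℝ S := by
    refine ContinuousLinearMap.isVonNBounded_iff.2 fun B hB => ?_
    obtain ⟨r, hr, hBr⟩ := (hB (hUo.mem_nhds h0)).exists_pos
    refine (NormedSpace.isVonNBounded_iff ℝ).2 (isBounded_iff_forall_norm_le.2 ⟨r, ?_⟩)
    rintro _ ⟨f, hf, b, hb, rfl⟩
    obtain ⟨a, ha, rfl⟩ := hBr r (by simp [abs_of_pos hr]) hb
    have := hf a ha
    simp only [_root_.map_smul, smul_eq_mul, norm_mul, Real.norm_eq_abs, abs_of_pos hr]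
    nlinarith
  refine mem_of_superset (preimage_mem_comap (eventually_forall_abs_le hS one_half_pos))
    fun x hx => ?_
  by_contra hxU
  obtain ⟨f, hf⟩ := geometric_hahn_banach_open_point hUc hUo hxU
  have hfx : 0 < f x := by simpa using hf 0 h0
  have hgS : (f x)⁻¹ • f ∈ S := fun a ha => by
    have h1 := hf a ha
    have h2 := hf (-a) (hUb.neg_mem_iff.2 ha)
    rw [map_neg] at h2
    simp only [smul_apply, smul_eq_mul, abs_mul, abs_inv, abs_of_pos hfx]
    rw [inv_mul_le_iff₀ hfx, mul_one]
    exact (abs_lt.2 ⟨by linarith, h1⟩).le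
  have := hx _ hgS
  simp only [evalBidual_apply, smul_apply, smul_eq_mul, inv_mul_cancel₀ hfx.ne', abs_one] at this
  norm_num at this

/-- The composition of a continuous linear map on a normed space and the canonical map to the
bidual is continuous. -/
theorem continuous_evalBidual_comp {X : Type*} [NormedAddCommGroup X] [NormedSpace ℝ X]
    (i : X →L[ℝ] E) : Continuous (evalBidual E ∘ₗ i.toLinearMap) := by
  refine continuous_to_dual _ fun S hS ε hε => ?_
  have hB : IsVonNBounded ℝ (i '' Metric.closedBall 0 1) :=
    ((NormedSpace.isVonNBounded_closedBall ℝ X 1).image i)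
  obtain ⟨C, hC⟩ := exists_forall_forall_abs_le hS hB
  have hle (f : StrongDual ℝ E) (hf : f ∈ S) (x : X) : |f (i x)| ≤ |C| * ‖x‖ := by
    have := (f.comp i).opNorm_le_of_unit_norm (C := |C|) (abs_nonneg C) fun y hy =>
      (hC f hf (i y) ⟨y, by simp [hy], rfl⟩).trans (le_abs_self C)
    exact (f.comp i).le_of_opNorm_le this x
  filter_upwards [Metric.ball_mem_nhds (0 : X) (show 0 < ε / (|C| + 1) by positivity)] with x hx f hf
  refine (hle f hf x).trans ?_
  rw [mem_ball_zero_iff, lt_div_iff₀ (by positivity)] at hx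
  nlinarith [norm_nonneg x, abs_nonneg C]

/-- A semireflexive locally convex space whose canonical map to the bidual is continuous is
reflexive. -/
theorem IsSemireflexive.isReflexive [LocallyConvexSpace ℝ E] (h : IsSemireflexive E)
    (hc : Continuous (evalBidual E)) : IsReflexive E := by
  let e := LinearEquiv.ofBijective (evalBidual E) h
  refine isReflexive_of_equiv ⟨e, hc, ?_⟩ fun x f => rfl
  refine continuous_of_continuousAt_zero e.symm ?_
  rw [ContinuousAt, map_zero]
  intro U hU
  obtain ⟨V, hV, hVU⟩ := comap_evalBidual_le hU
  refine mem_map.2 (mem_of_superset hV fun Φ hΦ => hVU ?_)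
  change evalBidual E (e.symm Φ) ∈ V
  rwa [show evalBidual E (e.symm Φ) = Φ from e.apply_symm_apply Φ]

end Dual

end Sobolev

end

noncomputable section

namespace Sobolev

open Filter Bornology

variable {n : ℕ} {Ω : Opens (Rn n)} {s p : ℝ} [Fact (1 < p)]

/-! ### Multiplication by test functions -/

theorem enorm_sobolevSpace (u : SobolevSpace Ω s p) : ‖u‖ₑ = sobolevNorm Ω s p u.1 := by
  rw [← ofReal_norm]
  exact ENNReal.ofReal_toReal u.2.ne

theorem IsSmoothMultiplicationTriple.exists_bound (h : IsSmoothMultiplicationTriple Ω s p)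
    (θ : 𝓓(Ω, ℝ)) : ∃ C : ℝ≥0, ∀ u, sobolevNorm Ω s p u < ∞ →
      sobolevNorm Ω s p (mulDistribution θ u) ≤ C * sobolevNorm Ω s p u := by
  obtain ⟨m, hm⟩ := h θ
  refine ⟨‖m‖₊, fun u hu => ?_⟩
  let w : SobolevSpace Ω s p := ⟨u, hu⟩
  have e : (m w).1 = mulDistribution θ u := hm w
  have h1 := m.le_opENorm w
  rw [enorm_sobolevSpace (m w), enorm_sobolevSpace w, e] at h1
  exact h1

theorem mulTest_eq_zero {θ φ : 𝓓(Ω, ℝ)} (h : tsupport φ ⊆ (tsupport θ)ᶜ) : mulTest θ φ = 0 := by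
  ext y
  rw [mulTest_apply]
  by_cases hy : y ∈ tsupport φ
  · rw [image_eq_zero_of_notMem_tsupport (h hy), zero_mul]
    rfl
  · rw [image_eq_zero_of_notMem_tsupport hy, mul_zero]
    rfl

theorem mulDistribution_mem_supportedIn (θ : 𝓓(Ω, ℝ)) (u : 𝓓'(Ω, ℝ)) :
    mulDistribution θ u ∈ supportedIn Ω (tsupport θ) := by
  intro x hx
  by_contra hxθ
  refine (Distribution.notMem_dsupport_iff x).2 ⟨(tsupport θ)ᶜ, fun ψ hψ => ?_,
    (isClosed_tsupport θ).isOpen_compl, hxθ⟩ hx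
  rw [mulDistribution_apply, mulTest_eq_zero hψ, map_zero]

theorem mulDistribution_cutoff {K V : Set (Rn n)} {θ : 𝓓(Ω, ℝ)} (hV : IsOpen V) (hKV : K ⊆ V)
    (hθ : ∀ x ∈ V, θ x = 1) {u : 𝓓'(Ω, ℝ)} (hu : u ∈ supportedIn Ω K) :
    mulDistribution θ u = u := by
  ext ψ
  rw [mulDistribution_apply]
  exact apply_smoothMul_cutoff hu hV hKV fun x hx => by rw [mulTest_apply, hθ x hx, one_mul]

theorem mulDistribution_ofTest (θ φ : 𝓓(Ω, ℝ)) :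
    mulDistribution θ (ofTest Ω φ) = ofTest Ω (mulTest θ φ) := by
  ext ψ
  rw [mulDistribution_apply, ofTest_apply, ofTest_apply]
  refine integral_congr_ae (Eventually.of_forall fun x => ?_)
  simp only [mulTest_apply]
  ring

theorem mulTest_assoc (θ φ ψ : 𝓓(Ω, ℝ)) :
    mulTest θ (mulTest φ ψ) = mulTest (mulTest θ φ) ψ := by
  ext x
  simp only [mulTest_apply, mul_assoc]

theorem mulTest_cutoff {θ φ : 𝓓(Ω, ℝ)} (h : ∀ x ∈ tsupport φ, θ x = 1) : mulTest θ φ = φ := by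
  ext x
  rw [mulTest_apply]
  by_cases hx : x ∈ tsupport φ
  · rw [h x hx, one_mul]
  · rw [image_eq_zero_of_notMem_tsupport hx, mul_zero]

theorem tsupport_mulTest_subset_left (θ φ : 𝓓(Ω, ℝ)) : tsupport (mulTest θ φ) ⊆ tsupport θ :=
  tsupport_mul_subset_left

theorem ofTest_mem_supportedIn (φ : 𝓓(Ω, ℝ)) {K : Set (Rn n)} (hK : tsupport φ ⊆ K) :
    ofTest Ω φ ∈ supportedIn Ω K := by
  intro x hx
  by_contra hxK
  refine (Distribution.notMem_dsupport_iff x).2 ⟨(tsupport φ)ᶜ, fun ψ hψ => ?_,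
    (isClosed_tsupport φ).isOpen_compl, fun h => hxK (hK h)⟩ hx
  rw [ofTest_apply]
  refine integral_eq_zero_of_ae (Eventually.of_forall fun y => ?_)
  by_cases hy : y ∈ tsupport φ
  · simp [image_eq_zero_of_notMem_tsupport fun h => hψ h hy]
  · simp [image_eq_zero_of_notMem_tsupport hy]

/-! ### The topology of `W^{s,p}_comp(Ω)` -/

theorem exists_compact_exhaustion (Ω : Opens (Rn n)) : ∃ L : ℕ → Compacts (Rn n),
    (∀ j, (L j : Set (Rn n)) ⊆ Ω) ∧ ∀ K : Set (Rn n), IsCompact K → K ⊆ Ω →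
      ∀ᶠ j in atTop, K ⊆ L j := by
  have : LocallyCompactSpace Ω := Ω.isOpen.locallyCompactSpace
  let X : CompactExhaustion Ω := default
  refine ⟨fun j => ⟨Subtype.val '' X j, (X.isCompact j).image continuous_subtype_val⟩,
    fun j => by rintro _ ⟨x, -, rfl⟩; exact x.2, fun K hK hKΩ => ?_⟩
  have hK' : IsCompact ((↑) ⁻¹' K : Set Ω) := by
    have e : ((↑) '' ((↑) ⁻¹' K : Set Ω) : Set (Rn n)) = K := by
      ext x
      exact ⟨by rintro ⟨y, hy, rfl⟩; exact hy, fun hx => ⟨⟨x, hKΩ hx⟩, hx, rfl⟩⟩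
    rw [Subtype.isCompact_iff, e]
    exact hK
  obtain ⟨j, hj⟩ := X.exists_superset_of_isCompact hK'
  filter_upwards [eventually_ge_atTop j] with i hi x hx
  exact ⟨⟨x, hKΩ hx⟩, X.subset hi (hj hx), rfl⟩

namespace SobolevComp

theorem continuous_toComp (K : Compacts (Rn n)) (hK : (K : Set (Rn n)) ⊆ Ω) :
    Continuous (SobolevSupp.toComp Ω s p K hK) :=
  continuous_sInf_rng.2 fun _ ht => ht.1 K hK

instance : LocallyConvexSpace ℝ (SobolevComp Ω s p) :=
  LocallyConvexSpace.sInf fun _ ht => ht.2.2.2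

/-- The universal property of the inductive limit topology. -/
theorem continuous_of_comp {F : Type*} [AddCommGroup F] [Module ℝ F] [TopologicalSpace F]
    [IsTopologicalAddGroup F] [ContinuousSMul ℝ F] [LocallyConvexSpace ℝ F]
    (g : SobolevComp Ω s p →ₗ[ℝ] F) (h : ∀ (K : Compacts (Rn n)) (hK : (K : Set (Rn n)) ⊆ Ω),
      Continuous (g ∘ₗ SobolevSupp.toComp Ω s p K hK)) : Continuous g := by
  rw [continuous_iff_le_induced]
  exact sInf_le ⟨fun K hK => continuous_induced_rng.2 (h K hK), topologicalAddGroup_induced g,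
    continuousSMul_induced g, .induced g⟩

theorem continuous_of_bound {F : Type*} [SeminormedAddCommGroup F] [NormedSpace ℝ F]
    (g : SobolevComp Ω s p →ₗ[ℝ] F)
    (h : ∀ K : Compacts (Rn n), (K : Set (Rn n)) ⊆ Ω → ∃ C : ℝ, ∀ x : SobolevComp Ω s p,
      x.1 ∈ supportedIn Ω (K : Set (Rn n)) → ‖g x‖ ≤ C * (sobolevNorm Ω s p x.1).toReal) :
    Continuous g := by
  refine continuous_of_comp g fun K hK => ?_
  obtain ⟨C, hC⟩ := h K hK
  exact AddMonoidHomClass.continuous_of_bound (g ∘ₗ SobolevSupp.toComp Ω s p K hK) C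
    fun x => hC _ x.2

theorem exists_bound (f : StrongDual ℝ (SobolevComp Ω s p)) (K : Compacts (Rn n))
    (hK : (K : Set (Rn n)) ⊆ Ω) : ∃ C : ℝ≥0, ∀ x : SobolevComp Ω s p,
      x.1 ∈ supportedIn Ω (K : Set (Rn n)) → |f x| ≤ C * (sobolevNorm Ω s p x.1).toReal := by
  let g : SobolevSupp Ω s p (K : Set (Rn n)) →L[ℝ] ℝ :=
    f.comp ⟨SobolevSupp.toComp Ω s p K hK, continuous_toComp K hK⟩
  exact ⟨‖g‖₊, fun x hx => g.le_opNorm ⟨⟨x.1, x.2.1⟩, hx⟩⟩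

theorem isVonNBounded_of_bound (K : Compacts (Rn n)) (hK : (K : Set (Rn n)) ⊆ Ω) (R : ℝ≥0) :
    IsVonNBounded ℝ {x : SobolevComp Ω s p | x.1 ∈ supportedIn Ω (K : Set (Rn n)) ∧
      sobolevNorm Ω s p x.1 ≤ R} := by
  let i : SobolevSupp Ω s p (K : Set (Rn n)) →L[ℝ] SobolevComp Ω s p :=
    ⟨SobolevSupp.toComp Ω s p K hK, continuous_toComp K hK⟩
  refine ((NormedSpace.isVonNBounded_closedBall ℝ _ (R : ℝ)).image i).subset ?_
  rintro x ⟨hxK, hxR⟩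
  refine ⟨⟨⟨x.1, x.2.1⟩, hxK⟩, ?_, rfl⟩
  rw [mem_closedBall_zero_iff]
  have := ENNReal.toReal_mono ENNReal.coe_ne_top hxR
  exact this

/-- The evaluation at a test function, as a continuous linear functional. -/
def eval (Ω : Opens (Rn n)) (s p : ℝ) [Fact (1 < p)] (φ : 𝓓(Ω, ℝ)) :
    StrongDual ℝ (SobolevComp Ω s p) where
  toFun x := x.1 φ
  map_add' _ _ := rfl
  map_smul' _ _ := rfl
  cont := by
    let g : SobolevComp Ω s p →ₗ[ℝ] ℝ :=
      { toFun := fun x => x.1 φ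
        map_add' := fun _ _ => rfl
        map_smul' := fun _ _ => rfl }
    change Continuous g
    obtain ⟨C, hC⟩ := (dualNorms_sobolevNorm Ω s p).eval_left φ
    refine continuous_of_bound g fun K _ => ⟨C, fun x _ => ?_⟩
    have := ENNReal.toReal_mono (ENNReal.mul_ne_top ENNReal.coe_ne_top x.2.1.ne) (hC x.1 x.2.1)
    rw [ENNReal.toReal_mul, toReal_enorm] at this
    exact this

/-- A bounded subset of `W^{s,p}_comp(Ω)` is contained in some `W^{s,p}_K(Ω)`. -/
theorem exists_supportedIn_of_isVonNBounded {B : Set (SobolevComp Ω s p)}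
    (hB : IsVonNBounded ℝ B) : ∃ K : Compacts (Rn n), (K : Set (Rn n)) ⊆ Ω ∧
      ∀ x ∈ B, x.1 ∈ supportedIn Ω (K : Set (Rn n)) := by
  obtain ⟨L, hL, hLK⟩ := exists_compact_exhaustion Ω
  by_contra! hcon
  choose x hxB hx using fun j => hcon (L j) (hL j)
  have hφ (j : ℕ) : ∃ φ : 𝓓(Ω, ℝ), Disjoint (L j : Set (Rn n)) (tsupport φ) ∧ (x j).1 φ ≠ 0 := by
    by_contra! h
    refine hx j fun y hy => ?_
    by_contra hyL
    refine (Distribution.notMem_dsupport_iff y).2 ⟨(L j : Set (Rn n))ᶜ, fun φ hφ => h φ ?_,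
      (L j).isCompact.isClosed.isOpen_compl, hyL⟩ hy
    exact Set.disjoint_left.2 fun z hz hzφ => hφ hzφ hz
  choose φ hφd hφx using hφ
  have hfin (y : SobolevComp Ω s p) : ∀ᶠ j in atTop, y.1 (φ j) = 0 := by
    obtain ⟨-, K, hK, hyK⟩ := y.2
    filter_upwards [hLK K K.isCompact hK] with j hj
    exact apply_eq_zero_of_disjoint hyK ((hφd j).mono_left hj)
  have hbd (y : SobolevComp Ω s p) : ∃ C, ∀ j, ‖(j / (x j).1 (φ j)) * y.1 (φ j)‖ ≤ C := by
    obtain ⟨j₀, hj₀⟩ := eventually_atTop.1 (hfin y)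
    refine ⟨∑ j ∈ Finset.range j₀, ‖(j / (x j).1 (φ j)) * y.1 (φ j)‖, fun j => ?_⟩
    rcases lt_or_ge j j₀ with hj | hj
    · exact Finset.single_le_sum (f := fun j : ℕ => ‖(j / (x j).1 (φ j)) * y.1 (φ j)‖)
        (fun _ _ => norm_nonneg _) (Finset.mem_range.2 hj)
    · rw [hj₀ j hj, mul_zero, norm_zero]
      exact Finset.sum_nonneg fun _ _ => norm_nonneg _
  let G : SobolevComp Ω s p →ₗ[ℝ] BoundedContinuousFunction ℕ ℝ :=
    { toFun := fun y => BoundedContinuousFunction.ofNormedAddCommGroup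
        (fun j : ℕ => (j / (x j).1 (φ j)) * y.1 (φ j)) continuous_of_discreteTopology
        (hbd y).choose (hbd y).choose_spec
      map_add' := fun y z => by
        ext j
        exact mul_add _ (y.1 (φ j)) (z.1 (φ j))
      map_smul' := fun c y => by
        ext j
        exact mul_left_comm _ c (y.1 (φ j)) }
  have hGc : Continuous G := by
    refine continuous_of_bound G fun K hK => ?_
    obtain ⟨j₀, hj₀⟩ := eventually_atTop.1 (hLK K K.isCompact hK)
    choose C hC using fun j => exists_bound (eval Ω s p (φ j)) K hK
    refine ⟨∑ j ∈ Finset.range j₀, |j / (x j).1 (φ j)| * C j, fun y hy => ?_⟩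
    have h0 : 0 ≤ ∑ j ∈ Finset.range j₀, |j / (x j).1 (φ j)| * C j :=
      Finset.sum_nonneg fun j _ => mul_nonneg (abs_nonneg _) (C j).coe_nonneg
    refine (BoundedContinuousFunction.norm_le (mul_nonneg h0 ENNReal.toReal_nonneg)).2 fun j => ?_
    change |(j / (x j).1 (φ j)) * y.1 (φ j)| ≤ _
    rcases lt_or_ge j j₀ with hj | hj
    · rw [abs_mul]
      calc |j / (x j).1 (φ j)| * |y.1 (φ j)|
          ≤ |j / (x j).1 (φ j)| * (C j * (sobolevNorm Ω s p y.1).toReal) :=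
            mul_le_mul_of_nonneg_left (hC j y hy) (abs_nonneg _)
        _ = |j / (x j).1 (φ j)| * C j * (sobolevNorm Ω s p y.1).toReal := by ring
        _ ≤ _ := mul_le_mul_of_nonneg_right (Finset.single_le_sum
            (f := fun j : ℕ => |j / (x j).1 (φ j)| * (C j : ℝ))
            (fun j _ => mul_nonneg (abs_nonneg _) (C j).coe_nonneg) (Finset.mem_range.2 hj))
            ENNReal.toReal_nonneg
    · rw [apply_eq_zero_of_disjoint hy ((hφd j).mono_left (hj₀ j hj)), mul_zero, abs_zero]
      exact mul_nonneg h0 ENNReal.toReal_nonneg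
  obtain ⟨C, hC⟩ := (NormedSpace.isVonNBounded_iff ℝ).1
    (hB.image (⟨G, hGc⟩ : SobolevComp Ω s p →L[ℝ] BoundedContinuousFunction ℕ ℝ))
    |>.exists_norm_le
  obtain ⟨j, hj⟩ := exists_nat_gt C
  have h1 := (BoundedContinuousFunction.norm_coe_le_norm (G (x j)) j).trans
    (hC _ ⟨x j, hxB j, rfl⟩)
  change |(j / (x j).1 (φ j)) * (x j).1 (φ j)| ≤ C at h1
  rw [div_mul_cancel₀ _ (hφx j), Nat.abs_cast] at h1
  linarith

/-- A bounded subset of `W^{s,p}_comp(Ω)` is a bounded subset of some `W^{s,p}_K(Ω)`. -/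
theorem exists_bound_of_isVonNBounded (h1 : IsSmoothMultiplicationTriple Ω s p)
    {B : Set (SobolevComp Ω s p)} (hB : IsVonNBounded ℝ B) :
    ∃ K : Compacts (Rn n), (K : Set (Rn n)) ⊆ Ω ∧ ∃ R : ℝ≥0, ∀ x ∈ B,
      x.1 ∈ supportedIn Ω (K : Set (Rn n)) ∧ sobolevNorm Ω s p x.1 ≤ R := by
  obtain ⟨K, hK, hBK⟩ := exists_supportedIn_of_isVonNBounded hB
  obtain ⟨θ, V, hV, hKV, hθ⟩ := exists_cutoff K.isCompact hK
  obtain ⟨A, hA⟩ := h1.exists_bound θ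
  let G : SobolevComp Ω s p →ₗ[ℝ] SobolevSpace Ω s p :=
    (mulDistribution θ ∘ₗ (compSubmodule Ω s p).subtype).codRestrict (sobolevNorm Ω s p).finite
      fun x => (hA x.1 x.2.1).trans_lt (ENNReal.mul_lt_top ENNReal.coe_lt_top x.2.1)
  have hG : Continuous G := continuous_of_bound G fun K' _ => ⟨A, fun x _ => by
    have := ENNReal.toReal_mono (ENNReal.mul_ne_top ENNReal.coe_ne_top x.2.1.ne) (hA x.1 x.2.1)
    rw [ENNReal.toReal_mul] at this
    exact this⟩
  obtain ⟨C, hC⟩ := (NormedSpace.isVonNBounded_iff ℝ).1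
    (hB.image (⟨G, hG⟩ : SobolevComp Ω s p →L[ℝ] SobolevSpace Ω s p)) |>.exists_norm_le
  refine ⟨K, hK, C.toNNReal, fun x hx => ⟨hBK x hx, ?_⟩⟩
  have h2 : ‖G x‖ ≤ C := hC _ ⟨x, hx, rfl⟩
  have h3 : ‖G x‖ₑ = sobolevNorm Ω s p x.1 := by
    rw [enorm_sobolevSpace]
    exact congrArg _ (mulDistribution_cutoff hV hKV hθ (hBK x hx))
  rw [← h3, ← ofReal_norm]
  exact ENNReal.ofReal_le_ofReal h2

end SobolevComp

end Sobolev

end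

noncomputable section

namespace Sobolev

open Filter Bornology

variable {n : ℕ} {Ω : Opens (Rn n)} {s p : ℝ} [Fact (1 < p)]

/-! ### The dual of `W^{s,p}_comp(Ω)` -/

theorem DualNorms.enorm_apply_le {N M : ExtSeminorm 𝓓'(Ω, ℝ)} (h : DualNorms Ω N M)
    {K : Set (Rn n)} (hK : IsCompact K) (hKΩ : K ⊆ Ω) {v : 𝓓'(Ω, ℝ)} (hvK : v ∈ supportedIn Ω K)
    (hv : M v < ∞) (φ : 𝓓(Ω, ℝ)) : ‖v φ‖ₑ ≤ M v * N (ofTest Ω φ) := by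
  obtain ⟨C, hC⟩ := h.eval_right φ
  have hN := (h.finite_left φ).ne
  have hle (ε : ℝ≥0∞) (hε : 0 < ε) :
      ‖v φ‖ₑ ≤ C * ε + N (ofTest Ω φ) * (ε + M v) := by
    obtain ⟨ψ, hψ⟩ := h.dense_right K hK hKΩ v hvK hv ε hε
    have e : v φ = (v - ofTest Ω ψ) φ + ofTest Ω φ ψ := by
      have : ofTest Ω ψ φ = ofTest Ω φ ψ := by simp only [ofTest_apply, mul_comm]
      rw [← this]
      exact (sub_add_cancel (v φ) _).symm
    have hψM : M (ofTest Ω ψ) ≤ ε + M v := by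
      have e' : ofTest Ω ψ = (-1 : ℝ) • (v - ofTest Ω ψ) + v := by
        rw [neg_one_smul, neg_sub, sub_add_cancel]
      rw [e']
      refine (M.add_le' _ _).trans (add_le_add_left ?_ _)
      refine (M.smul_le' _ _).trans ?_
      rw [enorm_neg, enorm_one, one_mul]
      exact hψ.le
    calc ‖v φ‖ₑ ≤ ‖(v - ofTest Ω ψ) φ‖ₑ + ‖ofTest Ω φ ψ‖ₑ := by
          rw [e]
          exact enorm_add_le _ _
      _ ≤ C * M (v - ofTest Ω ψ) + N (ofTest Ω φ) * M (ofTest Ω ψ) :=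
          add_le_add (hC _ (hψ.trans_le le_top)) (h.pairing φ ψ)
      _ ≤ _ := add_le_add (mul_le_mul_right hψ.le _) (mul_le_mul_right hψM _)
  have ht : Tendsto (fun ε => C * ε + N (ofTest Ω φ) * (ε + M v)) (𝓝[>] 0)
      (𝓝 (C * 0 + N (ofTest Ω φ) * (0 + M v))) := by
    refine Tendsto.mono_left ?_ nhdsWithin_le_nhds
    exact ((ENNReal.continuous_const_mul ENNReal.coe_ne_top).add
      ((ENNReal.continuous_const_mul hN).comp (continuous_id.add continuous_const))).tendsto 0
  rw [mul_zero, zero_add, zero_add, mul_comm] at ht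
  exact ge_of_tendsto ht (eventually_mem_nhdsWithin.mono fun ε hε => hle ε hε)

namespace SobolevComp

theorem testComp_val (φ : 𝓓(Ω, ℝ)) : (testComp Ω s p φ).1 = ofTest Ω φ := rfl

/-- The approximation of elements of `W^{s,p}_comp(Ω)` by test functions. -/
theorem exists_seq_tendsto (h1 : IsSmoothMultiplicationTriple Ω s p) {K V : Set (Rn n)}
    (hK : IsCompact K) (hKΩ : K ⊆ Ω) (hV : IsOpen V) (hKV : K ⊆ V) {θ : 𝓓(Ω, ℝ)}
    (hθ : ∀ x ∈ V, θ x = 1) (x : SobolevComp Ω s p) (hx : x.1 ∈ supportedIn Ω K) :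
    ∃ φ : ℕ → 𝓓(Ω, ℝ), Tendsto (fun k => sobolevNorm Ω s p (x.1 - ofTest Ω (φ k))) atTop (𝓝 0) ∧
      Tendsto (fun k => testComp Ω s p (mulTest θ (φ k))) atTop (𝓝 x) := by
  choose φ hφ using fun k : ℕ => (dualNorms_sobolevNorm Ω s p).dense_left K hK hKΩ x.1 hx x.2.1
    ((k : ℝ≥0∞)⁻¹) (by simp)
  have hφ0 : Tendsto (fun k => sobolevNorm Ω s p (x.1 - ofTest Ω (φ k))) atTop (𝓝 0) :=
    tendsto_of_tendsto_of_tendsto_of_le_of_le tendsto_const_nhds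
      ENNReal.tendsto_inv_nat_nhds_zero (fun _ => bot_le) fun k => (hφ k).le
  refine ⟨φ, hφ0, ?_⟩
  obtain ⟨A, hA⟩ := h1.exists_bound θ
  have hθx := mulDistribution_cutoff hV hKV hθ hx
  let Kθ : Compacts (Rn n) := ⟨tsupport θ, θ.hasCompactSupport⟩
  let y : SobolevSupp Ω s p (Kθ : Set (Rn n)) := ⟨⟨x.1, x.2.1⟩, by
    have := mulDistribution_mem_supportedIn θ x.1
    rw [hθx] at this
    exact this⟩
  let z (k : ℕ) : SobolevSupp Ω s p (Kθ : Set (Rn n)) :=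
    ⟨⟨ofTest Ω (mulTest θ (φ k)), sobolevNorm_ofTest_lt Ω s p _⟩,
      ofTest_mem_supportedIn _ (tsupport_mulTest_subset_left θ (φ k))⟩
  have hz : Tendsto z atTop (𝓝 y) := by
    rw [tendsto_iff_edist_tendsto_0]
    have hle (k : ℕ) : edist (z k) y ≤ A * sobolevNorm Ω s p (x.1 - ofTest Ω (φ k)) := by
      rw [edist_comm, edist_eq_enorm_sub]
      have e : ‖y - z k‖ₑ = sobolevNorm Ω s p (x.1 - ofTest Ω (mulTest θ (φ k))) :=
        enorm_sobolevSpace (y - z k).1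
      rw [e, ← mulDistribution_ofTest]
      nth_rw 1 [← hθx]
      rw [← map_sub]
      exact hA _ (x - testComp Ω s p (φ k)).2.1
    have h0 := ENNReal.Tendsto.const_mul (a := (A : ℝ≥0∞)) hφ0 (.inr ENNReal.coe_ne_top)
    rw [mul_zero] at h0
    exact tendsto_of_tendsto_of_tendsto_of_le_of_le tendsto_const_nhds h0 (fun _ => bot_le) hle
  exact ((continuous_toComp Kθ θ.tsupport_subset).tendsto y).comp hz

theorem eq_of_forall_test (h1 : IsSmoothMultiplicationTriple Ω s p) {K V : Set (Rn n)}
    (hK : IsCompact K) (hKΩ : K ⊆ Ω) (hV : IsOpen V) (hKV : K ⊆ V) {θ : 𝓓(Ω, ℝ)}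
    (hθ : ∀ x ∈ V, θ x = 1) {f g : StrongDual ℝ (SobolevComp Ω s p)}
    (hfg : ∀ φ, f (testComp Ω s p (mulTest θ φ)) = g (testComp Ω s p (mulTest θ φ)))
    (x : SobolevComp Ω s p) (hx : x.1 ∈ supportedIn Ω K) : f x = g x := by
  obtain ⟨φ, -, hφ⟩ := exists_seq_tendsto h1 hK hKΩ hV hKV hθ x hx
  refine tendsto_nhds_unique ((f.continuous.tendsto x).comp hφ) ?_
  exact ((g.continuous.tendsto x).comp hφ).congr fun k => (hfg (φ k)).symm

theorem exists_restrict (f : StrongDual ℝ (SobolevComp Ω s p)) :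
    ∃ u : 𝓓'(Ω, ℝ), ∀ φ, u φ = f (testComp Ω s p φ) :=
  (TestContinuous.sobolevNorm s p).exists_distribution (f.toLinearMap ∘ₗ testComp Ω s p)
    fun K hK => by
      obtain ⟨C, hC⟩ := exists_bound f K hK
      exact ⟨C, fun φ hφ => hC _ (ofTest_mem_supportedIn φ hφ)⟩

/-- The restriction of a continuous linear functional on `W^{s,p}_comp(Ω)` to the test
functions. -/
def restrict (Ω : Opens (Rn n)) (s p : ℝ) [Fact (1 < p)] :
    StrongDual ℝ (SobolevComp Ω s p) →ₗ[ℝ] 𝓓'(Ω, ℝ) where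
  toFun f := (exists_restrict f).choose
  map_add' f g := by
    ext φ
    change _ = (exists_restrict f).choose φ + (exists_restrict g).choose φ
    rw [(exists_restrict (f + g)).choose_spec, (exists_restrict f).choose_spec,
      (exists_restrict g).choose_spec]
    rfl
  map_smul' c f := by
    ext φ
    change _ = c • (exists_restrict f).choose φ
    rw [(exists_restrict (c • f)).choose_spec, (exists_restrict f).choose_spec]
    rfl

theorem restrict_apply (f : StrongDual ℝ (SobolevComp Ω s p)) (φ : 𝓓(Ω, ℝ)) :
    restrict Ω s p f φ = f (testComp Ω s p φ) := (exists_restrict f).choose_spec φ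

theorem sobolevNorm_mul_restrict_le {θ : 𝓓(Ω, ℝ)} {A : ℝ≥0}
    (hA : ∀ u, sobolevNorm Ω s p u < ∞ →
      sobolevNorm Ω s p (mulDistribution θ u) ≤ A * sobolevNorm Ω s p u)
    {f : StrongDual ℝ (SobolevComp Ω s p)} {ε : ℝ≥0}
    (hf : ∀ x : SobolevComp Ω s p, x.1 ∈ supportedIn Ω (tsupport θ) → sobolevNorm Ω s p x.1 ≤ A →
      |f x| ≤ ε) :
    sobolevNorm Ω (-s) p.conjExponent (mulDistribution θ (restrict Ω s p f)) ≤ ε := by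
  refine ((dualNorms_sobolevNorm Ω s p).le_right _ ε fun ψ => ?_).1
  rw [mulDistribution_apply, restrict_apply]
  have hψ := sobolevNorm_ofTest_lt Ω s p ψ
  rcases eq_or_ne (sobolevNorm Ω s p (ofTest Ω ψ)) 0 with h0 | h0
  · have e : testComp Ω s p (mulTest θ ψ) = 0 := by
      refine Subtype.ext ?_
      rw [testComp_val, ← mulDistribution_ofTest, eq_zero_of_sobolevNorm _ h0, map_zero]
      rfl
    rw [e, map_zero, enorm_zero]
    exact bot_le
  set r := (sobolevNorm Ω s p (ofTest Ω ψ)).toReal with hr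
  have hr0 : 0 < r := ENNReal.toReal_pos h0 hψ.ne
  have hrN : sobolevNorm Ω s p (ofTest Ω ψ) = ENNReal.ofReal r := (ENNReal.ofReal_toReal hψ.ne).symm
  have hx : (testComp Ω s p (mulTest θ (r⁻¹ • ψ))).1 = mulDistribution θ (ofTest Ω (r⁻¹ • ψ)) :=
    (mulDistribution_ofTest _ _).symm
  have hn : sobolevNorm Ω s p (ofTest Ω (r⁻¹ • ψ)) = 1 := by
    rw [_root_.map_smul, ExtSeminorm.map_smul, hrN, ← ofReal_norm, Real.norm_of_nonneg
      (inv_nonneg.2 hr0.le), ← ENNReal.ofReal_mul (inv_nonneg.2 hr0.le), inv_mul_cancel₀ hr0.ne',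
      ENNReal.ofReal_one]
  have h := hf (testComp Ω s p (mulTest θ (r⁻¹ • ψ)))
    (hx ▸ mulDistribution_mem_supportedIn θ _) (by
      rw [hx]
      refine (hA _ (sobolevNorm_ofTest_lt Ω s p _)).trans ?_
      rw [hn, mul_one])
  rw [_root_.map_smul, _root_.map_smul, _root_.map_smul, smul_eq_mul, abs_mul,
    abs_of_pos (inv_pos.2 hr0), inv_mul_le_iff₀ hr0, mul_comm] at h
  rw [hrN, ← ofReal_norm, ← ENNReal.ofReal_coe_nnreal, ← ENNReal.ofReal_mul ε.coe_nonneg]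
  exact ENNReal.ofReal_le_ofReal h

theorem sobolevNorm_mul_restrict_lt (h1 : IsSmoothMultiplicationTriple Ω s p) (θ : 𝓓(Ω, ℝ))
    (f : StrongDual ℝ (SobolevComp Ω s p)) :
    sobolevNorm Ω (-s) p.conjExponent (mulDistribution θ (restrict Ω s p f)) < ∞ := by
  obtain ⟨A, hA⟩ := h1.exists_bound θ
  obtain ⟨C, hC⟩ := exists_bound f ⟨tsupport θ, θ.hasCompactSupport⟩ θ.tsupport_subset
  refine (sobolevNorm_mul_restrict_le (ε := C * A) hA fun x hx hxA => ?_).trans_lt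
    ENNReal.coe_lt_top
  refine (hC x hx).trans ?_
  rw [NNReal.coe_mul]
  exact mul_le_mul_of_nonneg_left (ENNReal.toReal_mono ENNReal.coe_ne_top hxA) C.coe_nonneg

theorem abs_apply_le (h1 : IsSmoothMultiplicationTriple Ω s p) {K V : Set (Rn n)}
    (hK : IsCompact K) (hKΩ : K ⊆ Ω) (hV : IsOpen V) (hKV : K ⊆ V) {θ : 𝓓(Ω, ℝ)}
    (hθ : ∀ x ∈ V, θ x = 1) (f : StrongDual ℝ (SobolevComp Ω s p)) (x : SobolevComp Ω s p)
    (hx : x.1 ∈ supportedIn Ω K) :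
    |f x| ≤ (sobolevNorm Ω (-s) p.conjExponent (mulDistribution θ (restrict Ω s p f))).toReal *
      (sobolevNorm Ω s p x.1).toReal := by
  obtain ⟨φ, hφ0, hφ⟩ := exists_seq_tendsto h1 hK hKΩ hV hKV hθ x hx
  have hM := sobolevNorm_mul_restrict_lt h1 θ f
  set m := sobolevNorm Ω (-s) p.conjExponent (mulDistribution θ (restrict Ω s p f))
  have hle (k : ℕ) : ‖f (testComp Ω s p (mulTest θ (φ k)))‖ₑ ≤
      m * (sobolevNorm Ω s p (x.1 - ofTest Ω (φ k)) + sobolevNorm Ω s p x.1) := by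
    have := (dualNorms_sobolevNorm Ω s p).enorm_apply_le θ.hasCompactSupport θ.tsupport_subset
      (mulDistribution_mem_supportedIn θ (restrict Ω s p f)) hM (φ k)
    rw [mulDistribution_apply, restrict_apply] at this
    refine this.trans (mul_le_mul_right ?_ m)
    have e : ofTest Ω (φ k) = (-1 : ℝ) • (x.1 - ofTest Ω (φ k)) + x.1 := by
      rw [neg_one_smul, neg_sub, sub_add_cancel]
    nth_rw 1 [e]
    refine ((sobolevNorm Ω s p).add_le' _ _).trans (add_le_add_left ?_ _)
    refine ((sobolevNorm Ω s p).smul_le' _ _).trans ?_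
    rw [enorm_neg, enorm_one, one_mul]
  have hl := ((f.continuous.tendsto x).comp hφ).enorm
  have hr := ENNReal.Tendsto.const_mul (hφ0.add_const (sobolevNorm Ω s p x.1)) (.inr hM.ne)
  rw [zero_add] at hr
  have := ENNReal.toReal_mono (ENNReal.mul_ne_top hM.ne x.2.1.ne) (le_of_tendsto_of_tendsto' hl hr hle)
  rw [ENNReal.toReal_mul, toReal_enorm] at this
  exact this

/-- An element of `W^{-s,p'}(Ω)` with compact support defines a continuous linear functional on
`W^{s,p}_comp(Ω)`. -/
theorem exists_dual {K : Set (Rn n)} (hK : IsCompact K) (hKΩ : K ⊆ Ω) {v : 𝓓'(Ω, ℝ)}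
    (hvK : v ∈ supportedIn Ω K) (hv : sobolevNorm Ω (-s) p.conjExponent v < ∞) :
    ∃ g : StrongDual ℝ (SobolevComp Ω s p), (∀ φ, g (testComp Ω s p φ) = v φ) ∧ ∀ x,
      |g x| ≤ (sobolevNorm Ω (-s) p.conjExponent v).toReal * (sobolevNorm Ω s p x.1).toReal := by
  let e : 𝓓(Ω, ℝ) →ₗ[ℝ] SobolevSpace Ω s p :=
    (ofTest Ω).codRestrict (sobolevNorm Ω s p).finite (sobolevNorm_ofTest_lt Ω s p)
  let l : 𝓓(Ω, ℝ) →ₗ[ℝ] ℝ :=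
    { toFun := fun φ => v φ
      map_add' := fun φ ψ => map_add v φ ψ
      map_smul' := fun c φ => _root_.map_smul v c φ }
  obtain ⟨g, hgC, hg⟩ := exists_dual_of_bound e l
    (sobolevNorm Ω (-s) p.conjExponent v).toNNReal fun φ => by
      rw [enorm_sobolevSpace, ENNReal.coe_toNNReal hv.ne]
      exact (dualNorms_sobolevNorm Ω s p).enorm_apply_le hK hKΩ hvK hv φ
  rw [ENNReal.coe_toNNReal hv.ne] at hgC
  let i : SobolevComp Ω s p →ₗ[ℝ] SobolevSpace Ω s p :=
    (compSubmodule Ω s p).subtype.codRestrict (sobolevNorm Ω s p).finite fun x => x.2.1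
  have hi : Continuous i := continuous_of_bound i fun K _ => ⟨1, fun x _ => by
    rw [one_mul]
    exact le_rfl⟩
  refine ⟨g.comp ⟨i, hi⟩, hg, fun x => (g.le_opNorm (i x)).trans ?_⟩
  refine mul_le_mul_of_nonneg_right ?_ (norm_nonneg _)
  have := ENNReal.toReal_mono hv.ne hgC
  rwa [toReal_enorm] at this

/-- Every element of `W^{-s,p'}_loc(Ω)` defines a continuous linear functional on
`W^{s,p}_comp(Ω)`. -/
theorem exists_restrict_eq (h1 : IsSmoothMultiplicationTriple Ω s p) (u : 𝓓'(Ω, ℝ))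
    (hu : ∀ θ : 𝓓(Ω, ℝ), sobolevNorm Ω (-s) p.conjExponent (mulDistribution θ u) < ∞) :
    ∃ f : StrongDual ℝ (SobolevComp Ω s p), restrict Ω s p f = u := by
  obtain ⟨L, hL, hLK⟩ := exists_compact_exhaustion Ω
  choose χ V hV hLV hχ using fun j => exists_cutoff (L j).isCompact (hL j)
  choose g hg hgb using fun j => exists_dual (χ j).hasCompactSupport (χ j).tsupport_subset
    (mulDistribution_mem_supportedIn (χ j) u) (hu (χ j))
  have hgu (j : ℕ) (φ : 𝓓(Ω, ℝ)) (hφ : tsupport φ ⊆ L j) : g j (testComp Ω s p φ) = u φ := by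
    rw [hg, mulDistribution_apply, mulTest_cutoff fun x hx => hχ j x (hLV j (hφ hx))]
  have hst (K : Compacts (Rn n)) (hK : (K : Set (Rn n)) ⊆ Ω) : ∃ i, ∀ j ≥ i,
      ∀ x : SobolevComp Ω s p, x.1 ∈ supportedIn Ω (K : Set (Rn n)) → g j x = g i x := by
    obtain ⟨θ, W, hW, hKW, hθ⟩ := exists_cutoff K.isCompact hK
    obtain ⟨i, hi⟩ := eventually_atTop.1 (hLK _ θ.hasCompactSupport θ.tsupport_subset)
    refine ⟨i, fun j hj x hx => eq_of_forall_test h1 K.isCompact hK hW hKW hθ (fun φ => ?_) x hx⟩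
    have ht := tsupport_mulTest_subset_left θ φ
    rw [hgu j _ (ht.trans (hi j hj)), hgu i _ (ht.trans (hi i le_rfl))]
  choose i hi using hst
  let K (x : SobolevComp Ω s p) : Compacts (Rn n) := x.2.2.choose
  have hK (x : SobolevComp Ω s p) : (K x : Set (Rn n)) ⊆ Ω := x.2.2.choose_spec.1
  have hxK (x : SobolevComp Ω s p) : x.1 ∈ supportedIn Ω (K x : Set (Rn n)) :=
    x.2.2.choose_spec.2
  obtain ⟨F, hF⟩ : ∃ F : SobolevComp Ω s p →ₗ[ℝ] ℝ, ∀ (K' : Compacts (Rn n))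
      (hK' : (K' : Set (Rn n)) ⊆ Ω) (x : SobolevComp Ω s p),
      x.1 ∈ supportedIn Ω (K' : Set (Rn n)) → F x = g (i K' hK') x := by
    refine ⟨linearMapOfTendsto (l := atTop) (fun x => g (i (K x) (hK x)) x)
      (fun j => (g j).toLinearMap) (tendsto_pi_nhds.2 fun x => tendsto_const_nhds.congr' <|
        (eventually_ge_atTop (i (K x) (hK x))).mono fun j hj => (hi _ _ j hj x (hxK x)).symm),
      fun K' hK' x hx => ?_⟩
    change g (i (K x) (hK x)) x = _
    rw [← hi _ (hK x) _ (le_max_left _ (i K' hK')) x (hxK x),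
      ← hi _ hK' _ (le_max_right (i (K x) (hK x)) _) x hx]
  have hFc : Continuous F := continuous_of_bound F fun L' hL' =>
    ⟨(sobolevNorm Ω (-s) p.conjExponent (mulDistribution (χ (i L' hL')) u)).toReal, fun x hx => by
      rw [hF L' hL' x hx]
      exact hgb (i L' hL') x⟩
  refine ⟨⟨F, hFc⟩, ?_⟩
  ext φ
  rw [restrict_apply]
  have hφK : (testComp Ω s p φ).1 ∈ supportedIn Ω (tsupport φ) :=
    ofTest_mem_supportedIn φ subset_rfl
  let Kφ : Compacts (Rn n) := ⟨tsupport φ, φ.hasCompactSupport⟩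
  obtain ⟨j, hj⟩ := eventually_atTop.1 (hLK _ φ.hasCompactSupport φ.tsupport_subset)
  refine (hF Kφ φ.tsupport_subset _ hφK).trans ?_
  rw [← hi Kφ φ.tsupport_subset _ (le_max_left _ j) _ hφK]
  exact hgu _ φ (hj _ (le_max_right _ _))

/-- The restriction to the test functions, as a map to `W^{-s,p'}_loc(Ω)`. -/
def toLoc (h1 : IsSmoothMultiplicationTriple Ω s p) :
    StrongDual ℝ (SobolevComp Ω s p) →ₗ[ℝ] SobolevLoc Ω (-s) p.conjExponent :=
  (restrict Ω s p).codRestrict (locSubmodule Ω (-s) p.conjExponent) fun f =>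
    (Submodule.mem_iInf _).2 fun θ => sobolevNorm_mul_restrict_lt h1 θ f

theorem toLoc_bijective (h1 : IsSmoothMultiplicationTriple Ω s p) :
    Function.Bijective (toLoc h1) := by
  constructor
  · refine (injective_iff_map_eq_zero (toLoc h1)).2 fun f hf => ?_
    have hf' : restrict Ω s p f = 0 := congrArg Subtype.val hf
    ext x
    obtain ⟨-, K, hK, hxK⟩ := x.2
    obtain ⟨θ, V, hV, hKV, hθ⟩ := exists_cutoff K.isCompact hK
    refine eq_of_forall_test h1 K.isCompact hK hV hKV hθ (fun φ => ?_) x hxK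
    rw [← restrict_apply, hf']
    rfl
  · intro u
    obtain ⟨f, hf⟩ := exists_restrict_eq h1 u.1 fun θ => (Submodule.mem_iInf _).1 u.2 θ
    exact ⟨f, Subtype.ext hf⟩

theorem continuous_toLoc (h1 : IsSmoothMultiplicationTriple Ω s p) : Continuous (toLoc h1) := by
  refine continuous_iInf_rng.2 fun θ => continuous_induced_rng.2 ?_
  change Continuous (SobolevLoc.mul Ω (-s) p.conjExponent θ ∘ₗ toLoc h1)
  refine continuous_of_continuousAt_zero _ ?_
  rw [ContinuousAt, map_zero, Metric.nhds_basis_closedBall.tendsto_right_iff]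
  intro ε hε
  obtain ⟨A, hA⟩ := h1.exists_bound θ
  filter_upwards [eventually_forall_abs_le (isVonNBounded_of_bound (s := s) (p := p)
    ⟨tsupport θ, θ.hasCompactSupport⟩ θ.tsupport_subset A) hε] with f hf
  rw [mem_closedBall_zero_iff]
  have := ENNReal.toReal_mono ENNReal.coe_ne_top
    (sobolevNorm_mul_restrict_le (ε := ⟨ε, hε.le⟩) hA fun x hx hxA => hf x ⟨hx, hxA⟩)
  exact this

theorem SobolevLoc.continuous_mul (θ : 𝓓(Ω, ℝ)) : Continuous (SobolevLoc.mul Ω s p θ) :=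
  continuous_iff_le_induced.2 (iInf_le _ θ)

/-- The dual of `W^{s,p}_comp(Ω)` is `W^{-s,p'}_loc(Ω)`. -/
def dualEquiv (h1 : IsSmoothMultiplicationTriple Ω s p) :
    SobolevLoc Ω (-s) p.conjExponent ≃L[ℝ] StrongDual ℝ (SobolevComp Ω s p) where
  toLinearEquiv := (LinearEquiv.ofBijective (toLoc h1) (toLoc_bijective h1)).symm
  continuous_invFun := continuous_toLoc h1
  continuous_toFun := by
    set e := LinearEquiv.ofBijective (toLoc h1) (toLoc_bijective h1)
    refine continuous_to_dual e.symm.toLinearMap fun B hB ε hε => ?_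
    obtain ⟨K, hK, R, hR⟩ := exists_bound_of_isVonNBounded h1 hB
    obtain ⟨θ, V, hV, hKV, hθ⟩ := exists_cutoff K.isCompact hK
    have ht : Tendsto (fun u => ‖SobolevLoc.mul Ω (-s) p.conjExponent θ u‖ * R) (𝓝 0) (𝓝 0) := by
      have := (((SobolevLoc.continuous_mul (s := -s) (p := p.conjExponent) θ).norm.mul_const
        (R : ℝ)).tendsto 0)
      rwa [map_zero, norm_zero, zero_mul] at this
    filter_upwards [ht.eventually_le_const hε] with u hu b hb
    refine le_trans ?_ hu
    have he : restrict Ω s p (e.symm u) = u.1 := congrArg Subtype.val (e.apply_symm_apply u)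
    have h := abs_apply_le h1 K.isCompact hK hV hKV hθ (e.symm u) b (hR b hb).1
    rw [he] at h
    refine h.trans (mul_le_mul_of_nonneg_left ?_ ENNReal.toReal_nonneg)
    exact ENNReal.toReal_mono ENNReal.coe_ne_top (hR b hb).2

theorem dualEquiv_apply_test (h1 : IsSmoothMultiplicationTriple Ω s p)
    (u : SobolevLoc Ω (-s) p.conjExponent) (φ : 𝓓(Ω, ℝ)) :
    dualEquiv h1 u (testComp Ω s p φ) = u.1 φ := by
  rw [← restrict_apply]
  have := (LinearEquiv.ofBijective (toLoc h1) (toLoc_bijective h1)).apply_symm_apply u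
  exact congrArg (fun v : SobolevLoc Ω (-s) p.conjExponent => v.1 φ) this

end SobolevComp

end Sobolev

end

noncomputable section

namespace Sobolev

open Filter Bornology

variable {n : ℕ} {Ω : Opens (Rn n)} {s p : ℝ} [Fact (1 < p)]

/-! ### Continuous linear functionals on `W^{s,p}_loc(Ω)` -/

namespace SobolevLoc

/-- The test functions in `W^{s,p}_loc(Ω)`. -/
def test (Ω : Opens (Rn n)) (s p : ℝ) [Fact (1 < p)] : 𝓓(Ω, ℝ) →ₗ[ℝ] SobolevLoc Ω s p :=
  (ofTest Ω).codRestrict (locSubmodule Ω s p) fun φ => (Submodule.mem_iInf _).2 fun θ => by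
    change sobolevNorm Ω s p (mulDistribution θ (ofTest Ω φ)) < ∞
    rw [mulDistribution_ofTest]
    exact sobolevNorm_ofTest_lt Ω s p _

theorem exists_cutoff_pair (θ₁ θ₂ : 𝓓(Ω, ℝ)) :
    ∃ χ : 𝓓(Ω, ℝ), mulTest χ θ₁ = θ₁ ∧ mulTest χ θ₂ = θ₂ := by
  obtain ⟨χ, V, -, hV, hχ⟩ := exists_cutoff
    (θ₁.hasCompactSupport.isCompact.union θ₂.hasCompactSupport.isCompact)
    (Set.union_subset θ₁.tsupport_subset θ₂.tsupport_subset)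
  exact ⟨χ, mulTest_cutoff fun x hx => hχ x (hV (.inl hx)),
    mulTest_cutoff fun x hx => hχ x (hV (.inr hx))⟩

theorem comap_mul_le (h : IsSmoothMultiplicationTriple Ω s p) {χ θ : 𝓓(Ω, ℝ)}
    (hχ : mulTest χ θ = θ) : comap (mul Ω s p χ) (𝓝 0) ≤ comap (mul Ω s p θ) (𝓝 0) := by
  obtain ⟨m, hm⟩ := h θ
  have e : ⇑(mul Ω s p θ) = m ∘ mul Ω s p χ := funext fun u => Subtype.ext <| by
    refine Eq.trans ?_ (hm _).symm
    ext ψ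
    change u.1 (mulTest θ ψ) = u.1 (mulTest χ (mulTest θ ψ))
    rw [mulTest_assoc, hχ]
  rw [e, ← comap_comap]
  refine comap_mono ?_
  rw [← tendsto_iff_comap]
  simpa using m.continuous.tendsto 0

/-- A continuous linear functional on `W^{s,p}_loc(Ω)` is bounded by one of the seminorms. -/
theorem exists_bound (h : IsSmoothMultiplicationTriple Ω s p) (Φ : StrongDual ℝ (SobolevLoc Ω s p)) :
    ∃ (χ : 𝓓(Ω, ℝ)) (C : ℝ≥0), ∀ u, |Φ u| ≤ C * ‖mul Ω s p χ u‖ := by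
  have hΦ : {u | |Φ u| < 1} ∈ 𝓝 (0 : SobolevLoc Ω s p) :=
    (Φ.continuous.abs.tendsto 0).eventually_lt_const (by simp)
  have hn : 𝓝 (0 : SobolevLoc Ω s p) = ⨅ θ, comap (mul Ω s p θ) (𝓝 0) := by
    refine nhds_iInf.trans (iInf_congr fun θ => ?_)
    rw [nhds_induced, map_zero]
  rw [hn, mem_iInf_of_directed] at hΦ
  · obtain ⟨χ, hχ⟩ := hΦ
    obtain ⟨r, hr, hrχ⟩ := (Metric.nhds_basis_ball.comap _).mem_iff.1 hχ
    refine ⟨χ, (r / 2).toNNReal⁻¹, fun u => ?_⟩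
    rw [NNReal.coe_inv, Real.coe_toNNReal _ (half_pos hr).le]
    by_contra! hu
    have h0 : 0 < |Φ u| := lt_of_le_of_lt (by positivity) hu
    rw [inv_mul_lt_iff₀ (half_pos hr)] at hu
    have hmem : |Φ (|Φ u|⁻¹ • u)| < 1 := hrχ (by
      rw [Set.mem_preimage, mem_ball_zero_iff, _root_.map_smul, norm_smul, norm_inv, Real.norm_eq_abs,
        abs_abs, inv_mul_lt_iff₀ h0]
      nlinarith)
    rw [_root_.map_smul, smul_eq_mul, abs_mul, abs_inv, abs_abs, inv_mul_cancel₀ h0.ne'] at hmem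
    exact lt_irrefl _ hmem
  · intro θ₁ θ₂
    obtain ⟨χ, hχ₁, hχ₂⟩ := exists_cutoff_pair θ₁ θ₂
    exact ⟨χ, comap_mul_le h hχ₁, comap_mul_le h hχ₂⟩

/-- The test functions are dense in `W^{-s,p'}_loc(Ω)`. -/
theorem eq_zero_of_forall_test (h : IsSmoothMultiplicationTriple Ω (-s) p.conjExponent)
    (Φ : StrongDual ℝ (SobolevLoc Ω (-s) p.conjExponent))
    (hΦ : ∀ φ, Φ (test Ω (-s) p.conjExponent φ) = 0) : Φ = 0 := by
  obtain ⟨χ, C, hC⟩ := exists_bound h Φ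
  obtain ⟨A, hA⟩ := h.exists_bound χ
  obtain ⟨χ', V, -, hV, hχ'⟩ := exists_cutoff χ.hasCompactSupport χ.tsupport_subset
  ext u
  have hu : sobolevNorm Ω (-s) p.conjExponent (mulDistribution χ' u.1) < ∞ :=
    (Submodule.mem_iInf _).1 u.2 χ'
  have hle (ε : ℝ≥0) (hε : 0 < ε) : |Φ u| ≤ C * (A * ε) := by
    obtain ⟨φ, hφ⟩ := (dualNorms_sobolevNorm Ω s p).dense_right _ χ'.hasCompactSupport
      χ'.tsupport_subset _ (mulDistribution_mem_supportedIn χ' u.1) hu ε (by simpa using hε)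
    have e : Φ u = Φ (u - test Ω (-s) p.conjExponent φ) := by rw [map_sub, hΦ, sub_zero]
    rw [e]
    refine (hC _).trans (mul_le_mul_of_nonneg_left ?_ C.coe_nonneg)
    have e' : (mul Ω (-s) p.conjExponent χ (u - test Ω (-s) p.conjExponent φ)).1 =
        mulDistribution χ (mulDistribution χ' u.1 - ofTest Ω φ) := by
      change mulDistribution χ (u.1 - ofTest Ω φ) = _
      rw [map_sub, map_sub]
      congr 1
      ext ψ
      simp only [mulDistribution_apply]
      rw [mulTest_assoc, mulTest_cutoff fun x hx => hχ' x (hV hx)]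
    have h1 : ‖mul Ω (-s) p.conjExponent χ (u - test Ω (-s) p.conjExponent φ)‖ₑ ≤ (A * ε : ℝ≥0) := by
      rw [enorm_sobolevSpace, e', ENNReal.coe_mul]
      exact (hA _ (hφ.trans ENNReal.coe_lt_top)).trans (mul_le_mul_right hφ.le _)
    exact_mod_cast h1
  have ht : Tendsto (fun ε : ℝ≥0 => (C * (A * ε) : ℝ)) (𝓝[>] 0) (𝓝 (C * (A * (0 : ℝ≥0)))) := by
    refine Tendsto.mono_left ?_ nhdsWithin_le_nhds
    exact (continuous_const.mul (continuous_const.mul NNReal.continuous_coe)).tendsto 0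
  have := ge_of_tendsto ht (eventually_mem_nhdsWithin.mono fun ε hε => hle ε hε)
  rw [NNReal.coe_zero, mul_zero, mul_zero] at this
  exact abs_nonpos_iff.1 this

end SobolevLoc

/-! ### Reflexivity -/

namespace SobolevComp

theorem dualEquiv_test (h1 : IsSmoothMultiplicationTriple Ω s p) (φ : 𝓓(Ω, ℝ)) :
    dualEquiv h1 (SobolevLoc.test Ω (-s) p.conjExponent φ) = eval Ω s p φ := by
  refine (dualEquiv h1).symm.injective ?_
  rw [ContinuousLinearEquiv.symm_apply_apply]
  refine Subtype.ext ?_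
  ext ψ
  refine Eq.trans ?_ (restrict_apply (eval Ω s p φ) ψ).symm
  change ofTest Ω φ ψ = ofTest Ω ψ φ
  simp only [ofTest_apply, mul_comm]

theorem isSemireflexive (h1 : IsSmoothMultiplicationTriple Ω s p)
    (h2 : IsSmoothMultiplicationTriple Ω (-s) p.conjExponent) :
    IsSemireflexive (SobolevComp Ω s p) := by
  constructor
  · refine (injective_iff_map_eq_zero (evalBidual (SobolevComp Ω s p))).2 fun x hx => ?_
    refine Subtype.ext ?_
    ext φ
    exact congrArg (fun Ψ : StrongDual ℝ (StrongDual ℝ (SobolevComp Ω s p)) => Ψ (eval Ω s p φ)) hx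
  · intro Ψ
    let Φ : StrongDual ℝ (SobolevLoc Ω (-s) p.conjExponent) :=
      Ψ.comp (dualEquiv h1).toContinuousLinearMap
    obtain ⟨χ, C, hC⟩ := SobolevLoc.exists_bound h2 Φ
    obtain ⟨A, hA⟩ := h2.exists_bound χ
    let l : 𝓓(Ω, ℝ) →ₗ[ℝ] ℝ := Φ.toLinearMap ∘ₗ SobolevLoc.test Ω (-s) p.conjExponent
    have hl (φ : 𝓓(Ω, ℝ)) :
        ‖l φ‖ₑ ≤ (C * A : ℝ≥0) * sobolevNorm Ω (-s) p.conjExponent (ofTest Ω φ) := by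
      have h : ‖l φ‖ₑ ≤ C * sobolevNorm Ω (-s) p.conjExponent (mulDistribution χ (ofTest Ω φ)) := by
        have e := enorm_sobolevSpace
          (SobolevLoc.mul Ω (-s) p.conjExponent χ (SobolevLoc.test Ω (-s) p.conjExponent φ))
        refine le_of_le_of_eq (b := C * ‖SobolevLoc.mul Ω (-s) p.conjExponent χ
          (SobolevLoc.test Ω (-s) p.conjExponent φ)‖ₑ) ?_ (congrArg (fun t : ℝ≥0∞ => C * t) e)
        rw [← ofReal_norm, ← ofReal_norm, ← ENNReal.ofReal_coe_nnreal,
          ← ENNReal.ofReal_mul C.coe_nonneg]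
        exact ENNReal.ofReal_le_ofReal (hC _)
      refine h.trans ?_
      rw [ENNReal.coe_mul, mul_assoc]
      exact mul_le_mul_right (hA _ (sobolevNorm_ofTest_lt Ω _ _ φ)) _
    obtain ⟨x, hx⟩ := (TestContinuous.sobolevNorm (-s) p.conjExponent).exists_distribution l
      fun K _ => ⟨(C * A : ℝ≥0), fun φ _ => by
        have := ENNReal.toReal_mono (ENNReal.mul_ne_top ENNReal.coe_ne_top
          (sobolevNorm_ofTest_lt Ω (-s) p.conjExponent φ).ne) (hl φ)
        rwa [ENNReal.toReal_mul, toReal_enorm] at this⟩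
    have hxN : sobolevNorm Ω s p x < ∞ := by
      refine ((dualNorms_sobolevNorm Ω s p).le_left x (C * A) fun ψ => ?_).1.trans_lt
        ENNReal.coe_lt_top
      rw [hx]
      exact hl ψ
    have hxχ : x ∈ supportedIn Ω (tsupport χ) := by
      intro y hy
      by_contra hyχ
      refine (Distribution.notMem_dsupport_iff y).2 ⟨(tsupport χ)ᶜ, fun φ hφ => ?_,
        (isClosed_tsupport χ).isOpen_compl, hyχ⟩ hy
      rw [hx]
      have e : mulTest χ φ = 0 := mulTest_eq_zero hφ
      have e' : SobolevLoc.mul Ω (-s) p.conjExponent χ (SobolevLoc.test Ω (-s) p.conjExponent φ) =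
          0 := by
        refine Subtype.ext ?_
        change mulDistribution χ (ofTest Ω φ) = 0
        rw [mulDistribution_ofTest, e, map_zero]
      have := hC (SobolevLoc.test Ω (-s) p.conjExponent φ)
      rw [e', norm_zero, mul_zero] at this
      exact abs_nonpos_iff.1 this
    let X : SobolevComp Ω s p :=
      ⟨x, hxN, ⟨tsupport χ, χ.hasCompactSupport⟩, χ.tsupport_subset, hxχ⟩
    refine ⟨X, ?_⟩
    have h0 := SobolevLoc.eq_zero_of_forall_test h2
      ((evalBidual _ X).comp (dualEquiv h1).toContinuousLinearMap - Φ) fun φ => by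
        rw [_root_.sub_apply, sub_eq_zero]
        change dualEquiv h1 (SobolevLoc.test Ω (-s) p.conjExponent φ) X = l φ
        rw [dualEquiv_test]
        exact hx φ
    ext f
    have := congrArg (fun Λ : StrongDual ℝ (SobolevLoc Ω (-s) p.conjExponent) =>
      Λ ((dualEquiv h1).symm f)) (sub_eq_zero.1 h0)
    change evalBidual _ X (dualEquiv h1 ((dualEquiv h1).symm f)) =
      Ψ (dualEquiv h1 ((dualEquiv h1).symm f)) at this
    rwa [ContinuousLinearEquiv.apply_symm_apply] at this

theorem isReflexive (h1 : IsSmoothMultiplicationTriple Ω s p)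
    (h2 : IsSmoothMultiplicationTriple Ω (-s) p.conjExponent) : IsReflexive (SobolevComp Ω s p) := by
  refine (isSemireflexive h1 h2).isReflexive ?_
  refine continuous_of_comp (F := StrongDual ℝ (StrongDual ℝ (SobolevComp Ω s p))) _ fun K hK => ?_
  exact continuous_evalBidual_comp ⟨SobolevSupp.toComp Ω s p K hK, continuous_toComp K hK⟩

end SobolevComp

end Sobolev

end

theorem mainTheorem4 (n : ℕ) (hn : 0 < n) (Ω : TopologicalSpace.Opens (Sobolev.Rn n))
    (hΩ : (Ω : Set (Sobolev.Rn n)).Nonempty) (s p : ℝ) [Fact (1 < p)]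
    (h1 : Sobolev.IsSmoothMultiplicationTriple Ω s p)
    (h2 : Sobolev.IsSmoothMultiplicationTriple Ω (-s) p.conjExponent) :
    Sobolev.IsSemireflexive (Sobolev.SobolevComp Ω s p) ∧
    Sobolev.IsReflexive (Sobolev.SobolevComp Ω s p) ∧
    (∃ T : Sobolev.SobolevLoc Ω (-s) p.conjExponent ≃L[ℝ]
        StrongDual ℝ (Sobolev.SobolevComp Ω s p),
      ∀ (u : Sobolev.SobolevLoc Ω (-s) p.conjExponent) (φ : 𝓓(Ω, ℝ)),
        T u (Sobolev.testComp Ω s p φ) = (u : 𝓓'(Ω, ℝ)) φ) ∧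
    Sobolev.IsReflexive (Sobolev.SobolevLoc Ω (-s) p.conjExponent) := by
  have hr := Sobolev.SobolevComp.isReflexive h1 h2
  exact ⟨Sobolev.SobolevComp.isSemireflexive h1 h2, hr,
    ⟨Sobolev.SobolevComp.dualEquiv h1, Sobolev.SobolevComp.dualEquiv_apply_test h1⟩,
    hr.dual.congr (Sobolev.SobolevComp.dualEquiv h1).symm⟩
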